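/- **Notation.** For a finite simple connected graph $G=(V,E)$ with $\#V\ge 2$, the lazy random walk $W=(W(n))_{n\ge 0}$ on $G$ stays put with probability $\tfrac12$ and jumps to each neighbour of the current vertex $x$ with probability $\tfrac1{2\deg x}$; $\mathbb P_\varrho$ is its law started at $\varrho$. Let $\pi^G(x)=\deg(x)/(2\#E)$ and $$t^G_{\rm mix}=\min\Big\{n\in\mathbb N_0:\ \max_{x,y\in V}\Big|\tfrac{\mathbb P_x(W(n)=y)}{\pi^G(y)}-1\Big|\le\tfrac14\Big\}.$$ For a path $\gamma:\mathbb N_0\to V$ and $A\subseteq\mathbb N_0$ let ${\rm R}^\gamma(A)=\{\gamma(n):n\in A\}$. For a finite interval $A$ put ${\rm NE}^{\gamma,A}(\min A)=\{\min A\}$ and, for $n\in[\min A+1,\max A]$, $${\rm NE}^{\gamma,A}(n)=\{m\in{\rm NE}^{\gamma,A}(n-1):\gamma(n)\notin{\rm R}^\gamma({\rm NE}^{\gamma,A}(n-1)\cap[\min A,m])\}\cup\{n\}$$ (the time indices not erased by chronological loop erasure), and for $s\in\mathbb N_0$ let $${\rm NE}^{\gamma,s}(A)=\{m\in[\min A+s,\max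 A-s]:\ {\rm R}^\gamma({\rm NE}^{\gamma,[m-s,m]}(m))\cap{\rm R}^\gamma([m+1,m+s])=\emptyset\}.$$ For $i\ge1$ let $A_i^{(r,s)}=[(i-1)r+s,\,ir-1]$ and $B_i^{(r,s)}=[(i-1)r+2s,\,ir-s-1]$, and for $1\le i<j$ $$Z^{\gamma,(r,s)}_{(i,j)}=\mathbf 1\{{\rm R}^\gamma({\rm NE}^{\gamma,s}(A_i^{(r,s)}))\cap{\rm R}^\gamma(B_j^{(r,s)})\ne\emptyset\}.$$ For $c>0$ and a set $\Pi\subset\mathbb R^2$ let $$Z^{\Pi,c}_{(i,j)}=\mathbf 1\{\Pi\cap([(j-1)c,jc)\times[(i-1)c,ic))\ne\emptyset\}.$$ **Proposition (coupling of the cut-times and cut-points).** Let $(G_N)$, $G_N=(V_N,E_N)$, be a sequence of finite simple connected regular graphs with $\#V_N\ge2$, and let $(s'_N),(s_N),(r_N)$ be sequences of natural numbers such that, as $N\to\infty$, $$1\ll\Big(\tfrac{\ln(2\#V_N)}{\ln4}\Big)^2t^{G_N}_{\rm mix}\ll\tfrac{\ln(2\#V_N)}{\ln4}\,s'_N\ll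 s_N\ll r_N\ll(\#V_N)^{1/2},$$ where $a_N\ll b_N$ means $a_N=o(b_N)$. Suppose that there is a $\theta>0$ with $$\sup_{N\ge1}\ \sup_{\varrho\in V_N}\ \sum_{i=0}^{t^{G_N}_{\rm mix}}\sum_{j=0}^{t^{G_N}_{\rm mix}}\mathbb P_\varrho\big(W_N(i+j)=\varrho\big)\le\theta ,$$ where $W_N$ denotes the lazy random walk on $G_N$. Define $c_N\ge0$ by $$c_N^2=-\ln\mathbb P_{\pi^{G_N}\otimes\pi^{G_N}}\Big({\rm R}^{W^1_N}(A_1^{(r_N,s_N)})\cap{\rm R}^{W^2_N}({\rm NE}^{W^2_N,s_N}(A_1^{(r_N,s_N)}))=\emptyset\Big),$$ where $W^1_N,W^2_N$ are independent lazy random walks on $G_N$ started from $\pi^{G_N}$. Let $\varrho_N\in V_N$, let $W_N$ be started at $\varrho_N$, and let $\Pi$ be a Poisson point process on $\{(t,x):t\ge0,\ 0<x\le t\}$ with Lebesgue intensity. Then for every $T\ge0$ one can, for each $N$, couple $W_N$ and $\Pi$ (that is, find a joint law with the prescribed marginal laws) in such a way that $$\mathbb P\Big(Z^{W_N,(r_N,s_N)}_{(i,j)}=Z^{\Pi,c_N}_{(i,j)}\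 \text{ for all }1\le i<j\le\lfloor T/c_N\rfloor\Big)\longrightarrow1\qquad(N\to\infty).$$ (Under the hypotheses $c_N>0$ for all large $N$ and $c_N\to0$; the finitely many other $N$ are irrelevant.) -/

import Mathlib

open MeasureTheory ProbabilityTheory Filter Topology Asymptotics
open scoped ENNReal NNReal

noncomputable section

namespace CutCoupling

/-! ### The lazy random walk -/

section Walk

variable {V : Type*} [Fintype V] [DecidableEq V]

/-- One-step transition probabilities of the lazy random walk: stay put with probability `1/2`,
jump to each neighbour with probability `1/(2 deg x)`. (An isolated vertex, which a connected graph
with at least two vertices does not have, is made absorbing, so that the rows always sum to `1`.) -/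
def stepProb (G : SimpleGraph V) [DecidableRel G.Adj] (x y : V) : ℝ≥0∞ :=
  if x = y then (if G.degree x = 0 then 1 else 2⁻¹)
  else if G.Adj x y then (2 * (G.degree x : ℝ≥0∞))⁻¹ else 0

theorem sum_stepProb (G : SimpleGraph V) [DecidableRel G.Adj] (x : V) :
    ∑ y, stepProb G x y = 1 := by
  have h1 : ∀ y, stepProb G x y = (if x = y then (if G.degree x = 0 then 1 else 2⁻¹) else 0)
      + (if G.Adj x y then (2 * (G.degree x : ℝ≥0∞))⁻¹ else 0) := by
    intro y
    unfold stepProb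
    by_cases h : x = y
    · subst h; simp
    · simp [h]
  simp_rw [h1]
  rw [Finset.sum_add_distrib, Finset.sum_ite_eq, ← Finset.sum_filter, Finset.sum_const,
    ← SimpleGraph.neighborFinset_eq_filter, SimpleGraph.card_neighborFinset_eq_degree]
  by_cases hd : G.degree x = 0
  · simp [hd]
  · have hd0 : (G.degree x : ℝ≥0∞) ≠ 0 := by exact_mod_cast hd
    have hdt : (G.degree x : ℝ≥0∞) ≠ ∞ := ENNReal.natCast_ne_top _
    rw [ENNReal.mul_inv (by simp) (by simp), nsmul_eq_mul, mul_left_comm,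
      ENNReal.mul_inv_cancel hd0 hdt]
    simp [hd, ENNReal.inv_two_add_inv_two]

/-- The law of one step of the lazy random walk from `x`. -/
def stepPMF (G : SimpleGraph V) [DecidableRel G.Adj] (x : V) : PMF V :=
  PMF.ofFintype (stepProb G x) (sum_stepProb G x)

variable [MeasurableSpace V] [MeasurableSingletonClass V]

/-- The transition kernel of the lazy random walk. -/
def stepKernel (G : SimpleGraph V) [DecidableRel G.Adj] : Kernel V V :=
  Kernel.ofFunOfCountable fun x => (stepPMF G x).toMeasure

instance (G : SimpleGraph V) [DecidableRel G.Adj] : IsMarkovKernel (stepKernel G) :=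
  ⟨fun x => inferInstanceAs (IsProbabilityMeasure (stepPMF G x).toMeasure)⟩

/-- The next vertex, given the whole history up to time `n`: it depends on the present only. -/
def historyKernel (G : SimpleGraph V) [DecidableRel G.Adj] (n : ℕ) :
    Kernel ((_ : Finset.Iic n) → V) V :=
  (stepKernel G).comap (fun h => h ⟨n, Finset.mem_Iic.2 le_rfl⟩) (measurable_pi_apply _)

instance (G : SimpleGraph V) [DecidableRel G.Adj] (n : ℕ) : IsMarkovKernel (historyKernel G n) := by
  unfold historyKernel; infer_instance

/-- The law, on the space of vertex sequences `ℕ → V`, of the lazy random walk on `G` whose initial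
vertex has law `ν`. -/
def walkLaw (G : SimpleGraph V) [DecidableRel G.Adj] (ν : Measure V) : Measure (ℕ → V) :=
  ν.bind fun x => Kernel.traj (X := fun _ => V) (historyKernel G) 0 (fun _ => x)

/-- The degree distribution `π(x) = deg x / (2 #E)`. -/
def statProb (G : SimpleGraph V) [DecidableRel G.Adj] (x : V) : ℝ :=
  (G.degree x : ℝ) / (2 * (G.edgeFinset.card : ℝ))

/-- The degree distribution as a measure. -/
def statMeasure (G : SimpleGraph V) [DecidableRel G.Adj] : Measure V :=
  ∑ x, ENNReal.ofReal (statProb G x) • Measure.dirac x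

/-- `P_x(W(n) = y)` for the lazy random walk `W`. -/
def transProb (G : SimpleGraph V) [DecidableRel G.Adj] (n : ℕ) (x y : V) : ℝ :=
  (walkLaw G (Measure.dirac x)).real {w | w n = y}

/-- The uniform (`ℓ_∞`) mixing time at level `1/4`. -/
def mixTime (G : SimpleGraph V) [DecidableRel G.Adj] : ℕ :=
  sInf {n : ℕ | ∀ x y : V, |transProb G n x y / statProb G y - 1| ≤ 1 / 4}

/-- `∑_{i=0}^{m} ∑_{j=0}^{m} P_ρ(W(i+j) = ρ)`. -/
def returnSum (G : SimpleGraph V) [DecidableRel G.Adj] (m : ℕ) (ρ : V) : ℝ :=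
  ∑ i ∈ Finset.range (m + 1), ∑ j ∈ Finset.range (m + 1), transProb G (i + j) ρ ρ

end Walk

/-! ### Loop erasure and the segments of a path -/

section Path

variable {V : Type*} [DecidableEq V]

/-- The range of the path `γ` over the set `A` of times. -/
def pathRange (γ : ℕ → V) (A : Finset ℕ) : Finset V := A.image γ

/-- `nonErased γ a k` is the set of time indices in `[a, a + k]` which are not erased when the path
`γ(a), γ(a+1), …, γ(a+k)` is loop-erased in chronological order. -/
def nonErased (γ : ℕ → V) (a : ℕ) : ℕ → Finset ℕ
  | 0 => {a}
  | k + 1 => insert (a + k + 1) {m ∈ nonErased γ a k |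
      γ (a + k + 1) ∉ pathRange γ {l ∈ nonErased γ a k | l ≤ m}}

/-- The `(A, s)`-locally non-erased time indices of `γ`, for a finite interval `A`: those
`m ∈ [min A + s, max A - s]` such that the loop erasure of `γ(m-s), …, γ(m)` is not hit by `γ`
during `[m + 1, m + s]`. -/
def locNonErased (γ : ℕ → V) (s : ℕ) (A : Finset ℕ) : Finset ℕ :=
  {m ∈ A | (∃ a ∈ A, a + s ≤ m) ∧ (∃ b ∈ A, m + s ≤ b) ∧
    pathRange γ (nonErased γ (m - s) s) ∩ pathRange γ (Finset.Icc (m + 1) (m + s)) = ∅}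

/-- The `i`-th segment `A_i = [(i-1) r + s, i r - 1]`, `i ≥ 1`. -/
def segA (r s i : ℕ) : Finset ℕ := Finset.Ico ((i - 1) * r + s) (i * r)

/-- The shortened `i`-th segment `B_i = [(i-1) r + 2 s, i r - s - 1]`, `i ≥ 1`. -/
def segB (r s i : ℕ) : Finset ℕ := Finset.Ico ((i - 1) * r + 2 * s) (i * r - s)

/-- The indicator that the path, during the segment `B_j`, hits the locally non-erased part of its
segment `A_i`. -/
def pathZ (r s : ℕ) (γ : ℕ → V) (i j : ℕ) : ℕ :=
  if pathRange γ (locNonErased γ s (segA r s i)) ∩ pathRange γ (segB r s j) ≠ ∅ then 1 else 0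

end Path

/-- The constant `c` given by
`c² = -ln P_{π⊗π}(R^{W¹}(A_1) ∩ R^{W²}(NE^{W²,s}(A_1)) = ∅)`,
for two independent stationary lazy random walks `W¹`, `W²` on `G`. -/
def cutScale {V : Type*} [Fintype V] [DecidableEq V] [MeasurableSpace V]
    [MeasurableSingletonClass V] (G : SimpleGraph V) [DecidableRel G.Adj] (r s : ℕ) : ℝ :=
  √(-Real.log (((walkLaw G (statMeasure G)).prod (walkLaw G (statMeasure G))).real
    {w | pathRange w.1 (segA r s 1) ∩ pathRange w.2 (locNonErased w.2 s (segA r s 1)) = ∅}))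

/-! ### The Poisson point process and its squares -/

/-- `Pi` is, under the probability measure `P`, a Poisson point process (a random set of points)
with intensity measure `μ`: the numbers of points in measurable sets are random variables, they are
Poisson with parameter `μ B` for every measurable `B` of finite `μ`-measure, and they are
independent for disjoint sets. -/
structure IsPoissonProcess {Ω E : Type*} [MeasurableSpace Ω] [MeasurableSpace E]
    (Pi : Ω → Set E) (μ : Measure E) (P : Measure Ω) : Prop where
  measurable_count : ∀ B : Set E, MeasurableSet B → Measurable fun ω => (Pi ω ∩ B).encard
  map_count : ∀ B : Set E, MeasurableSet B → μ B ≠ ∞ →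
    P.map (fun ω => (Pi ω ∩ B).encard) =
      (poissonMeasure (μ B).toNNReal).map (Nat.cast : ℕ → ℕ∞)
  indep_count : ∀ (n : ℕ) (B : Fin n → Set E), (∀ k, MeasurableSet (B k)) →
    Pairwise (fun k l => Disjoint (B k) (B l)) →
      iIndepFun (fun k ω => (Pi ω ∩ B k).encard) P

/-- The octant `Δ = {(t, x) : t ≥ 0, 0 < x ≤ t}`. -/
def octant : Set (ℝ × ℝ) := {p | 0 ≤ p.1 ∧ 0 < p.2 ∧ p.2 ≤ p.1}

/-- The square `{(x, y) : (j-1) c ≤ x < j c, (i-1) c ≤ y < i c}`. -/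
def square (c : ℝ) (i j : ℕ) : Set (ℝ × ℝ) :=
  {p | ((j : ℝ) - 1) * c ≤ p.1 ∧ p.1 < j * c ∧ ((i : ℝ) - 1) * c ≤ p.2 ∧ p.2 < i * c}

open Classical in
/-- The indicator that the point cloud `p` has a point in the `(i, j)`-th square of side `c`. -/
def cloudZ (c : ℝ) (p : Set (ℝ × ℝ)) (i j : ℕ) : ℕ :=
  if (p ∩ square c i j).Nonempty then 1 else 0

/-- `Q` is a coupling of `μ` and `ν`. -/
def IsCoupling {X Y : Type*} [MeasurableSpace X] [MeasurableSpace Y]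
    (Q : Measure (X × Y)) (μ : Measure X) (ν : Measure Y) : Prop :=
  Q.map Prod.fst = μ ∧ Q.map Prod.snd = ν

/-- `ln (2 #V) / ln 4`. -/
def logSize (V : Type*) [Fintype V] : ℝ := Real.log (2 * (Fintype.card V : ℝ)) / Real.log 4

end CutCoupling

end

set_option linter.unusedSectionVars false

noncomputable section

namespace CutCoupling

/-! ### Finite-horizon events and the Markov property -/

/-! Write `n` for the number of vertices and `x = r/√n`. Regularity makes the transition
probabilities symmetric and the stationary law uniform (`SymmWalk`). The indicator for `(i, j)`
depends on two segments of the walk, and consecutive segments are separated by `s` steps. As `s`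
eventually exceeds `⌊logSize⌋ + 1` mixing times, a gap forgets the past up to a relative error
`1/n`, so the law of the first `M` segments is at least `(1 - 1/n)^M` times the product of
stationary segment laws (`le_walkFrom_blocks`). This one-sided bound suffices, since total variation
between probability laws is an excess in one direction.

For independent segments a union bound makes each indicator have conditional probability at most `p
= r²/n`, whichever of its two segments is frozen. The indicators are replaced one at a time by
independent Bernoulli variables of parameter `q = cutHit` (`abs_piExp_sub_bern_le`). Each
replacement costs a bias of order `sr/n`, from the shortening of the hitting segment, plus `O(M p²)`
from the `O(M)` pairs sharing an index. On the Poisson side the squares are disjoint of area `c²`,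
hence occupied independently with probability `1 - exp(-c²)`, which is exactly `q` by the choice of
`c` (`real_squareArray`). The two finite arrays are thus close in total variation, and a maximal
coupling of them lifts to a coupling of walk and process (`exists_isCoupling_le`).

The total error is of order `M/n + M² sr/n + M³ r⁴/n²` with `M ≤ T/c`. It is `O(x + s/r)` once `c`
is at least of order `x`, that is, once `q ≥ const · r²/n` (`hitConst_mul_le_cutHit`). This comes
from two second-moment arguments. Two stationary walks meet within `r` steps with probability at
least of order `r²/n`, because the return sums bound the second moment of the number of meetings. At
a last meeting, the past of one walk spliced to the future of the other is a single walk avoiding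
its own past, so such avoidance over windows of length `s` has probability bounded below
(`le_statWalk_avoid`). A time with disjoint windows is locally non-erased, and `le_cutHit` repeats
the second-moment argument for meetings at locally non-erased times. -/

theorem measureReal_eq_sum_fiber {Ω U : Type*} [MeasurableSpace Ω] [Fintype U] (μ : Measure Ω)
    [IsFiniteMeasure μ] (X : Ω → U) (hX : ∀ u, MeasurableSet {ω | X ω = u}) (E : Set Ω) :
    μ.real E = ∑ u, μ.real (E ∩ {ω | X ω = u}) := by
  have h := sum_measureReal_preimage_singleton (μ := μ.restrict E) (f := X) Finset.univ
    (fun y _ => hX y)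
  simp only [Finset.coe_univ, Set.preimage_univ] at h
  rw [measureReal_restrict_apply MeasurableSet.univ, Set.univ_inter] at h
  rw [← h]
  refine Finset.sum_congr rfl fun u _ => ?_
  change (μ.restrict E).real {ω | X ω = u} = _
  rw [measureReal_restrict_apply (hX u), Set.inter_comm]

variable {V : Type*}

/-- The path seen from time `k` on. -/
def shiftPath (k : ℕ) (w : ℕ → V) : ℕ → V := fun i => w (i + k)

theorem shiftPath_add (j k : ℕ) (w : ℕ → V) :
    shiftPath j (shiftPath k w) = shiftPath (j + k) w := by
  funext i; simp [shiftPath, add_assoc]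

/-- The event `E` depends on the path up to time `k` only. -/
def UpTo (k : ℕ) (E : Set (ℕ → V)) : Prop :=
  ∀ ⦃w w' : ℕ → V⦄, (∀ i ≤ k, w i = w' i) → w ∈ E → w' ∈ E

theorem UpTo.inter {k : ℕ} {E F : Set (ℕ → V)} (hE : UpTo k E) (hF : UpTo k F) :
    UpTo k (E ∩ F) :=
  fun _ _ hw h => ⟨hE hw h.1, hF hw h.2⟩

theorem UpTo.mono {k l : ℕ} {E : Set (ℕ → V)} (hE : UpTo k E) (h : k ≤ l) : UpTo l E :=
  fun _ _ hw hwE => hE (fun i hi => hw i (hi.trans h)) hwE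

theorem UpTo.shift {k : ℕ} {E : Set (ℕ → V)} (hE : UpTo k E) (j : ℕ) :
    UpTo (k + j) (shiftPath j ⁻¹' E) :=
  fun _ _ hw hwE => hE (fun i hi => hw (i + j) (by omega)) hwE

theorem upTo_eval {k i : ℕ} (h : i ≤ k) (p : V → Prop) : UpTo k {w : ℕ → V | p (w i)} := by
  intro w w' hw hwE
  simpa only [Set.mem_ofPred_eq, ← hw i h] using hwE

/-- The paths which agree with `v` up to time `k`. -/
def cyl (k : ℕ) (v : ℕ → V) : Set (ℕ → V) := {w | ∀ i ≤ k, w i = v i}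

theorem upTo_cyl (k : ℕ) (v : ℕ → V) : UpTo k (cyl k v) :=
  fun _ _ hw h i hi => (hw i hi).symm.trans (h i hi)

variable [MeasurableSpace V]

theorem measurable_shiftPath (k : ℕ) : Measurable (shiftPath k : (ℕ → V) → ℕ → V) :=
  measurable_pi_iff.2 fun i => measurable_pi_apply (i + k)

variable [Fintype V] [MeasurableSingletonClass V]

/-- Such an event is the preimage of a set of words of length `k + 1`, and there are finitely many
words. -/
theorem UpTo.measurableSet {k : ℕ} {E : Set (ℕ → V)} (hE : UpTo k E) : MeasurableSet E := by
  have : E = (fun (w : ℕ → V) (i : Finset.Iic k) => w i) ⁻¹'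
      ((fun (w : ℕ → V) (i : Finset.Iic k) => w i) '' E) := by
    refine Set.Subset.antisymm (Set.subset_preimage_image _ _) ?_
    rintro w ⟨w', hw', h⟩
    exact hE (fun i hi => congrFun h ⟨i, Finset.mem_Iic.2 hi⟩) hw'
  rw [this]
  exact (measurable_pi_iff.2 fun i => measurable_pi_apply _) (Set.toFinite _).measurableSet

theorem measurableSet_cyl (k : ℕ) (v : ℕ → V) : MeasurableSet (cyl k v) :=
  (upTo_cyl k v).measurableSet

/-- Cylinders fix the law of every initial piece of the path, every finite set of times lies in an
initial piece, and projective limits are unique. -/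
theorem ext_of_cyl [Nonempty V] {μ ν : Measure (ℕ → V)} [IsFiniteMeasure μ] [IsFiniteMeasure ν]
    (h : ∀ k v, μ (cyl k v) = ν (cyl k v)) : μ = ν := by
  have key : ∀ k, μ.map (Preorder.frestrictLe (π := fun _ => V) k)
      = ν.map (Preorder.frestrictLe (π := fun _ => V) k) := by
    intro k
    refine Measure.ext_of_singleton fun u => ?_
    obtain ⟨x⟩ := ‹Nonempty V›
    have hu : Preorder.frestrictLe (π := fun _ => V) k ⁻¹' {u} = cyl k
        (fun i => if hi : i ≤ k then u ⟨i, Finset.mem_Iic.2 hi⟩ else x) := by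
      ext w
      simp only [Set.mem_preimage, Set.mem_singleton_iff, cyl, Set.mem_ofPred_eq]
      constructor
      · rintro rfl i hi
        simp [hi]
      · intro hw
        funext i
        have := hw i (Finset.mem_Iic.1 i.2)
        rw [dif_pos (Finset.mem_Iic.1 i.2)] at this
        exact this
    rw [Measure.map_apply (by fun_prop) (measurableSet_singleton _),
      Measure.map_apply (by fun_prop) (measurableSet_singleton _), hu, h]
  have h1 : IsProjectiveLimit μ (fun I => μ.map (Finset.restrict I)) := fun I => rfl
  refine h1.unique ?_
  intro I
  have hI : I ⊆ Finset.Iic (I.sup id) := I.subset_Iic_sup_id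
  have := congrArg (fun m => m.map (Finset.restrict₂ (π := fun _ => V) hI)) (key (I.sup id))
  simp only [Preorder.frestrictLe] at this
  rw [Measure.map_map (by fun_prop) (by fun_prop), Measure.map_map (by fun_prop) (by fun_prop),
    Finset.restrict₂_comp_restrict] at this
  exact this.symm

theorem measurableSet_eval (k : ℕ) (y : V) : MeasurableSet {w : ℕ → V | w k = y} :=
  (upTo_eval le_rfl (· = y)).measurableSet

variable [DecidableEq V]

/-- The law of the lazy random walk started at `x`. -/
abbrev walkFrom (G : SimpleGraph V) [DecidableRel G.Adj] (x : V) : Measure (ℕ → V) :=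
  walkLaw G (Measure.dirac x)

variable (G : SimpleGraph V) [DecidableRel G.Adj]

theorem walkFrom_eq (x : V) : walkFrom G x =
    Kernel.traj (X := fun _ => V) (historyKernel G) 0 (fun _ => x) := by
  unfold walkFrom walkLaw
  exact Measure.dirac_bind (Measurable.of_discrete) x

instance (x : V) : IsProbabilityMeasure (walkFrom G x) := by
  rw [walkFrom_eq]; infer_instance

theorem stepKernel_singleton (x y : V) : stepKernel G x {y} = stepProb G x y := by
  change (stepPMF G x).toMeasure {y} = _
  rw [PMF.toMeasure_apply_singleton _ _ (measurableSet_singleton y)]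
  rfl

theorem walkFrom_cyl_succ (x : V) (k : ℕ) (v : ℕ → V) :
    walkFrom G x (cyl (k + 1) v) = walkFrom G x (cyl k v) * stepProb G (v k) (v (k + 1)) := by
  rw [walkFrom_eq]
  have h := Kernel.partialTraj_compProd_eq_map_traj (X := fun _ => V) (κ := historyKernel G)
    (a := 0) (b := k) (Nat.zero_le k) (x₀ := fun _ => x)
  have h1 : cyl (k + 1) v = (fun w : ℕ → V => (Preorder.frestrictLe (π := fun _ => V) k w,
      w (k + 1))) ⁻¹' ({Preorder.frestrictLe (π := fun _ => V) k v} ×ˢ {v (k + 1)}) := by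
    ext w
    simp only [cyl, Set.mem_ofPred_eq, Set.mem_preimage, Set.mem_prod, Set.mem_singleton_iff]
    constructor
    · intro hw
      exact ⟨funext fun i => hw i ((Finset.mem_Iic.1 i.2).trans (Nat.le_succ k)), hw _ le_rfl⟩
    · rintro ⟨h2, h3⟩ i hi
      rcases Nat.lt_or_ge k i with h4 | h4
      · obtain rfl : i = k + 1 := by omega
        exact h3
      · exact congrFun h2 ⟨i, Finset.mem_Iic.2 h4⟩
  have h0 : cyl k v = Preorder.frestrictLe (π := fun _ => V) k ⁻¹'
      {Preorder.frestrictLe (π := fun _ => V) k v} := by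
    ext w
    simp only [cyl, Set.mem_ofPred_eq, Set.mem_preimage, Set.mem_singleton_iff]
    exact ⟨fun hw => funext fun i => hw i (Finset.mem_Iic.1 i.2),
      fun h2 i hi => congrFun h2 ⟨i, Finset.mem_Iic.2 hi⟩⟩
  rw [h1, ← Measure.map_apply (by fun_prop)
    ((measurableSet_singleton _).prod (measurableSet_singleton _)), ← h,
    Measure.compProd_apply_prod (measurableSet_singleton _) (measurableSet_singleton _),
    lintegral_singleton, mul_comm, h0, ← Measure.map_apply (by fun_prop)
    (measurableSet_singleton _), Kernel.traj_map_frestrictLe_apply]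
  congr 1
  exact stepKernel_singleton G (v k) (v (k + 1))

theorem walkFrom_cyl_zero (x : V) (v : ℕ → V) : walkFrom G x (cyl 0 v) = if v 0 = x then 1 else 0 := by
  have h := Kernel.traj_map_frestrictLe_apply (X := fun _ => V) (κ := historyKernel G) 0 0
    (fun _ => x)
  rw [Kernel.partialTraj_self, Kernel.id_apply] at h
  have h0 : cyl 0 v = Preorder.frestrictLe (π := fun _ => V) 0 ⁻¹'
      {Preorder.frestrictLe (π := fun _ => V) 0 v} := by
    ext w
    simp only [cyl, Set.mem_ofPred_eq, Set.mem_preimage, Set.mem_singleton_iff]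
    exact ⟨fun hw => funext fun i => hw i (Finset.mem_Iic.1 i.2),
      fun h2 i hi => congrFun h2 ⟨i, Finset.mem_Iic.2 hi⟩⟩
  rw [walkFrom_eq, h0, ← Measure.map_apply (by fun_prop) (measurableSet_singleton _), h,
    Measure.dirac_apply' _ (measurableSet_singleton _)]
  by_cases hv : v 0 = x
  · rw [if_pos hv, Set.indicator_of_mem]
    · rfl
    · funext i
      obtain ⟨i, hi⟩ := i
      obtain rfl : i = 0 := by simpa using hi
      exact hv.symm
  · rw [if_neg hv, Set.indicator_of_notMem]
    intro h3
    exact hv (congrFun h3 ⟨0, by simp⟩).symm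

theorem walkFrom_cyl_add (x : V) (k l : ℕ) (v : ℕ → V) :
    walkFrom G x (cyl (k + l) v)
      = walkFrom G x (cyl k v) * walkFrom G (v k) (cyl l (shiftPath k v)) := by
  induction l with
  | zero => rw [walkFrom_cyl_zero]; simp [shiftPath]
  | succ l ih =>
    rw [← add_assoc, walkFrom_cyl_succ, ih, walkFrom_cyl_succ, mul_assoc]
    simp only [shiftPath]
    rw [show l + 1 + k = k + l + 1 by omega, add_comm l k]

/-- Both sides are finite measures in `B`, so cylinders suffice. A cylinder placed after `v` is the
cylinder of the concatenated path, or is empty when the endpoints do not match. -/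
theorem markov_cyl (x : V) (k : ℕ) (v : ℕ → V) {B : Set (ℕ → V)} (hB : MeasurableSet B) :
    walkFrom G x (cyl k v ∩ shiftPath k ⁻¹' B) = walkFrom G x (cyl k v) * walkFrom G (v k) B := by
  have : Nonempty V := ⟨x⟩
  have hm : IsFiniteMeasure (walkFrom G x (cyl k v) • walkFrom G (v k)) :=
    Measure.smul_finite _ (measure_ne_top _ _)
  have key : ((walkFrom G x).restrict (cyl k v)).map (shiftPath k)
      = walkFrom G x (cyl k v) • walkFrom G (v k) := by
    refine ext_of_cyl fun l b => ?_
    rw [Measure.map_apply (measurable_shiftPath k) (measurableSet_cyl l b),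
      Measure.restrict_apply (measurable_shiftPath k (measurableSet_cyl l b)),
      Measure.smul_apply, smul_eq_mul]
    by_cases hb : b 0 = v k
    · set c : ℕ → V := fun i => if i ≤ k then v i else b (i - k) with hc
      have h1 : shiftPath k ⁻¹' cyl l b ∩ cyl k v = cyl (k + l) c := by
        ext w
        simp only [Set.mem_inter_iff, Set.mem_preimage, cyl, Set.mem_ofPred_eq, shiftPath, hc]
        constructor
        · rintro ⟨h2, h3⟩ i hi
          by_cases hik : i ≤ k
          · rw [if_pos hik, h3 i hik]
          · rw [if_neg hik, ← h2 (i - k) (by omega), Nat.sub_add_cancel (by omega)]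
        · intro h2
          refine ⟨fun i hi => ?_, fun i hi => ?_⟩
          · rw [h2 (i + k) (by omega)]
            by_cases hi0 : i = 0
            · subst hi0; simp [hb]
            · rw [if_neg (by omega), Nat.add_sub_cancel]
          · rw [h2 i (by omega), if_pos hi]
      have h2 : cyl k c = cyl k v := by
        ext w
        simp only [cyl, Set.mem_ofPred_eq, hc]
        refine forall_congr' fun i => forall_congr' fun hi => ?_
        rw [if_pos hi]
      have h3 : shiftPath k c = b := by
        funext i
        simp only [shiftPath, hc]
        by_cases hi0 : i = 0
        · subst hi0; simp [hb]
        · rw [if_neg (by omega), Nat.add_sub_cancel]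
      rw [h1, walkFrom_cyl_add, h2, h3]
      simp [hc]
    · have h1 : shiftPath k ⁻¹' cyl l b ∩ cyl k v = ∅ := by
        ext w
        simp only [Set.mem_inter_iff, Set.mem_preimage, cyl, Set.mem_ofPred_eq, shiftPath,
          Set.mem_empty_iff_false, iff_false, not_and]
        intro h2 h3
        have := h2 0 (Nat.zero_le l)
        rw [zero_add, h3 k le_rfl] at this
        exact hb this.symm
      have h2 : walkFrom G (v k) (cyl l b) = 0 := by
        refine measure_mono_null (t := cyl 0 b) (fun w hw i hi => hw i (hi.trans (Nat.zero_le l))) ?_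
        rw [walkFrom_cyl_zero, if_neg hb]
      rw [h1, h2]; simp
  have h := congrArg (fun m => m B) key
  simp only [Measure.smul_apply, smul_eq_mul] at h
  rw [Measure.map_apply (measurable_shiftPath k) hB,
    Measure.restrict_apply (measurable_shiftPath k hB), Set.inter_comm] at h
  exact h

/-- The Markov property at time `k`. -/
theorem markov_at (x y : V) {k : ℕ} {E B : Set (ℕ → V)} (hE : UpTo k E) (hB : MeasurableSet B) :
    (walkFrom G x).real (E ∩ {w | w k = y} ∩ shiftPath k ⁻¹' B)
      = (walkFrom G x).real (E ∩ {w | w k = y}) * (walkFrom G y).real B := by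
  have hEy : UpTo k (E ∩ {w | w k = y}) := hE.inter (upTo_eval le_rfl (· = y))
  have hfib : ∀ u : Finset.Iic k → V,
      {w : ℕ → V | (fun i : Finset.Iic k => w i) = u} = cyl k (fun i =>
        if hi : i ≤ k then u ⟨i, Finset.mem_Iic.2 hi⟩ else x) := by
    intro u
    ext w
    simp only [cyl, Set.mem_ofPred_eq]
    constructor
    · rintro rfl i hi
      simp [hi]
    · intro hw
      funext i
      have := hw i (Finset.mem_Iic.1 i.2)
      rw [dif_pos (Finset.mem_Iic.1 i.2)] at this
      exact this
  have hX : ∀ u : Finset.Iic k → V,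
      MeasurableSet {w : ℕ → V | (fun i : Finset.Iic k => w i) = u} := by
    intro u; rw [hfib]; exact measurableSet_cyl _ _
  rw [measureReal_eq_sum_fiber _ _ hX (E ∩ {w | w k = y} ∩ shiftPath k ⁻¹' B),
    measureReal_eq_sum_fiber _ _ hX (E ∩ {w | w k = y}), Finset.sum_mul]
  refine Finset.sum_congr rfl fun u _ => ?_
  rw [hfib]
  -- The filler `x` is irrelevant: the event looks only at times up to `k`, so it contains this
  -- cylinder or misses it.
  set v : ℕ → V := fun i => if hi : i ≤ k then u ⟨i, Finset.mem_Iic.2 hi⟩ else x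
  by_cases hv : v ∈ E ∩ {w | w k = y}
  · have h1 : E ∩ {w | w k = y} ∩ cyl k v = cyl k v :=
      Set.inter_eq_self_of_subset_right fun w hw => hEy (fun i hi => (hw i hi).symm) hv
    rw [Set.inter_right_comm, h1, measureReal_def, markov_cyl G x k v hB, ENNReal.toReal_mul,
      show v k = y from hv.2]
    rfl
  · have h1 : E ∩ {w | w k = y} ∩ cyl k v = ∅ :=
      Set.eq_empty_of_forall_notMem fun w hw => hv (hEy (fun i hi => hw.2 i hi) hw.1)
    rw [Set.inter_right_comm, h1]
    simp

theorem markov (x : V) {k : ℕ} {E B : Set (ℕ → V)} (hE : UpTo k E) (hB : MeasurableSet B) :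
    (walkFrom G x).real (E ∩ shiftPath k ⁻¹' B)
      = ∑ y, (walkFrom G x).real (E ∩ {w | w k = y}) * (walkFrom G y).real B := by
  rw [measureReal_eq_sum_fiber _ (fun w : ℕ → V => w k) (measurableSet_eval k) _]
  refine Finset.sum_congr rfl fun y _ => ?_
  rw [← markov_at G x y hE hB, Set.inter_right_comm]

/-! ### Transition probabilities, stationarity and mixing -/

section Transition

variable {V : Type*} [Fintype V] [DecidableEq V] [MeasurableSpace V] [MeasurableSingletonClass V]
  (G : SimpleGraph V) [DecidableRel G.Adj]

theorem walkFrom_eval_zero (x y : V) :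
    (walkFrom G x).real {w | w 0 = y} = if x = y then 1 else 0 := by
  have h : {w : ℕ → V | w 0 = y} = cyl 0 (fun _ => y) := by
    ext w; simp [cyl]
  rw [h, measureReal_def, walkFrom_cyl_zero]
  by_cases hxy : x = y
  · simp [hxy]
  · simp [hxy, Ne.symm hxy]

theorem transProb_zero (x y : V) : transProb G 0 x y = if x = y then 1 else 0 :=
  walkFrom_eval_zero G x y

theorem transProb_nonneg (n : ℕ) (x y : V) : 0 ≤ transProb G n x y := measureReal_nonneg

theorem sum_transProb (n : ℕ) (x : V) : ∑ y, transProb G n x y = 1 := by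
  have h := measureReal_eq_sum_fiber (walkFrom G x) (fun w : ℕ → V => w n)
    (measurableSet_eval n) Set.univ
  simp only [Set.univ_inter, probReal_univ] at h
  exact h.symm

theorem transProb_add (a b : ℕ) (x y : V) :
    transProb G (a + b) x y = ∑ z, transProb G a x z * transProb G b z y := by
  have h := markov G x (k := a) (E := Set.univ) (fun _ _ _ _ => trivial) (measurableSet_eval b y)
  simp only [Set.univ_inter] at h
  rw [transProb, add_comm a b]
  exact h

theorem transProb_one (x y : V) : transProb G 1 x y = (stepProb G x y).toReal := by
  have h : {w : ℕ → V | w 0 = x} ∩ {w | w 1 = y} = cyl 1 (fun i => if i = 0 then x else y) := by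
    ext w
    simp only [Set.mem_inter_iff, cyl, Set.mem_ofPred_eq]
    constructor
    · rintro ⟨h0, h1⟩ i hi
      interval_cases i
      · simpa using h0
      · simpa using h1
    · intro h
      exact ⟨by simpa using h 0 (by omega), by simpa using h 1 le_rfl⟩
  have h2 : transProb G 1 x y = (walkFrom G x).real ({w | w 1 = y} ∩ {w | w 0 = x}) := by
    rw [transProb, measureReal_eq_sum_fiber _ (fun w : ℕ → V => w 0) (measurableSet_eval 0),
      Finset.sum_eq_single x]
    · intro z _ hz
      refine le_antisymm ?_ measureReal_nonneg
      refine (measureReal_mono Set.inter_subset_right).trans ?_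
      rw [walkFrom_eval_zero, if_neg hz.symm]
    · simp
  have h3 := walkFrom_cyl_succ G x 0 (fun i => if i = 0 then x else y)
  rw [h2, Set.inter_comm, h, measureReal_def, h3, walkFrom_cyl_zero]
  simp

/-- The walk has symmetric transition probabilities and uniform stationary distribution. -/
class SymmWalk : Prop where
  statProb_eq : ∀ x, statProb G x = (Fintype.card V : ℝ)⁻¹
  comm : ∀ n x y, transProb G n x y = transProb G n y x

theorem symmWalk_of_regular [Nontrivial V] (hc : G.Connected)
    (hr : ∃ d : ℕ, G.IsRegularOfDegree d) : SymmWalk G := by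
  obtain ⟨d, hd⟩ := hr
  have hd0 : d ≠ 0 := by
    obtain ⟨x⟩ := hc.nonempty
    have := hc.preconnected.degree_pos_of_nontrivial x
    rw [hd x] at this
    omega
  refine ⟨fun x => ?_, fun n => ?_⟩
  · have h := G.sum_degrees_eq_twice_card_edges
    simp only [hd.degree_eq, Finset.sum_const, Finset.card_univ, smul_eq_mul] at h
    have h2 : (Fintype.card V : ℝ) * d = 2 * (G.edgeFinset.card : ℝ) := by exact_mod_cast h
    rw [statProb, ← h2, hd.degree_eq]
    have : (d : ℝ) ≠ 0 := by exact_mod_cast hd0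
    have h3 : (Fintype.card V : ℝ) ≠ 0 := by exact_mod_cast Fintype.card_ne_zero
    field_simp
  · have hs : ∀ x y, transProb G 1 x y = transProb G 1 y x := by
      intro x y
      rw [transProb_one, transProb_one, stepProb, stepProb]
      simp only [hd.degree_eq, eq_comm (a := x), G.adj_comm x y]
    induction n with
    | zero => intro x y; rw [transProb_zero, transProb_zero]; simp only [eq_comm]
    | succ n ih =>
      intro x y
      -- Powers of one matrix commute: one side is expanded with the single step last, the other
      -- with it first.
      rw [transProb_add, add_comm, transProb_add]
      refine Finset.sum_congr rfl fun z _ => ?_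
      rw [ih x z, hs z y, mul_comm]

/-- The law of the stationary lazy random walk. -/
abbrev statWalk : Measure (ℕ → V) := walkLaw G (statMeasure G)

theorem statWalk_apply {B : Set (ℕ → V)} (hB : MeasurableSet B) :
    statWalk G B = ∑ x, ENNReal.ofReal (statProb G x) * walkFrom G x B := by
  have hm : Measurable (fun x : V =>
    Kernel.traj (X := fun _ => V) (historyKernel G) 0 (fun _ => x)) := Measurable.of_discrete
  simp only [walkFrom_eq]
  unfold statWalk walkLaw statMeasure
  rw [Measure.bind_apply hB hm.aemeasurable, lintegral_finsetSum_measure]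
  refine Finset.sum_congr rfl fun x _ => ?_
  rw [lintegral_smul_measure, lintegral_dirac]
  rfl

variable [Nonempty V] [hG : SymmWalk G]

instance : IsProbabilityMeasure (statWalk G) := by
  constructor
  rw [statWalk_apply G MeasurableSet.univ]
  simp only [measure_univ, mul_one, hG.statProb_eq, Finset.sum_const, Finset.card_univ,
    nsmul_eq_mul]
  rw [ENNReal.ofReal_inv_of_pos (by exact_mod_cast Fintype.card_pos), ENNReal.ofReal_natCast]
  exact ENNReal.mul_inv_cancel (by simp) (ENNReal.natCast_ne_top _)

theorem statWalk_real {B : Set (ℕ → V)} (hB : MeasurableSet B) :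
    (statWalk G).real B = (Fintype.card V : ℝ)⁻¹ * ∑ x, (walkFrom G x).real B := by
  rw [measureReal_def, statWalk_apply G hB, ENNReal.toReal_sum, Finset.mul_sum]
  · refine Finset.sum_congr rfl fun x _ => ?_
    rw [ENNReal.toReal_mul, hG.statProb_eq, ENNReal.toReal_ofReal (by positivity)]
    rfl
  · intro x _
    exact ENNReal.mul_ne_top ENNReal.ofReal_ne_top (measure_ne_top _ _)

theorem statWalk_markov_at (y : V) {k : ℕ} {E B : Set (ℕ → V)} (hE : UpTo k E)
    (hB : MeasurableSet B) :
    (statWalk G).real (E ∩ {w | w k = y} ∩ shiftPath k ⁻¹' B)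
      = (statWalk G).real (E ∩ {w | w k = y}) * (walkFrom G y).real B := by
  have h1 : MeasurableSet (E ∩ {w | w k = y}) := hE.measurableSet.inter (measurableSet_eval k y)
  rw [statWalk_real G (h1.inter (measurable_shiftPath k hB)), statWalk_real G h1, mul_assoc,
    Finset.sum_mul]
  simp only [markov_at G _ y hE hB]

theorem sum_transProb_left (n : ℕ) (y : V) : ∑ x, transProb G n x y = 1 := by
  simp only [hG.comm n _ y, sum_transProb]

theorem statWalk_eval (k : ℕ) (y : V) :
    (statWalk G).real {w | w k = y} = (Fintype.card V : ℝ)⁻¹ := by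
  rw [statWalk_real G (measurableSet_eval k y)]
  change _ * ∑ x, transProb G k x y = _
  rw [sum_transProb_left, mul_one]

theorem statWalk_eval_shift (k : ℕ) (y : V) {B : Set (ℕ → V)} (hB : MeasurableSet B) :
    (statWalk G).real ({w | w k = y} ∩ shiftPath k ⁻¹' B)
      = (Fintype.card V : ℝ)⁻¹ * (walkFrom G y).real B := by
  have h := statWalk_markov_at G y (k := k) (E := Set.univ) (fun _ _ _ _ => trivial) hB
  rwa [Set.univ_inter, statWalk_eval] at h

theorem statWalk_shift (k : ℕ) {B : Set (ℕ → V)} (hB : MeasurableSet B) :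
    (statWalk G).real (shiftPath k ⁻¹' B) = (statWalk G).real B := by
  rw [measureReal_eq_sum_fiber _ (fun w : ℕ → V => w k) (measurableSet_eval k),
    statWalk_real G hB, Finset.mul_sum]
  refine Finset.sum_congr rfl fun y _ => ?_
  rw [Set.inter_comm, statWalk_eval_shift G k y hB]

theorem statWalk_pair (k l : ℕ) (x y : V) :
    (statWalk G).real ({w | w k = x} ∩ {w | w l = y})
      = (Fintype.card V : ℝ)⁻¹ * transProb G (Nat.dist k l) x y := by
  have key : ∀ (k j : ℕ) (x y : V), (statWalk G).real ({w | w k = x} ∩ {w | w (j + k) = y})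
      = (Fintype.card V : ℝ)⁻¹ * transProb G j x y := by
    intro k j x y
    have h := statWalk_eval_shift G k x (measurableSet_eval j y)
    have e : shiftPath k ⁻¹' {w : ℕ → V | w j = y} = {w | w (j + k) = y} := rfl
    rw [e] at h
    exact h
  rcases le_total k l with h | h
  · rw [Nat.dist_eq_sub_of_le h, ← key, Nat.sub_add_cancel h]
  · rw [Nat.dist_eq_sub_of_le_right h, hG.comm, ← key, Nat.sub_add_cancel h, Set.inter_comm]

/-- The deviation at the later time is an average of deviations at time `a` over the extra initial
steps. -/
theorem transProb_dev_mono {a : ℕ} {α : ℝ}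
    (ha : ∀ x y, |(Fintype.card V : ℝ) * transProb G a x y - 1| ≤ α) {b : ℕ} (hb : a ≤ b)
    (x y : V) : |(Fintype.card V : ℝ) * transProb G b x y - 1| ≤ α := by
  obtain ⟨c, rfl⟩ := Nat.exists_eq_add_of_le' hb
  have h : (Fintype.card V : ℝ) * transProb G (c + a) x y - 1
      = ∑ z, transProb G c x z * ((Fintype.card V : ℝ) * transProb G a z y - 1) := by
    rw [transProb_add]
    simp only [mul_sub, mul_one, Finset.sum_sub_distrib, sum_transProb, Finset.mul_sum]
    congr 1
    exact Finset.sum_congr rfl fun z _ => by ring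
  rw [h]
  refine (Finset.abs_sum_le_sum_abs _ _).trans ?_
  calc _ ≤ ∑ z, transProb G c x z * α := by
        refine Finset.sum_le_sum fun z _ => ?_
        rw [abs_mul, abs_of_nonneg (transProb_nonneg G c x z)]
        exact mul_le_mul_of_nonneg_left (ha z y) (transProb_nonneg G c x z)
    _ = α := by rw [← Finset.sum_mul, sum_transProb, one_mul]

/-- Rows and columns both sum to one, so the cross terms cancel and the deviation kernels compose.
Hence the deviation decays geometrically in multiples of the mixing time. -/
theorem transProb_dev_add {a b : ℕ} {α β : ℝ}
    (ha : ∀ x y, |(Fintype.card V : ℝ) * transProb G a x y - 1| ≤ α)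
    (hb : ∀ x y, |(Fintype.card V : ℝ) * transProb G b x y - 1| ≤ β) (x y : V) :
    |(Fintype.card V : ℝ) * transProb G (a + b) x y - 1| ≤ α * β := by
  have hn : (0 : ℝ) < Fintype.card V := by exact_mod_cast Fintype.card_pos
  have hα : 0 ≤ α := (abs_nonneg _).trans (ha x y)
  have h : (Fintype.card V : ℝ) * transProb G (a + b) x y - 1
      = (Fintype.card V : ℝ)⁻¹ * ∑ z, ((Fintype.card V : ℝ) * transProb G a x z - 1)
        * ((Fintype.card V : ℝ) * transProb G b z y - 1) := by
    have h1 : ∀ z, ((Fintype.card V : ℝ) * transProb G a x z - 1)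
        * ((Fintype.card V : ℝ) * transProb G b z y - 1)
        = (Fintype.card V : ℝ) ^ 2 * (transProb G a x z * transProb G b z y)
          - (Fintype.card V : ℝ) * transProb G a x z
          - (Fintype.card V : ℝ) * transProb G b z y + 1 := fun z => by ring
    simp only [h1, Finset.sum_add_distrib, Finset.sum_sub_distrib, ← Finset.mul_sum,
      ← transProb_add, sum_transProb, sum_transProb_left]
    simp only [Finset.sum_const, Finset.card_univ, nsmul_eq_mul]
    field_simp
    ring
  rw [h, abs_mul, abs_of_pos (inv_pos.2 hn), inv_mul_le_iff₀ hn]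
  refine (Finset.abs_sum_le_sum_abs _ _).trans ?_
  calc _ ≤ ∑ _z : V, α * β := by
        refine Finset.sum_le_sum fun z _ => ?_
        rw [abs_mul]
        exact mul_le_mul (ha x z) (hb z y) (abs_nonneg _) hα
    _ = _ := by simp

/-- A nonzero `sInf` certifies that the set of admissible times is nonempty; for the empty set it
would be `0`. -/
theorem transProb_dev_mixTime (h : mixTime G ≠ 0) (x y : V) :
    |(Fintype.card V : ℝ) * transProb G (mixTime G) x y - 1| ≤ 1 / 4 := by
  have h1 := Nat.sInf_mem (Nat.nonempty_of_pos_sInf (Nat.pos_of_ne_zero h)) x y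
  rw [hG.statProb_eq, div_inv_eq_mul, mul_comm] at h1
  exact h1

theorem transProb_dev_mul_mixTime (h : mixTime G ≠ 0) (k : ℕ) (x y : V) :
    |(Fintype.card V : ℝ) * transProb G ((k + 1) * mixTime G) x y - 1| ≤ (1 / 4) ^ (k + 1) := by
  induction k generalizing x y with
  | zero => simpa using transProb_dev_mixTime G h x y
  | succ k ih =>
    rw [pow_succ, add_mul (k + 1), one_mul]
    exact transProb_dev_add G (fun x y => ih x y) (transProb_dev_mixTime G h) x y

theorem transProb_le_of_mixTime_le (h : mixTime G ≠ 0) {j : ℕ} (hj : mixTime G ≤ j) (x y : V) :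
    transProb G j x y ≤ 5 / 4 * (Fintype.card V : ℝ)⁻¹ := by
  have hn : (0 : ℝ) < Fintype.card V := by exact_mod_cast Fintype.card_pos
  have h1 := (abs_le.1 (transProb_dev_mono G (transProb_dev_mixTime G h) hj x y)).2
  rw [← div_eq_mul_inv, le_div_iff₀ hn]
  linarith

theorem le_transProb (h : mixTime G ≠ 0) {j k : ℕ} (hj : (k + 1) * mixTime G ≤ j) (x y : V) :
    (1 - (1 / 4) ^ (k + 1)) * (Fintype.card V : ℝ)⁻¹ ≤ transProb G j x y := by
  have hn : (0 : ℝ) < Fintype.card V := by exact_mod_cast Fintype.card_pos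
  have h1 := (abs_le.1 (transProb_dev_mono G (transProb_dev_mul_mixTime G h k) hj x y)).1
  rw [← div_eq_mul_inv, div_le_iff₀ hn]
  linarith

/-- After a gap during which the walk mixes, it is bounded below by a fresh stationary walk. -/
theorem le_walkFrom_gap {j : ℕ} {δ : ℝ}
    (hj : ∀ x y, δ * (Fintype.card V : ℝ)⁻¹ ≤ transProb G j x y) (x : V) {k : ℕ}
    {E B : Set (ℕ → V)} (hE : UpTo k E) (hB : MeasurableSet B) :
    δ * ((walkFrom G x).real E * (statWalk G).real B)
      ≤ (walkFrom G x).real (E ∩ shiftPath (k + j) ⁻¹' B) := by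
  have hg : ∀ y, δ * (statWalk G).real B ≤ (walkFrom G y).real (shiftPath j ⁻¹' B) := by
    intro y
    have h := markov G y (k := j) (E := Set.univ) (fun _ _ _ _ => trivial) hB
    simp only [Set.univ_inter] at h
    rw [h, statWalk_real G hB, ← mul_assoc, Finset.mul_sum]
    exact Finset.sum_le_sum fun z _ => mul_le_mul_of_nonneg_right (hj y z) measureReal_nonneg
  have h2 : shiftPath (k + j) ⁻¹' B = shiftPath k ⁻¹' (shiftPath j ⁻¹' B) := by
    ext w
    rw [Set.mem_preimage, Set.mem_preimage, Set.mem_preimage, shiftPath_add, add_comm]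
  rw [h2, markov G x hE (measurable_shiftPath j hB),
    measureReal_eq_sum_fiber (walkFrom G x) (fun w : ℕ → V => w k) (measurableSet_eval k) E,
    Finset.sum_mul, Finset.mul_sum]
  refine Finset.sum_le_sum fun y _ => ?_
  rw [mul_left_comm]
  exact mul_le_mul_of_nonneg_left (hg y) measureReal_nonneg

end Transition

/-! ### Loop erasure: locality and shift equivariance -/

section Loop

variable {V : Type*} [DecidableEq V]

theorem pathRange_congr {w w' : ℕ → V} {A : Finset ℕ} (h : ∀ i ∈ A, w i = w' i) :
    pathRange w A = pathRange w' A :=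
  Finset.image_congr h

theorem card_pathRange_le (w : ℕ → V) (A : Finset ℕ) : (pathRange w A).card ≤ A.card :=
  Finset.card_image_le

theorem pathRange_image_add (w : ℕ → V) (b : ℕ) (A : Finset ℕ) :
    pathRange w (A.image (· + b)) = pathRange (shiftPath b w) A := by
  rw [pathRange, Finset.image_image]
  rfl

theorem nonErased_subset (w : ℕ → V) (a k : ℕ) : nonErased w a k ⊆ Finset.Icc a (a + k) := by
  induction k with
  | zero => simp [nonErased]
  | succ k ih =>
    intro m hm
    rw [nonErased, Finset.mem_insert, Finset.mem_filter] at hm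
    rcases hm with rfl | ⟨hm, _⟩
    · exact Finset.mem_Icc.2 ⟨by omega, by omega⟩
    · have := Finset.mem_Icc.1 (ih hm)
      exact Finset.mem_Icc.2 ⟨this.1, by omega⟩

theorem nonErased_congr {w w' : ℕ → V} {a k : ℕ} (h : ∀ i ≤ a + k, w i = w' i) :
    nonErased w a k = nonErased w' a k := by
  induction k with
  | zero => rfl
  | succ k ih =>
    have ih := ih fun i hi => h i (by omega)
    simp only [nonErased]
    rw [ih, h (a + k + 1) (by omega)]
    congr 1
    refine Finset.filter_congr fun m hm => ?_
    rw [pathRange_congr fun i hi => h i ?_]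
    have := Finset.mem_Icc.1 (nonErased_subset w' a k (Finset.mem_filter.1 hi).1)
    omega

theorem nonErased_shift (w : ℕ → V) (a b k : ℕ) :
    nonErased w (a + b) k = (nonErased (shiftPath b w) a k).image (· + b) := by
  induction k with
  | zero => simp [nonErased]
  | succ k ih =>
    have h1 : ∀ m, {l ∈ (nonErased (shiftPath b w) a k).image (· + b) | l ≤ m + b}
        = ({l ∈ nonErased (shiftPath b w) a k | l ≤ m}).image (· + b) := by
      intro m
      rw [Finset.filter_image]
      simp
    simp only [nonErased]
    rw [ih, Finset.image_insert, Finset.filter_image]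
    simp only [h1, pathRange_image_add, shiftPath]
    rw [show a + b + k + 1 = a + k + 1 + b by omega]
    rfl

theorem mem_locNonErased (w : ℕ → V) (s a c m : ℕ) :
    m ∈ locNonErased w s (Finset.Ico a c) ↔ a + s ≤ m ∧ m + s < c ∧
      pathRange w (nonErased w (m - s) s) ∩ pathRange w (Finset.Icc (m + 1) (m + s)) = ∅ := by
  simp only [locNonErased, Finset.mem_filter, Finset.mem_Ico]
  constructor
  · rintro ⟨_, ⟨a', h2, h3⟩, ⟨b', h4, h5⟩, h6⟩
    exact ⟨by omega, by omega, h6⟩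
  · rintro ⟨h1, h2, h3⟩
    exact ⟨⟨by omega, by omega⟩, ⟨a, by omega, h1⟩, ⟨m + s, by omega, le_rfl⟩, h3⟩

/-- The loop erasure of a window uses only times in that window, so disjointness of the whole
windows is enough. This crude criterion spares the lower bound on `cutHit` any analysis of loop
erasure. -/
theorem mem_locNonErased_of_disjoint {w : ℕ → V} {s a c m : ℕ} (h1 : a + s ≤ m) (h2 : m + s < c)
    (h : ∀ i j, m - s ≤ i → i ≤ m → m < j → j ≤ m + s → w i ≠ w j) :
    m ∈ locNonErased w s (Finset.Ico a c) := by
  rw [mem_locNonErased]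
  refine ⟨h1, h2, Finset.eq_empty_of_forall_notMem fun v hv => ?_⟩
  simp only [Finset.mem_inter, pathRange, Finset.mem_image] at hv
  obtain ⟨⟨i, hi, rfl⟩, ⟨j, hj, hij⟩⟩ := hv
  have hi := Finset.mem_Icc.1 (nonErased_subset w _ _ hi)
  have hj := Finset.mem_Icc.1 hj
  exact h i j hi.1 (by omega) (by omega) hj.2 hij.symm

theorem locNonErased_shift (w : ℕ → V) (s b c : ℕ) :
    locNonErased w s (Finset.Ico b (c + b))
      = (locNonErased (shiftPath b w) s (Finset.Ico 0 c)).image (· + b) := by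
  ext m
  rw [mem_locNonErased, Finset.mem_image]
  have key : ∀ l, s ≤ l → (pathRange w (nonErased w (l + b - s) s)
      ∩ pathRange w (Finset.Icc (l + b + 1) (l + b + s)) = ∅ ↔
      pathRange (shiftPath b w) (nonErased (shiftPath b w) (l - s) s)
        ∩ pathRange (shiftPath b w) (Finset.Icc (l + 1) (l + s)) = ∅) := by
    intro l hl
    rw [show l + b - s = l - s + b by omega, nonErased_shift, pathRange_image_add,
      show l + b + 1 = l + 1 + b by omega, show l + b + s = l + s + b by omega,
      ← Finset.image_add_right_Icc, pathRange_image_add]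
  constructor
  · rintro ⟨h1, h2, h3⟩
    obtain ⟨l, rfl⟩ := Nat.exists_eq_add_of_le' (show b ≤ m by omega)
    exact ⟨l, (mem_locNonErased _ _ _ _ _).2 ⟨by omega, by omega, (key l (by omega)).1 h3⟩, rfl⟩
  · rintro ⟨l, hl, rfl⟩
    obtain ⟨h1, h2, h3⟩ := (mem_locNonErased _ _ _ _ _).1 hl
    exact ⟨by omega, by omega, (key l (by omega)).2 h3⟩

theorem pathRange_locNonErased_shift (w : ℕ → V) (s b c : ℕ) :
    pathRange w (locNonErased w s (Finset.Ico b (c + b)))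
      = pathRange (shiftPath b w) (locNonErased (shiftPath b w) s (Finset.Ico 0 c)) := by
  rw [locNonErased_shift, pathRange_image_add]

theorem locNonErased_congr {w w' : ℕ → V} {s c : ℕ} (h : ∀ i < c, w i = w' i) :
    locNonErased w s (Finset.Ico 0 c) = locNonErased w' s (Finset.Ico 0 c) := by
  ext m
  simp only [mem_locNonErased]
  refine and_congr_right fun h1 => and_congr_right fun h2 => ?_
  have h3 : nonErased w (m - s) s = nonErased w' (m - s) s :=
    nonErased_congr fun i hi => h i (by omega)
  rw [h3, pathRange_congr (w := w) (w' := w') (A := nonErased w' (m - s) s),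
    pathRange_congr (w := w) (w' := w') (A := Finset.Icc (m + 1) (m + s))]
  · intro i hi
    have := Finset.mem_Icc.1 hi
    exact h i (by omega)
  · intro i hi
    have := Finset.mem_Icc.1 (nonErased_subset w' _ _ hi)
    exact h i (by omega)

theorem locNonErased_subset (w : ℕ → V) (s : ℕ) (A : Finset ℕ) : locNonErased w s A ⊆ A :=
  Finset.filter_subset _ _

/-- The vertices visited by a segment of length `l` at its locally non-erased times. -/
def cutRange (s l : ℕ) (w : ℕ → V) : Finset V := pathRange w (locNonErased w s (Finset.Ico 0 l))

theorem card_cutRange_le (s l : ℕ) (w : ℕ → V) : (cutRange s l w).card ≤ l := by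
  refine (card_pathRange_le _ _).trans ((Finset.card_le_card (locNonErased_subset _ _ _)).trans ?_)
  simp

theorem upTo_cutRange {s l k : ℕ} (hl : l ≤ k + 1) (S : Finset V) :
    UpTo k {w : ℕ → V | cutRange s l w = S} := by
  intro w w' h hw
  have h1 : ∀ i < l, w i = w' i := fun i hi => h i (by omega)
  rw [Set.mem_ofPred_eq] at hw ⊢
  rw [← hw, cutRange, cutRange, locNonErased_congr h1]
  refine (pathRange_congr fun i hi => h1 i ?_).symm
  exact (Finset.mem_Ico.1 (locNonErased_subset _ _ _ hi)).2

theorem upTo_pathRange {A : Finset ℕ} {k : ℕ} (hA : ∀ i ∈ A, i ≤ k) (p : Finset V → Prop) :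
    UpTo k {w : ℕ → V | p (pathRange w A)} := by
  intro w w' h hw
  rw [Set.mem_ofPred_eq] at hw ⊢
  rwa [← pathRange_congr fun i hi => h i (hA i hi)]

/-- Each of the two segments is read from its own starting time, so that stationarity and the gap
argument apply to it. The bound `2 * s ≤ r` keeps the truncated subtractions exact. -/
theorem pathZ_eq (r s : ℕ) (w : ℕ → V) (i j : ℕ) (hr : 2 * s ≤ r) :
    pathZ r s w (i + 1) (j + 1) = if (cutRange s (r - s) (shiftPath (i * r + s) w)
      ∩ pathRange (shiftPath (j * r + s) w) (Finset.Ico s (r - s - s))).Nonempty then 1 else 0 := by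
  have h1 : segA r s (i + 1) = Finset.Ico (i * r + s) (r - s + (i * r + s)) := by
    rw [segA, Nat.add_sub_cancel, Nat.succ_mul]
    congr 1; omega
  have h2 : segB r s (j + 1) = (Finset.Ico s (r - s - s)).image (· + (j * r + s)) := by
    rw [Finset.image_add_right_Ico, segB, Nat.add_sub_cancel, Nat.succ_mul j]
    congr 1 <;> omega
  rw [pathZ, h1, h2, pathRange_locNonErased_shift, pathRange_image_add]
  simp only [Finset.nonempty_iff_ne_empty]
  rfl

end Loop

/-! ### Separated segments of a walk -/

section Blocks

variable {V : Type*} [Fintype V] [DecidableEq V] [MeasurableSpace V] [MeasurableSingletonClass V]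
  (G : SimpleGraph V) [DecidableRel G.Adj] [Nonempty V] [hG : SymmWalk G]

/-- Segments of the walk separated by gaps in which it mixes are bounded below by independent
stationary segments. -/
theorem le_walkFrom_blocks {U : Type*} {r s m : ℕ} {δ : ℝ} (hδ : 0 ≤ δ)
    (hs : ∀ x y, δ * (Fintype.card V : ℝ)⁻¹ ≤ transProb G s x y) (hm : m + s ≤ r)
    (φ : (ℕ → V) → U) (hφ : ∀ u, UpTo m {w | φ w = u}) (x : V) (u : ℕ → U) (M : ℕ) :
    δ ^ M * ∏ k ∈ Finset.range M, (statWalk G).real {w | φ w = u k}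
      ≤ (walkFrom G x).real {w | ∀ k < M, φ (shiftPath (k * r + s) w) = u k} := by
  induction M with
  | zero => simp
  | succ M ih =>
    -- Segment `k` is decided by time `k * r + s + m ≤ (k + 1) * r`, which leaves `s` steps before
    -- segment `k + 1` begins.
    have hE : UpTo (M * r) {w : ℕ → V | ∀ k < M, φ (shiftPath (k * r + s) w) = u k} := by
      intro w w' h hw k hk
      refine (hφ (u k)).shift (k * r + s) (fun i hi => h i ?_) (hw k hk)
      have : (k + 1) * r ≤ M * r := Nat.mul_le_mul_right r hk
      rw [Nat.succ_mul] at this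
      omega
    have h1 := le_walkFrom_gap G hs x hE (hφ (u M)).measurableSet
    have h2 : {w : ℕ → V | ∀ k < M, φ (shiftPath (k * r + s) w) = u k}
        ∩ shiftPath (M * r + s) ⁻¹' {w | φ w = u M}
        = {w | ∀ k < M + 1, φ (shiftPath (k * r + s) w) = u k} := by
      ext w
      exact Nat.forall_lt_succ_right.symm
    rw [h2] at h1
    refine le_trans ?_ h1
    rw [Finset.prod_range_succ, pow_succ, mul_comm (δ ^ M) δ, mul_assoc, ← mul_assoc (δ ^ M)]
    exact mul_le_mul_of_nonneg_left (mul_le_mul_of_nonneg_right ih measureReal_nonneg) hδ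

end Blocks

/-! ### Moment bounds for hitting probabilities -/

/-- With `N` the number of events that occur, this integrates `2tN - t²N² ≤ 1_{N > 0}`, which is
`(tN - 1)² ≥ 0` where `N > 0`. The best `t` is the ratio of the first to the second moment. -/
theorem second_moment_le_measureReal_biUnion {Ω I : Type*} [MeasurableSpace Ω] (Q : Measure Ω)
    [IsFiniteMeasure Q] (T : Finset I) (E : I → Set Ω) (hE : ∀ a, MeasurableSet (E a)) (t : ℝ) :
    2 * t * ∑ a ∈ T, Q.real (E a) - t ^ 2 * ∑ a ∈ T, ∑ b ∈ T, Q.real (E a ∩ E b)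
      ≤ Q.real (⋃ a ∈ T, E a) := by
  classical
  have hU : MeasurableSet (⋃ a ∈ T, E a) := T.measurableSet_biUnion fun a _ => hE a
  have hi : ∀ {s : Set Ω}, MeasurableSet s → Integrable (s.indicator (1 : Ω → ℝ)) Q :=
    fun hs => (integrable_const 1).indicator hs
  have h1 : ∑ a ∈ T, Q.real (E a) = ∫ ω, ∑ a ∈ T, (E a).indicator (1 : Ω → ℝ) ω ∂Q := by
    rw [integral_finsetSum _ fun a _ => hi (hE a)]
    exact Finset.sum_congr rfl fun a _ => (integral_indicator_one (hE a)).symm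
  have h2 : ∑ a ∈ T, ∑ b ∈ T, Q.real (E a ∩ E b)
      = ∫ ω, ∑ a ∈ T, ∑ b ∈ T, (E a ∩ E b).indicator (1 : Ω → ℝ) ω ∂Q := by
    rw [integral_finsetSum _ fun a _ =>
      integrable_finsetSum _ fun b _ => hi ((hE a).inter (hE b))]
    refine Finset.sum_congr rfl fun a _ => ?_
    rw [integral_finsetSum _ fun b _ => hi ((hE a).inter (hE b))]
    exact Finset.sum_congr rfl fun b _ => (integral_indicator_one ((hE a).inter (hE b))).symm
  rw [h1, h2, ← integral_indicator_one hU, ← integral_const_mul, ← integral_const_mul,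
    ← integral_sub]
  · refine integral_mono ?_ (hi hU) fun ω => ?_
    · exact ((integrable_finsetSum _ fun a _ => hi (hE a)).const_mul _).sub
        ((integrable_finsetSum _ fun a _ =>
          integrable_finsetSum _ fun b _ => hi ((hE a).inter (hE b))).const_mul _)
    · have h3 : ∑ a ∈ T, ∑ b ∈ T, (E a ∩ E b).indicator (1 : Ω → ℝ) ω
          = (∑ a ∈ T, (E a).indicator (1 : Ω → ℝ) ω) ^ 2 := by
        rw [sq, Finset.sum_mul_sum]
        refine Finset.sum_congr rfl fun a _ => Finset.sum_congr rfl fun b _ => ?_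
        rw [Set.inter_indicator_one]
        rfl
      change _ * _ - _ * _ ≤ _
      rw [h3]
      by_cases hω : ω ∈ ⋃ a ∈ T, E a
      · rw [Set.indicator_of_mem hω]
        simp only [Pi.one_apply]
        nlinarith [sq_nonneg (t * (∑ a ∈ T, (E a).indicator (1 : Ω → ℝ) ω) - 1)]
      · have h0 : ∑ a ∈ T, (E a).indicator (1 : Ω → ℝ) ω = 0 := by
          refine Finset.sum_eq_zero fun a ha => Set.indicator_of_notMem (fun h => hω ?_) _
          exact Set.mem_biUnion ha h
        rw [h0, Set.indicator_of_notMem hω]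
        simp
  · exact (integrable_finsetSum _ fun a _ => hi (hE a)).const_mul _
  · exact (integrable_finsetSum _ fun a _ =>
      integrable_finsetSum _ fun b _ => hi ((hE a).inter (hE b))).const_mul _

/-- Splitting along the finite-valued `X` leaves only rectangles, so no measurability of `F` is
needed. -/
theorem prod_real_fiber {Ω Ω' U : Type*} [MeasurableSpace Ω] [MeasurableSpace Ω'] [Fintype U]
    (μ : Measure Ω) (ν : Measure Ω') [IsFiniteMeasure μ] [IsFiniteMeasure ν] (X : Ω → U)
    (hX : ∀ u, MeasurableSet {ω | X ω = u}) (F : U → Set Ω') :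
    (μ.prod ν).real {w | w.2 ∈ F (X w.1)} = ∑ u, μ.real {ω | X ω = u} * ν.real (F u) := by
  rw [measureReal_eq_sum_fiber _ (fun w : Ω × Ω' => X w.1) fun u => measurable_fst (hX u)]
  refine Finset.sum_congr rfl fun u _ => ?_
  rw [← measureReal_prod_prod]
  congr 1
  ext w
  simp only [Set.mem_inter_iff, Set.mem_ofPred_eq, Set.mem_prod]
  constructor
  · rintro ⟨h1, h2⟩
    exact ⟨h2, h2 ▸ h1⟩
  · rintro ⟨h1, h2⟩
    exact ⟨h1 ▸ h2, h1⟩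

theorem prod_real_fiber_snd {Ω Ω' U : Type*} [MeasurableSpace Ω] [MeasurableSpace Ω'] [Fintype U]
    (μ : Measure Ω) (ν : Measure Ω') [IsFiniteMeasure μ] [IsFiniteMeasure ν] (X : Ω' → U)
    (hX : ∀ u, MeasurableSet {ω | X ω = u}) (F : U → Set Ω) :
    (μ.prod ν).real {w | w.1 ∈ F (X w.2)} = ∑ u, ν.real {ω | X ω = u} * μ.real (F u) := by
  rw [measureReal_eq_sum_fiber _ (fun w : Ω × Ω' => X w.2) fun u => measurable_snd (hX u)]
  refine Finset.sum_congr rfl fun u _ => ?_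
  rw [mul_comm, ← measureReal_prod_prod]
  congr 1
  ext w
  simp only [Set.mem_inter_iff, Set.mem_ofPred_eq, Set.mem_prod]
  constructor
  · rintro ⟨h1, h2⟩
    exact ⟨h2 ▸ h1, h2⟩
  · rintro ⟨h1, h2⟩
    exact ⟨h2 ▸ h1, h2⟩

/-- Each distance from `k` occurs at most once on either side. -/
theorem sum_dist_le {r k : ℕ} (hk : k < r) (f : ℕ → ℝ) (hf : ∀ i, 0 ≤ f i) :
    ∑ l ∈ Finset.range r, f (Nat.dist k l) ≤ 2 * ∑ i ∈ Finset.range r, f i := by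
  rw [← Finset.sum_filter_add_sum_filter_not (Finset.range r) (· ≤ k), two_mul]
  have h : ∀ (T : Finset ℕ) (g : ℕ → ℕ), (∀ l ∈ T, Nat.dist k l = g l) →
      (∀ l ∈ T, g l < r) → Set.InjOn g T →
      ∑ l ∈ T, f (Nat.dist k l) ≤ ∑ i ∈ Finset.range r, f i := by
    intro T g h1 h2 h3
    rw [Finset.sum_congr rfl fun l hl => by rw [h1 l hl], ← Finset.sum_image h3]
    refine Finset.sum_le_sum_of_subset_of_nonneg ?_ fun i _ _ => hf i
    intro i hi
    obtain ⟨l, hl, rfl⟩ := Finset.mem_image.1 hi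
    exact Finset.mem_range.2 (h2 l hl)
  refine add_le_add (h _ (fun l => k - l) ?_ ?_ ?_) (h _ (fun l => l - k) ?_ ?_ ?_)
  · intro l hl
    exact Nat.dist_eq_sub_of_le_right (Finset.mem_filter.1 hl).2
  · intro l hl
    omega
  · intro a ha b hb hab
    have ha := (Finset.mem_filter.1 ha).2
    have hb := (Finset.mem_filter.1 hb).2
    change k - a = k - b at hab
    omega
  · intro l hl
    exact Nat.dist_eq_sub_of_le (not_le.1 (Finset.mem_filter.1 hl).2).le
  · intro l hl
    have := Finset.mem_range.1 (Finset.mem_filter.1 hl).1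
    change l - k < r
    omega
  · intro a ha b hb hab
    have ha := not_le.1 (Finset.mem_filter.1 ha).2
    have hb := not_le.1 (Finset.mem_filter.1 hb).2
    change a - k = b - k at hab
    omega

/-! ### Meetings of two independent stationary walks. -/

section Hit

variable {V : Type*} [Fintype V] [DecidableEq V] [MeasurableSpace V] [MeasurableSingletonClass V]
  (G : SimpleGraph V) [DecidableRel G.Adj] [Nonempty V] [hG : SymmWalk G]

theorem statWalk_hit_le (A : Finset ℕ) (S : Finset V) :
    (statWalk G).real {w | (pathRange w A ∩ S).Nonempty}
      ≤ A.card * S.card * (Fintype.card V : ℝ)⁻¹ := by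
  have h1 : {w : ℕ → V | (pathRange w A ∩ S).Nonempty} ⊆
      ⋃ p ∈ A ×ˢ S, {w | w p.1 = p.2} := by
    rintro w ⟨v, hv⟩
    rw [Finset.mem_inter, pathRange, Finset.mem_image] at hv
    obtain ⟨⟨i, hi, hiv⟩, hS⟩ := hv
    exact Set.mem_biUnion (show (i, v) ∈ A ×ˢ S from Finset.mem_product.2 ⟨hi, hS⟩) hiv
  refine (measureReal_mono h1 (measure_ne_top _ _)).trans ((measureReal_biUnion_finset_le _ _).trans ?_)
  simp only [statWalk_eval, Finset.sum_const, Finset.card_product, nsmul_eq_mul, Nat.cast_mul]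
  exact le_rfl

/-- Given the two meeting points `x` and `y`, one walk goes from `x` to `y`. By symmetry the other
may be run back from `y` to `x`, and summing over `y` closes a loop at `x`. -/
theorem prod_statWalk_pair (k m k' m' : ℕ) :
    ((statWalk G).prod (statWalk G)).real
        ({w | w.1 k = w.2 m} ∩ {w | w.1 k' = w.2 m'})
      = (Fintype.card V : ℝ)⁻¹ ^ 2 * ∑ x, transProb G (Nat.dist k k' + Nat.dist m m') x x := by
  have h := prod_real_fiber (statWalk G) (statWalk G) (fun w : ℕ → V => (w k, w k'))
    (fun u => by
      have : {w : ℕ → V | (w k, w k') = u} = {w | w k = u.1} ∩ {w | w k' = u.2} := by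
        ext w; simp [Prod.ext_iff]
      rw [this]
      exact (measurableSet_eval k _).inter (measurableSet_eval k' _))
    (fun u => {w | w m = u.1} ∩ {w | w m' = u.2})
  have e : {w : (ℕ → V) × (ℕ → V) | w.1 k = w.2 m} ∩ {w | w.1 k' = w.2 m'}
      = {w : (ℕ → V) × (ℕ → V) | w.2 ∈ (fun u : V × V =>
          ({w | w m = u.1} ∩ {w | w m' = u.2} : Set (ℕ → V))) (w.1 k, w.1 k')} := by
    ext w
    simp [eq_comm]
  rw [e, h, Fintype.sum_prod_type, Finset.mul_sum]
  refine Finset.sum_congr rfl fun x _ => ?_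
  rw [transProb_add, Finset.mul_sum]
  refine Finset.sum_congr rfl fun y _ => ?_
  have h2 : {w : ℕ → V | (w k, w k') = (x, y)} = {w | w k = x} ∩ {w | w k' = y} := by
    ext w; simp
  rw [h2, statWalk_pair, statWalk_pair, hG.comm (Nat.dist m m') y x]
  ring

/-- The first walk at time `k` is uniform and independent of the second walk. -/
theorem prod_statWalk_meet (k m : ℕ) (D : Set (ℕ → V)) :
    ((statWalk G).prod (statWalk G)).real {w | w.1 k = w.2 m ∧ w.2 ∈ D}
      = (Fintype.card V : ℝ)⁻¹ * (statWalk G).real D := by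
  rw [measureReal_eq_sum_fiber _ (fun w : (ℕ → V) × (ℕ → V) => w.2 m)
    fun u => measurable_snd (measurableSet_eval m u),
    measureReal_eq_sum_fiber (statWalk G) (fun w : ℕ → V => w m) (measurableSet_eval m),
    Finset.mul_sum]
  refine Finset.sum_congr rfl fun v _ => ?_
  rw [← statWalk_eval G k v, ← measureReal_prod_prod]
  congr 1
  ext w
  simp only [Set.mem_inter_iff, Set.mem_ofPred_eq, Set.mem_prod]
  constructor
  · rintro ⟨⟨h1, h2⟩, h3⟩
    exact ⟨h1.trans h3, h2, h3⟩
  · rintro ⟨h1, h2, h3⟩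
    exact ⟨⟨h1.trans h3.symm, h2⟩, h3⟩

/-- Once `i` or `j` exceeds the mixing time, so does `i + j`, and the return probability is at most
`5/4` of the uniform one. The other terms belong to `returnSum`. -/
theorem sum_transProb_le {r : ℕ} (h : mixTime G ≠ 0) (x : V) :
    ∑ i ∈ Finset.range r, ∑ j ∈ Finset.range r, transProb G (i + j) x x
      ≤ returnSum G (mixTime G) x + r ^ 2 * (5 / 4 * (Fintype.card V : ℝ)⁻¹) := by
  set t := mixTime G + 1 with ht
  have hc : (0 : ℝ) ≤ 5 / 4 * (Fintype.card V : ℝ)⁻¹ := by positivity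
  have h1 : ∀ i j, transProb G (i + j) x x ≤ (if i < t then if j < t then
      transProb G (i + j) x x else 0 else 0) + 5 / 4 * (Fintype.card V : ℝ)⁻¹ := by
    intro i j
    by_cases hi : i < t
    · by_cases hj : j < t
      · simp [hi, hj]
      · rw [if_pos hi, if_neg hj, zero_add]
        exact transProb_le_of_mixTime_le G h (by omega) x x
    · rw [if_neg hi, zero_add]
      exact transProb_le_of_mixTime_le G h (by omega) x x
  have h2 : ∀ g : ℕ → ℝ, (∀ i, 0 ≤ g i) →
      ∑ i ∈ Finset.range r, (if i < t then g i else 0) ≤ ∑ i ∈ Finset.range t, g i := by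
    intro g hg
    rw [← Finset.sum_filter]
    refine Finset.sum_le_sum_of_subset_of_nonneg ?_ fun i _ _ => hg i
    intro i hi
    exact Finset.mem_range.2 (Finset.mem_filter.1 hi).2
  calc _ ≤ ∑ i ∈ Finset.range r, ∑ j ∈ Finset.range r, ((if i < t then if j < t then
      transProb G (i + j) x x else 0 else 0) + 5 / 4 * (Fintype.card V : ℝ)⁻¹) :=
        Finset.sum_le_sum fun i _ => Finset.sum_le_sum fun j _ => h1 i j
    _ = ∑ i ∈ Finset.range r, (if i < t then ∑ j ∈ Finset.range r, (if j < t then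
      transProb G (i + j) x x else 0) else 0) + r ^ 2 * (5 / 4 * (Fintype.card V : ℝ)⁻¹) := by
        simp only [Finset.sum_add_distrib, Finset.sum_const, Finset.card_range, nsmul_eq_mul]
        congr 1
        · refine Finset.sum_congr rfl fun i _ => ?_
          by_cases hi : i < t <;> simp [hi]
        · ring
    _ ≤ _ := by
        refine add_le_add ((h2 _ fun i => Finset.sum_nonneg fun j _ => ?_).trans ?_) le_rfl
        · split_ifs
          · exact transProb_nonneg G _ _ _
          · exact le_rfl
        · exact Finset.sum_le_sum fun i _ => h2 _ fun j => transProb_nonneg G _ _ _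

/-- The factor `4` is a factor `2` from `sum_dist_le` in each of the two time coordinates; the sum
over base points cancels one power of the number of vertices. -/
theorem sum_prod_statWalk_pair_le {r : ℕ} {C : ℝ}
    (hC : ∀ x, ∑ i ∈ Finset.range r, ∑ j ∈ Finset.range r, transProb G (i + j) x x ≤ C)
    (T : Finset (ℕ × ℕ)) (hT : T ⊆ Finset.range r ×ˢ Finset.range r) :
    ∑ a ∈ T, ∑ b ∈ T, ((statWalk G).prod (statWalk G)).real
        ({w | w.1 a.1 = w.2 a.2} ∩ {w | w.1 b.1 = w.2 b.2})
      ≤ 4 * C * (r ^ 2 * (Fintype.card V : ℝ)⁻¹) := by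
  have hn : (Fintype.card V : ℝ) ≠ 0 := by exact_mod_cast Fintype.card_ne_zero
  have h1 : ∀ a ∈ Finset.range r ×ˢ Finset.range r,
      ∑ b ∈ Finset.range r ×ˢ Finset.range r, ((statWalk G).prod (statWalk G)).real
        ({w | w.1 a.1 = w.2 a.2} ∩ {w | w.1 b.1 = w.2 b.2})
      ≤ 4 * C * (Fintype.card V : ℝ)⁻¹ := by
    intro a ha
    obtain ⟨ha1, ha2⟩ := Finset.mem_product.1 ha
    have ha1 := Finset.mem_range.1 ha1
    have ha2 := Finset.mem_range.1 ha2
    simp only [prod_statWalk_pair]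
    rw [← Finset.mul_sum, Finset.sum_comm]
    have h2 : ∀ x, ∑ b ∈ Finset.range r ×ˢ Finset.range r,
        transProb G (Nat.dist a.1 b.1 + Nat.dist a.2 b.2) x x ≤ 4 * C := by
      intro x
      rw [Finset.sum_product]
      calc _ ≤ ∑ k ∈ Finset.range r, 2 * ∑ j ∈ Finset.range r,
            transProb G (Nat.dist a.1 k + j) x x :=
            Finset.sum_le_sum fun k _ => sum_dist_le ha2
              (fun j => transProb G (Nat.dist a.1 k + j) x x) fun j => transProb_nonneg G _ _ _
        _ ≤ 2 * ∑ i ∈ Finset.range r, 2 * ∑ j ∈ Finset.range r, transProb G (i + j) x x :=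
            sum_dist_le ha1 (fun i => 2 * ∑ j ∈ Finset.range r, transProb G (i + j) x x)
              fun i => mul_nonneg zero_le_two
                (Finset.sum_nonneg fun j _ => transProb_nonneg G _ _ _)
        _ ≤ _ := by
            rw [← Finset.mul_sum]
            linarith [hC x]
    calc _ ≤ (Fintype.card V : ℝ)⁻¹ ^ 2 * ∑ _x : V, 4 * C :=
          mul_le_mul_of_nonneg_left (Finset.sum_le_sum fun x _ => h2 x) (by positivity)
      _ = _ := by
          simp only [Finset.sum_const, Finset.card_univ, nsmul_eq_mul]
          field_simp
  calc _ ≤ ∑ a ∈ Finset.range r ×ˢ Finset.range r, ∑ b ∈ Finset.range r ×ˢ Finset.range r,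
      ((statWalk G).prod (statWalk G)).real
        ({w | w.1 a.1 = w.2 a.2} ∩ {w | w.1 b.1 = w.2 b.2}) := by
        refine (Finset.sum_le_sum_of_subset_of_nonneg hT fun a _ _ =>
          Finset.sum_nonneg fun b _ => measureReal_nonneg).trans' ?_
        exact Finset.sum_le_sum fun a _ =>
          Finset.sum_le_sum_of_subset_of_nonneg hT fun b _ _ => measureReal_nonneg
    _ ≤ ∑ _a ∈ Finset.range r ×ˢ Finset.range r, 4 * C * (Fintype.card V : ℝ)⁻¹ :=
        Finset.sum_le_sum h1
    _ = _ := by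
        simp only [Finset.sum_const, Finset.card_product, Finset.card_range, nsmul_eq_mul]
        push_cast
        ring

end Hit

/-! ### Avoidance of the past and the size of the hitting probability `cutHit`. -/

section CutHit

variable {V : Type*}

/-- The path does not return, during the `l` steps after time `i`, to a vertex visited up to
time `i`. -/
def avoid (i l : ℕ) : Set (ℕ → V) := {w | ∀ a ≤ i, ∀ b, i < b → b ≤ i + l → w a ≠ w b}

theorem upTo_avoid (i l : ℕ) : UpTo (i + l) (avoid i l : Set (ℕ → V)) := by
  intro w w' h hw a ha b hb hbl
  rw [← h a (by omega), ← h b hbl]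
  exact hw a ha b hb hbl

theorem avoid_subset {i l s : ℕ} (hi : s ≤ i) (hl : s ≤ l) :
    (avoid i l : Set (ℕ → V)) ⊆ shiftPath (i - s) ⁻¹' avoid s s := by
  intro w hw a ha b hb hbs
  exact hw (a + (i - s)) (by omega) (b + (i - s)) (by omega) (by omega)

variable [Fintype V] [DecidableEq V] [MeasurableSpace V] [MeasurableSingletonClass V]
  (G : SimpleGraph V) [DecidableRel G.Adj] [Nonempty V] [hG : SymmWalk G]

theorem upTo_notMem (l : ℕ) (S : Finset V) :
    UpTo l {w : ℕ → V | ∀ b, 0 < b → b ≤ l → w b ∉ S} := by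
  intro w w' h hw b hb hbl
  rw [← h b hbl]
  exact hw b hb hbl

theorem upTo_range_eq (i : ℕ) (S : Finset V) :
    UpTo i {w : ℕ → V | pathRange w (Finset.range (i + 1)) = S} :=
  upTo_pathRange (fun _ hj => Nat.lt_succ_iff.1 (Finset.mem_range.1 hj)) (· = S)

theorem setOf_pair_eq (i : ℕ) (u : Finset V × V) :
    {w : ℕ → V | (pathRange w (Finset.range (i + 1)), w i) = u}
      = {w | pathRange w (Finset.range (i + 1)) = u.1} ∩ {w | w i = u.2} := by
  ext w
  simp [Prod.ext_iff]

/-- The Markov property at time `i`: the future needs only the current vertex and the set of visited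
vertices. -/
theorem statWalk_avoid (i l : ℕ) :
    (statWalk G).real (avoid i l) = ∑ u : Finset V × V,
      (statWalk G).real {w | (pathRange w (Finset.range (i + 1)), w i) = u}
        * (walkFrom G u.2).real {w | ∀ b, 0 < b → b ≤ l → w b ∉ u.1} := by
  rw [measureReal_eq_sum_fiber _ (fun w : ℕ → V => (pathRange w (Finset.range (i + 1)), w i))
    (fun u => by
      rw [setOf_pair_eq]
      exact ((upTo_range_eq i u.1).measurableSet).inter (measurableSet_eval i u.2))]
  refine Finset.sum_congr rfl fun u _ => ?_
  rw [setOf_pair_eq, ← statWalk_markov_at G u.2 (upTo_range_eq i u.1)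
    (upTo_notMem l u.1).measurableSet, Set.inter_comm]
  congr 1
  ext w
  simp only [Set.mem_inter_iff, Set.mem_ofPred_eq, Set.mem_preimage, shiftPath, avoid]
  refine and_congr_right fun h => ?_
  rw [← h.1]
  simp only [pathRange, Finset.mem_image, Finset.mem_range, not_exists, not_and]
  constructor
  · intro h1 b hb hbl a ha
    exact h1 a (by omega) (b + i) (by omega) (by omega)
  · intro h1 a ha b hb hbl
    have := h1 (b - i) (by omega) (by omega) a (by omega)
    rwa [Nat.sub_add_cancel hb.le] at this

/-- Given a meeting of `w.1` at time `i` with `w.2` at time `j`, the past of the first followed by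
the future of the second has the law of one stationary walk around time `i`. The prefactor is the
cost of the meeting. -/
theorem prod_statWalk_last_meet (i j l : ℕ) :
    ((statWalk G).prod (statWalk G)).real {w | w.1 i = w.2 j ∧
        ∀ a ≤ i, ∀ b, j < b → b ≤ j + l → w.1 a ≠ w.2 b}
      = (Fintype.card V : ℝ)⁻¹ * (statWalk G).real (avoid i l) := by
  have h := prod_real_fiber (statWalk G) (statWalk G)
    (fun w : ℕ → V => (pathRange w (Finset.range (i + 1)), w i))
    (fun u => by
      rw [setOf_pair_eq]
      exact ((upTo_range_eq i u.1).measurableSet).inter (measurableSet_eval i u.2))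
    (fun u => {w | w j = u.2} ∩ shiftPath j ⁻¹' {w | ∀ b, 0 < b → b ≤ l → w b ∉ u.1})
  have e : {w : (ℕ → V) × (ℕ → V) | w.1 i = w.2 j ∧
        ∀ a ≤ i, ∀ b, j < b → b ≤ j + l → w.1 a ≠ w.2 b}
      = {w : (ℕ → V) × (ℕ → V) | w.2 ∈ (fun u : Finset V × V =>
        ({w | w j = u.2} ∩ shiftPath j ⁻¹' {w | ∀ b, 0 < b → b ≤ l → w b ∉ u.1} : Set (ℕ → V)))
          (pathRange w.1 (Finset.range (i + 1)), w.1 i)} := by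
    ext w
    simp only [Set.mem_inter_iff, Set.mem_ofPred_eq, Set.mem_preimage, shiftPath, pathRange,
      Finset.mem_image, Finset.mem_range, not_exists, not_and]
    refine and_congr eq_comm ⟨fun h1 b hb hbl a ha => ?_, fun h1 a ha b hb hbl => ?_⟩
    · exact h1 a (by omega) (b + j) (by omega) (by omega)
    · have := h1 (b - j) (by omega) (by omega) a (by omega)
      rwa [Nat.sub_add_cancel hb.le] at this
  rw [e, h, statWalk_avoid, Finset.mul_sum]
  refine Finset.sum_congr rfl fun u _ => ?_
  rw [statWalk_eval_shift G j u.2 (upTo_notMem l u.1).measurableSet]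
  ring

theorem measurableSet_meet (k m : ℕ) :
    MeasurableSet {w : (ℕ → V) × (ℕ → V) | w.1 k = w.2 m} := by
  have : {w : (ℕ → V) × (ℕ → V) | w.1 k = w.2 m}
      = ⋃ v : V, ({w | w k = v} ×ˢ {w | w m = v} : Set ((ℕ → V) × (ℕ → V))) := by
    ext w
    simp [eq_comm]
  rw [this]
  exact MeasurableSet.iUnion fun v => (measurableSet_eval k v).prod (measurableSet_eval m v)

/-- A lower bound for the probability that a walk does not return to its past. -/
theorem le_statWalk_avoid {r s : ℕ} {C : ℝ} (hC0 : 0 < C)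
    (hC : ∀ x, ∑ i ∈ Finset.range r, ∑ j ∈ Finset.range r, transProb G (i + j) x x ≤ C) :
    (r : ℝ) ^ 2 / (4 * C) ≤ r ^ 2 * (statWalk G).real (avoid s s) + 2 * s * r := by
  have hn : (0 : ℝ) < Fintype.card V := by exact_mod_cast Fintype.card_pos
  set Q := (statWalk G).prod (statWalk G) with hQ
  set U := (statWalk G).real (avoid s s) with hU
  set T := Finset.range r ×ˢ Finset.range r with hT
  -- The parameter `1 / (4 * C)` is the ratio of the first moment `r²/n` to the bound `4C r²/n` on
  -- the second.
  have hlow := second_moment_le_measureReal_biUnion Q T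
    (fun a => {w : (ℕ → V) × (ℕ → V) | w.1 a.1 = w.2 a.2})
    (fun a => measurableSet_meet a.1 a.2) (1 / (4 * C))
  have h1 : ∑ a ∈ T, Q.real {w : (ℕ → V) × (ℕ → V) | w.1 a.1 = w.2 a.2}
      = r ^ 2 * (Fintype.card V : ℝ)⁻¹ := by
    have : ∀ a : ℕ × ℕ, Q.real {w : (ℕ → V) × (ℕ → V) | w.1 a.1 = w.2 a.2}
        = (Fintype.card V : ℝ)⁻¹ := by
      intro a
      have := prod_statWalk_meet G a.1 a.2 Set.univ
      simpa using this
    simp only [this, Finset.sum_const, hT, Finset.card_product, Finset.card_range, nsmul_eq_mul]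
    push_cast
    ring
  have h2 := sum_prod_statWalk_pair_le G hC T subset_rfl
  have hup : Q.real (⋃ a ∈ T, {w : (ℕ → V) × (ℕ → V) | w.1 a.1 = w.2 a.2})
      ≤ (Fintype.card V : ℝ)⁻¹ * (r ^ 2 * U + 2 * s * r) := by
    have hsub : (⋃ a ∈ T, {w : (ℕ → V) × (ℕ → V) | w.1 a.1 = w.2 a.2})
        ⊆ ⋃ a ∈ T, {w : (ℕ → V) × (ℕ → V) | w.1 a.1 = w.2 a.2 ∧ ∀ k ≤ a.1, ∀ b, a.2 < b →
          b ≤ a.2 + (r - 1 - a.2) → w.1 k ≠ w.2 b} := by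
      intro w hw
      obtain ⟨a, ha, haw⟩ := Set.mem_iUnion₂.1 hw
      classical
      obtain ⟨ha1, ha2⟩ := Finset.mem_product.1 ha
      -- Take the last time of the second walk at a vertex visited by the first, with any visit time
      -- `i` of the first. Nothing the second walk does later, up to time `r - 1`, touches the first
      -- walk.
      set J := (Finset.range r).filter fun j => ∃ k < r, w.1 k = w.2 j with hJ
      have hJn : J.Nonempty := ⟨a.2, Finset.mem_filter.2 ⟨ha2, a.1, Finset.mem_range.1 ha1, haw⟩⟩
      obtain ⟨hj1, i, hi, hij⟩ := Finset.mem_filter.1 (J.max'_mem hJn)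
      refine Set.mem_biUnion (show (i, J.max' hJn) ∈ T from
        Finset.mem_product.2 ⟨Finset.mem_range.2 hi, hj1⟩) ⟨hij, ?_⟩
      intro k hk b hb hbr hkb
      have hj1 := Finset.mem_range.1 hj1
      have hki : k ≤ i := hk
      have hb1 : b ≤ J.max' hJn + (r - 1 - J.max' hJn) := hbr
      have : b ∈ J := Finset.mem_filter.2
        ⟨Finset.mem_range.2 (by omega), k, by omega, hkb⟩
      exact absurd (J.le_max' b this) (not_le.2 hb)
    refine (measureReal_mono hsub (measure_ne_top _ _)).trans
      ((measureReal_biUnion_finset_le _ _).trans ?_)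
    simp only [hQ, prod_statWalk_last_meet]
    rw [← Finset.mul_sum]
    refine mul_le_mul_of_nonneg_left ?_ (inv_nonneg.2 hn.le)
    -- Windows of length `s` fit around the meeting unless it falls in the first `s` times of one
    -- walk or the last `s` of the other. Those at most `2sr` pairs are bounded trivially.
    have h3 : ∀ a ∈ T, (statWalk G).real (avoid a.1 (r - 1 - a.2))
        ≤ U + (if a.1 < s then 1 else 0) + (if r - 1 - a.2 < s then 1 else 0) := by
      intro a _
      have hU0 : 0 ≤ U := measureReal_nonneg
      by_cases h4 : a.1 < s
      · rw [if_pos h4]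
        have := measureReal_le_one (μ := statWalk G) (s := avoid a.1 (r - 1 - a.2))
        split_ifs <;> linarith
      · by_cases h5 : r - 1 - a.2 < s
        · rw [if_pos h5, if_neg h4]
          have := measureReal_le_one (μ := statWalk G) (s := avoid a.1 (r - 1 - a.2))
          linarith
        · rw [if_neg h5, if_neg h4, add_zero, add_zero]
          refine (measureReal_mono (avoid_subset (not_lt.1 h4) (not_lt.1 h5))).trans ?_
          rw [statWalk_shift G _ (upTo_avoid s s).measurableSet]
    refine (Finset.sum_le_sum h3).trans ?_
    have h6 : ∑ i ∈ Finset.range r, (if i < s then (1 : ℝ) else 0) ≤ s := by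
      rw [← Finset.sum_filter, Finset.sum_const, nsmul_eq_mul, mul_one]
      have : ((Finset.range r).filter (· < s)).card ≤ (Finset.range s).card :=
        Finset.card_le_card fun i hi => Finset.mem_range.2 (Finset.mem_filter.1 hi).2
      rw [Finset.card_range] at this
      exact_mod_cast this
    have h7 : ∑ j ∈ Finset.range r, (if r - 1 - j < s then (1 : ℝ) else 0)
        = ∑ i ∈ Finset.range r, (if i < s then (1 : ℝ) else 0) :=
      Finset.sum_range_reflect (fun i => if i < s then (1 : ℝ) else 0) r
    have h8 : ∑ i ∈ Finset.range r, ∑ _j ∈ Finset.range r, (if i < s then (1 : ℝ) else 0)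
        = r * ∑ i ∈ Finset.range r, (if i < s then (1 : ℝ) else 0) := by
      rw [Finset.sum_comm, Finset.sum_const, Finset.card_range, nsmul_eq_mul]
    rw [hT, Finset.sum_product]
    simp only [Finset.sum_add_distrib, h7, h8]
    simp only [Finset.sum_const, Finset.card_range, nsmul_eq_mul]
    have hr : (0 : ℝ) ≤ r := Nat.cast_nonneg r
    nlinarith [mul_le_mul_of_nonneg_left h6 hr]
  rw [h1] at hlow
  have h8 := hlow.trans hup
  have h9 : (1 / (4 * C)) ^ 2 * ∑ a ∈ T, ∑ b ∈ T, Q.real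
      ({w : (ℕ → V) × (ℕ → V) | w.1 a.1 = w.2 a.2} ∩ {w | w.1 b.1 = w.2 b.2})
      ≤ (1 / (4 * C)) ^ 2 * (4 * C * (r ^ 2 * (Fintype.card V : ℝ)⁻¹)) :=
    mul_le_mul_of_nonneg_left h2 (sq_nonneg _)
  have h10 : (1 / (4 * C)) ^ 2 * (4 * C * (r ^ 2 * (Fintype.card V : ℝ)⁻¹))
      = (Fintype.card V : ℝ)⁻¹ * ((r : ℝ) ^ 2 / (4 * C)) := by
    field_simp
  have h11 : 2 * (1 / (4 * C)) * ((r : ℝ) ^ 2 * (Fintype.card V : ℝ)⁻¹)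
      = 2 * ((Fintype.card V : ℝ)⁻¹ * ((r : ℝ) ^ 2 / (4 * C))) := by
    field_simp
  have h12 : (Fintype.card V : ℝ)⁻¹ * ((r : ℝ) ^ 2 / (4 * C))
      ≤ (Fintype.card V : ℝ)⁻¹ * (r ^ 2 * U + 2 * s * r) := by linarith
  exact le_of_mul_le_mul_left h12 (inv_pos.2 hn)

theorem statWalk_avoid_le_nonErased {s a c m : ℕ} (h1 : a + s ≤ m) (h2 : m + s < c) :
    (statWalk G).real (avoid s s)
      ≤ (statWalk G).real {w | m ∈ locNonErased w s (Finset.Ico a c)} := by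
  rw [← statWalk_shift G (m - s) (upTo_avoid s s).measurableSet]
  refine measureReal_mono fun w hw => ?_
  refine mem_locNonErased_of_disjoint h1 h2 fun i j hi him hj hjm => ?_
  have := hw (i - (m - s)) (by omega) (j - (m - s)) (by omega) (by omega)
  rwa [shiftPath, shiftPath, Nat.sub_add_cancel hi, Nat.sub_add_cancel (by omega)] at this

theorem segA_one {r s : ℕ} (h : s ≤ r) : segA r s 1 = Finset.Ico s (r - s + s) := by
  rw [segA, Nat.sub_self, zero_mul, zero_add, one_mul, Nat.sub_add_cancel h]

theorem upTo_mem_locNonErased (s a c m : ℕ) :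
    UpTo (m + s) {w : ℕ → V | m ∈ locNonErased w s (Finset.Ico a c)} := by
  intro w w' h hw
  rw [Set.mem_ofPred_eq, mem_locNonErased] at hw ⊢
  refine ⟨hw.1, hw.2.1, ?_⟩
  have h3 : nonErased w (m - s) s = nonErased w' (m - s) s :=
    nonErased_congr fun i hi => h i (by omega)
  rw [← hw.2.2, h3, pathRange_congr (w := w') (w' := w) (A := nonErased w' (m - s) s),
    pathRange_congr (w := w') (w' := w) (A := Finset.Icc (m + 1) (m + s))]
  · intro i hi
    have := Finset.mem_Icc.1 hi
    exact (h i (by omega)).symm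
  · intro i hi
    have := Finset.mem_Icc.1 (nonErased_subset w' _ _ hi)
    exact (h i (by omega)).symm

/-- The probability that a stationary walk hits the locally non-erased part of an independent
one during the first segment. -/
def cutHit (r s : ℕ) : ℝ := ((statWalk G).prod (statWalk G)).real
  {w | (pathRange w.1 (segA r s 1) ∩ pathRange w.2 (locNonErased w.2 s (segA r s 1))).Nonempty}

theorem le_cutHit {r s : ℕ} {C κ : ℝ} (hC0 : 0 < C)
    (hC : ∀ x, ∑ i ∈ Finset.range r, ∑ j ∈ Finset.range r, transProb G (i + j) x x ≤ C)
    (hs : 6 * s ≤ r) (hκ0 : 0 ≤ κ) (hκ : κ ≤ (statWalk G).real (avoid s s)) :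
    (κ / 4) ^ 2 / (4 * C) * (r ^ 2 * (Fintype.card V : ℝ)⁻¹) ≤ cutHit G r s := by
  have hn : (0 : ℝ) < Fintype.card V := by exact_mod_cast Fintype.card_pos
  set Q := (statWalk G).prod (statWalk G) with hQ
  -- The times in `[2s, r - s)` are those whose two windows of length `s` fit inside the segment.
  set T := Finset.Ico s r ×ˢ Finset.Ico (2 * s) (r - s) with hT
  set E : ℕ × ℕ → Set ((ℕ → V) × (ℕ → V)) := fun a =>
    {w | w.1 a.1 = w.2 a.2 ∧ w.2 ∈ {w : ℕ → V | a.2 ∈ locNonErased w s (Finset.Ico s r)}} with hE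
  -- Again the ratio of moments, here `(κ/4) r²/n` to `4C r²/n`.
  have hlow := second_moment_le_measureReal_biUnion Q T E
    (fun a => (measurableSet_meet a.1 a.2).inter
      (measurable_snd (upTo_mem_locNonErased s s r a.2).measurableSet)) (κ / 4 / (4 * C))
  have h1 : κ / 4 * (r ^ 2 * (Fintype.card V : ℝ)⁻¹) ≤ ∑ a ∈ T, Q.real (E a) := by
    have h2 : ∀ a ∈ T, (Fintype.card V : ℝ)⁻¹ * κ ≤ Q.real (E a) := by
      intro a ha
      have ha := Finset.mem_Ico.1 (Finset.mem_product.1 ha).2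
      rw [hQ, hE, prod_statWalk_meet]
      refine mul_le_mul_of_nonneg_left (hκ.trans ?_) (inv_nonneg.2 hn.le)
      exact statWalk_avoid_le_nonErased G (by omega) (by omega)
    refine le_trans ?_ (Finset.sum_le_sum h2)
    rw [Finset.sum_const, hT, Finset.card_product, Nat.card_Ico, Nat.card_Ico, nsmul_eq_mul]
    -- Since `6 * s ≤ r`, both time ranges contain at least `r/2` times.
    have h3 : ((r : ℝ) / 2) ^ 2 ≤ (((r - s) * (r - s - 2 * s) : ℕ) : ℝ) := by
      rw [Nat.cast_mul, sq]
      have h4 : r ≤ 2 * (r - s) := by omega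
      have h5 : r ≤ 2 * (r - s - 2 * s) := by omega
      have h4 : (r : ℝ) ≤ 2 * ((r - s : ℕ) : ℝ) := by exact_mod_cast h4
      have h5 : (r : ℝ) ≤ 2 * ((r - s - 2 * s : ℕ) : ℝ) := by exact_mod_cast h5
      exact mul_le_mul (by linarith) (by linarith) (by positivity) (by positivity)
    calc _ = ((r : ℝ) / 2) ^ 2 * ((Fintype.card V : ℝ)⁻¹ * κ) := by ring
      _ ≤ _ := mul_le_mul_of_nonneg_right h3 (by positivity)
  have h2 : ∑ a ∈ T, ∑ b ∈ T, Q.real (E a ∩ E b) ≤ 4 * C * (r ^ 2 * (Fintype.card V : ℝ)⁻¹) := by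
    refine le_trans ?_ (sum_prod_statWalk_pair_le G hC T ?_)
    · refine Finset.sum_le_sum fun a _ => Finset.sum_le_sum fun b _ => ?_
      exact measureReal_mono (Set.inter_subset_inter (fun w hw => hw.1) (fun w hw => hw.1))
    · intro a ha
      obtain ⟨ha1, ha2⟩ := Finset.mem_product.1 ha
      have ha1 := Finset.mem_Ico.1 ha1
      have ha2 := Finset.mem_Ico.1 ha2
      exact Finset.mem_product.2 ⟨Finset.mem_range.2 (by omega), Finset.mem_range.2 (by omega)⟩
  have hup : Q.real (⋃ a ∈ T, E a) ≤ cutHit G r s := by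
    refine measureReal_mono fun w hw => ?_
    obtain ⟨a, ha, h3, h4⟩ := Set.mem_iUnion₂.1 hw
    have ha1 := (Finset.mem_product.1 ha).1
    rw [Set.mem_ofPred_eq, segA_one (by omega), Nat.sub_add_cancel (by omega)]
    exact ⟨w.1 a.1, Finset.mem_inter.2 ⟨Finset.mem_image_of_mem _ ha1,
      h3 ▸ Finset.mem_image_of_mem _ h4⟩⟩
  refine le_trans ?_ (hlow.trans hup)
  have ht : 0 ≤ κ / 4 / (4 * C) := by positivity
  have h5 := mul_le_mul_of_nonneg_left h1 (mul_nonneg zero_le_two ht)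
  have h6 := mul_le_mul_of_nonneg_left h2 (sq_nonneg (κ / 4 / (4 * C)))
  have h7 : 2 * (κ / 4 / (4 * C)) * (κ / 4 * (r ^ 2 * (Fintype.card V : ℝ)⁻¹))
      - (κ / 4 / (4 * C)) ^ 2 * (4 * C * (r ^ 2 * (Fintype.card V : ℝ)⁻¹))
      = (κ / 4) ^ 2 / (4 * C) * (r ^ 2 * (Fintype.card V : ℝ)⁻¹) := by
    field_simp
    ring
  linarith

theorem measurableSet_cutRange (s l : ℕ) (S : Finset V) :
    MeasurableSet {w : ℕ → V | cutRange s l w = S} :=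
  (upTo_cutRange (Nat.le_succ l) S).measurableSet

theorem measurableSet_pathRange (A : Finset ℕ) (p : Finset V → Prop) :
    MeasurableSet {w : ℕ → V | p (pathRange w A)} :=
  (upTo_pathRange (k := A.sup id) (fun _ hi => Finset.le_sup (f := id) hi) p).measurableSet

theorem cutHit_eq {r s : ℕ} (h : s ≤ r) : cutHit G r s = ∑ S : Finset V,
    (statWalk G).real {w | cutRange s (r - s) w = S}
      * (statWalk G).real {w | (pathRange w (Finset.Ico 0 (r - s)) ∩ S).Nonempty} := by
  set H : Finset V → Set (ℕ → V) :=
    fun S => {w | (pathRange w (Finset.Ico 0 (r - s)) ∩ S).Nonempty} with hH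
  set D : Finset V → Set (ℕ → V) := fun S => {w | cutRange s (r - s) w = S} with hD
  have hHm : ∀ S, MeasurableSet (H S) := fun S =>
    measurableSet_pathRange _ fun R => (R ∩ S).Nonempty
  have hDm : ∀ S, MeasurableSet (D S) := measurableSet_cutRange s (r - s)
  have hX : ∀ S, {w : ℕ → V | cutRange s (r - s) (shiftPath s w) = S} = shiftPath s ⁻¹' D S :=
    fun S => rfl
  have h1 := prod_real_fiber_snd (statWalk G) (statWalk G)
    (fun w : ℕ → V => cutRange s (r - s) (shiftPath s w))
    (fun S => by rw [hX]; exact measurable_shiftPath s (hDm S)) (fun S => shiftPath s ⁻¹' H S)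
  have e : {w : (ℕ → V) × (ℕ → V) | (pathRange w.1 (segA r s 1) ∩
      pathRange w.2 (locNonErased w.2 s (segA r s 1))).Nonempty}
      = {w : (ℕ → V) × (ℕ → V) |
        w.1 ∈ shiftPath s ⁻¹' H (cutRange s (r - s) (shiftPath s w.2))} := by
    ext w
    have h2 : pathRange w.1 (segA r s 1)
        = pathRange (shiftPath s w.1) (Finset.Ico 0 (r - s)) := by
      rw [segA_one h, ← pathRange_image_add, Finset.image_add_right_Ico, zero_add]
    have h3 : pathRange w.2 (locNonErased w.2 s (segA r s 1))
        = cutRange s (r - s) (shiftPath s w.2) := by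
      rw [segA_one h, pathRange_locNonErased_shift, cutRange]
    rw [Set.mem_ofPred_eq, Set.mem_ofPred_eq, h2, h3, Set.mem_preimage, hH, Set.mem_ofPred_eq]
  rw [cutHit, e, h1]
  refine Finset.sum_congr rfl fun S _ => ?_
  rw [hX, statWalk_shift G s (hHm S), statWalk_shift G s (hDm S)]

/-- Sets with more than `l` elements have weight zero, so comparisons of weighted sums need only
consider small sets. -/
theorem statWalk_cutRange_mul_le (s l : ℕ) (S : Finset V) {a b : ℝ} (hab : S.card ≤ l → a ≤ b) :
    (statWalk G).real {w | cutRange s l w = S} * a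
      ≤ (statWalk G).real {w | cutRange s l w = S} * b := by
  by_cases hS : S.card ≤ l
  · exact mul_le_mul_of_nonneg_left (hab hS) measureReal_nonneg
  · have : {w : ℕ → V | cutRange s l w = S} = ∅ := by
      refine Set.eq_empty_of_forall_notMem fun w hw => hS ?_
      rw [← show cutRange s l w = S from hw]
      exact card_cutRange_le s l w
    simp [this]

theorem sum_statWalk_cutRange (s l : ℕ) :
    ∑ S : Finset V, (statWalk G).real {w | cutRange s l w = S} = 1 := by
  have h := measureReal_eq_sum_fiber (statWalk G) (cutRange s l) (measurableSet_cutRange s l)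
    Set.univ
  simpa using h.symm

theorem cutHit_le {r s : ℕ} (h : s ≤ r) : cutHit G r s ≤ r ^ 2 * (Fintype.card V : ℝ)⁻¹ := by
  rw [cutHit_eq G h]
  calc _ ≤ ∑ S : Finset V, (statWalk G).real {w | cutRange s (r - s) w = S}
        * (r ^ 2 * (Fintype.card V : ℝ)⁻¹) := by
        refine Finset.sum_le_sum fun S _ => statWalk_cutRange_mul_le G _ _ _ fun hS => ?_
        refine (statWalk_hit_le G _ _).trans ?_
        refine mul_le_mul_of_nonneg_right ?_ (by positivity)
        rw [Nat.card_Ico, sq]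
        have h1 : ((r - s - 0 : ℕ) : ℝ) ≤ r := by exact_mod_cast (by omega : r - s - 0 ≤ r)
        have h2 : (S.card : ℝ) ≤ r := by exact_mod_cast (by omega : S.card ≤ r)
        exact mul_le_mul h1 h2 (by positivity) (by positivity)
    _ = _ := by rw [← Finset.sum_mul, sum_statWalk_cutRange, one_mul]

/-- Shortening the segment of the hitting walk by `s` at both ends changes little. -/
theorem abs_cutHit_sub_le {r s : ℕ} (h : 2 * s ≤ r) :
    |∑ S : Finset V, (statWalk G).real {w | cutRange s (r - s) w = S}
      * (statWalk G).real {w | (pathRange w (Finset.Ico s (r - s - s)) ∩ S).Nonempty}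
      - cutHit G r s| ≤ 2 * (s * r) * (Fintype.card V : ℝ)⁻¹ := by
  rw [cutHit_eq G (by omega), abs_sub_comm, ← Finset.sum_sub_distrib]
  have hmono : ∀ S : Finset V,
      (statWalk G).real {w | (pathRange w (Finset.Ico s (r - s - s)) ∩ S).Nonempty}
      ≤ (statWalk G).real {w | (pathRange w (Finset.Ico 0 (r - s)) ∩ S).Nonempty} := by
    intro S
    refine measureReal_mono fun w hw => ?_
    refine Finset.Nonempty.mono (Finset.inter_subset_inter_right (Finset.image_subset_image ?_)) hw
    exact Finset.Ico_subset_Ico (by omega) (by omega)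
  rw [abs_of_nonneg (Finset.sum_nonneg fun S _ => by
    rw [← mul_sub]
    exact mul_nonneg measureReal_nonneg (sub_nonneg.2 (hmono S)))]
  calc _ ≤ ∑ S : Finset V, (statWalk G).real {w | cutRange s (r - s) w = S}
        * (2 * (s * r) * (Fintype.card V : ℝ)⁻¹) := by
        refine Finset.sum_le_sum fun S _ => ?_
        rw [← mul_sub]
        refine statWalk_cutRange_mul_le G _ _ _ fun hS => ?_
        -- Only two blocks of `s` times are dropped, and hitting at most `r` vertices during them
        -- costs at most `2sr/n`.
        have h1 : (statWalk G).real {w | (pathRange w (Finset.Ico 0 (r - s)) ∩ S).Nonempty}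
            ≤ (statWalk G).real {w | (pathRange w (Finset.Ico s (r - s - s)) ∩ S).Nonempty}
            + (statWalk G).real {w | (pathRange w
              (Finset.Ico 0 s ∪ Finset.Ico (r - s - s) (r - s)) ∩ S).Nonempty} := by
          refine (measureReal_mono ?_ (measure_ne_top _ _)).trans (measureReal_union_le _ _)
          rintro w ⟨v, hv⟩
          obtain ⟨hv1, hv2⟩ := Finset.mem_inter.1 hv
          obtain ⟨i, hi, rfl⟩ := Finset.mem_image.1 hv1
          have hi := Finset.mem_Ico.1 hi
          by_cases hi2 : i ∈ Finset.Ico s (r - s - s)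
          · exact Or.inl ⟨w i, Finset.mem_inter.2 ⟨Finset.mem_image_of_mem _ hi2, hv2⟩⟩
          · refine Or.inr ⟨w i, Finset.mem_inter.2 ⟨Finset.mem_image_of_mem _ ?_, hv2⟩⟩
            simp only [Finset.mem_union, Finset.mem_Ico] at hi2 ⊢
            omega
        have h2 := statWalk_hit_le G (Finset.Ico 0 s ∪ Finset.Ico (r - s - s) (r - s)) S
        have h3 : ((Finset.Ico 0 s ∪ Finset.Ico (r - s - s) (r - s)).card : ℝ) ≤ 2 * s := by
          have := Finset.card_union_le (Finset.Ico 0 s) (Finset.Ico (r - s - s) (r - s))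
          rw [Nat.card_Ico, Nat.card_Ico] at this
          exact_mod_cast (by omega :
            (Finset.Ico 0 s ∪ Finset.Ico (r - s - s) (r - s)).card ≤ 2 * s)
        have h4 : (S.card : ℝ) ≤ r := by exact_mod_cast (by omega : S.card ≤ r)
        have h5 := mul_le_mul h3 h4 (by positivity) (by positivity)
        have h6 := mul_le_mul_of_nonneg_right h5
          (inv_nonneg.2 (Nat.cast_nonneg (α := ℝ) (Fintype.card V)))
        linarith
    _ = _ := by rw [← Finset.sum_mul, sum_statWalk_cutRange, one_mul]

theorem one_sub_cutHit (r s : ℕ) : ((statWalk G).prod (statWalk G)).real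
    {w | pathRange w.1 (segA r s 1) ∩ pathRange w.2 (locNonErased w.2 s (segA r s 1)) = ∅}
      = 1 - cutHit G r s := by
  have hm : MeasurableSet {w : (ℕ → V) × (ℕ → V) | (pathRange w.1 (segA r s 1) ∩
      pathRange w.2 (locNonErased w.2 s (segA r s 1))).Nonempty} := by
    have : {w : (ℕ → V) × (ℕ → V) | (pathRange w.1 (segA r s 1) ∩
        pathRange w.2 (locNonErased w.2 s (segA r s 1))).Nonempty}
        = ⋃ a ∈ segA r s 1, ⋃ b, ({w : (ℕ → V) × (ℕ → V) | w.1 a = w.2 b} ∩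
          Prod.snd ⁻¹' {w : ℕ → V | b ∈ locNonErased w s (segA r s 1)}) := by
      ext w
      simp only [Set.mem_ofPred_eq, Set.mem_iUnion, Set.mem_inter_iff, Set.mem_preimage,
        Finset.Nonempty, Finset.mem_inter, pathRange, Finset.mem_image, exists_prop]
      constructor
      · rintro ⟨v, ⟨a, ha, hav⟩, b, hb, hbv⟩
        exact ⟨a, ha, b, hav.trans hbv.symm, hb⟩
      · rintro ⟨a, ha, b, hab, hb⟩
        exact ⟨w.1 a, ⟨a, ha, rfl⟩, b, hb, hab.symm⟩
    rw [this]
    refine (segA r s 1).measurableSet_biUnion fun a _ => MeasurableSet.iUnion fun b => ?_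
    exact (measurableSet_meet a b).inter
      (measurable_snd (upTo_mem_locNonErased s _ _ b).measurableSet)
  rw [cutHit, ← probReal_compl_eq_one_sub hm]
  congr 1
  ext w
  simp [Finset.not_nonempty_iff_eq_empty]

end CutHit

/-! ### Poisson approximation for dissociated indicators -/

section Dissociated

/-- The expectation of `F` under the product of copies of the weights `σ`. -/
def piExp {ι U : Type*} [Fintype ι] [DecidableEq ι] [Fintype U] (σ : U → ℝ) (F : (ι → U) → ℝ) : ℝ :=
  ∑ x : ι → U, (∏ i, σ (x i)) * F x

variable {ι U : Type*} [Fintype ι] [DecidableEq ι] [Fintype U] {σ : U → ℝ}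

theorem piExp_mono (h0 : ∀ u, 0 ≤ σ u) {F F' : (ι → U) → ℝ} (h : ∀ x, F x ≤ F' x) :
    piExp σ F ≤ piExp σ F' :=
  Finset.sum_le_sum fun x _ => mul_le_mul_of_nonneg_left (h x) (Finset.prod_nonneg fun _ _ => h0 _)

theorem piExp_sub (F F' : (ι → U) → ℝ) :
    piExp σ (fun x => F x - F' x) = piExp σ F - piExp σ F' := by
  simp only [piExp, mul_sub, Finset.sum_sub_distrib]

theorem piExp_add (F F' : (ι → U) → ℝ) :
    piExp σ (fun x => F x + F' x) = piExp σ F + piExp σ F' := by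
  simp only [piExp, mul_add, Finset.sum_add_distrib]

theorem piExp_sum {κ : Type*} (T : Finset κ) (F : κ → (ι → U) → ℝ) :
    piExp σ (fun x => ∑ k ∈ T, F k x) = ∑ k ∈ T, piExp σ (F k) := by
  simp only [piExp, Finset.mul_sum]
  exact Finset.sum_comm

theorem piExp_const_mul (c : ℝ) (F : (ι → U) → ℝ) :
    piExp σ (fun x => c * F x) = c * piExp σ F := by
  simp only [piExp, Finset.mul_sum, mul_left_comm]

theorem piExp_const (h1 : ∑ u, σ u = 1) (c : ℝ) : piExp σ (fun _ : ι → U => c) = c := by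
  have h := Finset.prod_univ_sum (fun _ : ι => (Finset.univ : Finset U)) (fun _ u => σ u)
  simp only [h1, Finset.prod_const_one, Fintype.piFinset_univ] at h
  rw [piExp, ← Finset.sum_mul, ← h, one_mul]

theorem abs_piExp_le (h0 : ∀ u, 0 ≤ σ u) (F : (ι → U) → ℝ) :
    |piExp σ F| ≤ piExp σ fun x => |F x| := by
  refine (Finset.abs_sum_le_sum_abs _ _).trans (Finset.sum_le_sum fun x _ => ?_)
  rw [abs_mul, abs_of_nonneg (Finset.prod_nonneg fun i _ => h0 _)]

/-- Resampling one coordinate does not change expectations. -/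
theorem piExp_update (h1 : ∑ u, σ u = 1) (t : ι) (F : (ι → U) → ℝ) :
    piExp σ F = piExp σ fun x => ∑ v, σ v * F (Function.update x t v) := by
  -- Exchanging coordinate `t` with a fresh sample is an involution that preserves the product
  -- weights.
  have hinv : Function.Involutive
      (fun p : (ι → U) × U => (Function.update p.1 t p.2, p.1 t)) := by
    rintro ⟨x, v⟩
    simp
  have hw : ∀ (x : ι → U) (v : U),
      (∏ i, σ (Function.update x t v i)) * σ (x t) = (∏ i, σ (x i)) * σ v := by
    intro x v
    rw [← Finset.mul_prod_erase Finset.univ _ (Finset.mem_univ t),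
      ← Finset.mul_prod_erase Finset.univ (fun i => σ (x i)) (Finset.mem_univ t),
      Function.update_self]
    have : ∏ i ∈ Finset.univ.erase t, σ (Function.update x t v i)
        = ∏ i ∈ Finset.univ.erase t, σ (x i) :=
      Finset.prod_congr rfl fun i hi => by rw [Function.update_of_ne (Finset.ne_of_mem_erase hi)]
    rw [this]
    ring
  calc piExp σ F = ∑ p : (ι → U) × U, (∏ i, σ (p.1 i)) * σ p.2 * F p.1 := by
        rw [Fintype.sum_prod_type, piExp]
        refine Finset.sum_congr rfl fun x _ => ?_
        dsimp only
        rw [← Finset.sum_mul, ← Finset.mul_sum, h1, mul_one]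
    _ = ∑ p : (ι → U) × U, (∏ i, σ (p.1 i)) * σ p.2 * F (Function.update p.1 t p.2) := by
        rw [← Equiv.sum_comp hinv.toPerm]
        refine Finset.sum_congr rfl fun p _ => ?_
        change (∏ i, σ (Function.update p.1 t p.2 i)) * σ (p.1 t) * _ = _
        rw [hw]
        rfl
    _ = _ := by
        rw [Fintype.sum_prod_type, piExp]
        refine Finset.sum_congr rfl fun x _ => ?_
        rw [Finset.mul_sum]
        exact Finset.sum_congr rfl fun v _ => by ring

/-- The weights of the Bernoulli distribution. -/
def bern (q : ℝ) (b : Bool) : ℝ := if b then q else 1 - q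

theorem bern_nonneg {q : ℝ} (h0 : 0 ≤ q) (h1 : q ≤ 1) (b : Bool) : 0 ≤ bern q b := by
  cases b
  · simpa [bern] using h1
  · simpa [bern] using h0

theorem sum_bern (q : ℝ) : ∑ b, bern q b = 1 := by simp [bern]

/-- The ordered pairs of indices. -/
abbrev Pairs (M : ℕ) : Type := {p : Fin M × Fin M // p.1 < p.2}

/-- The array of indicators built from the family `x`. -/
def pairArray {M : ℕ} (f : U → U → Bool) (x : Fin M → U) : Pairs M → Bool :=
  fun a => f (x a.1.1) (x a.1.2)

/-- The pairs `a` and `b` have a common index. -/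
def Meets {M : ℕ} (a b : Pairs M) : Prop :=
  b.1.1 = a.1.1 ∨ b.1.1 = a.1.2 ∨ b.1.2 = a.1.1 ∨ b.1.2 = a.1.2

theorem card_meets_le {M : ℕ} (a : Pairs M) (T : Finset (Pairs M)) (hT : ∀ b ∈ T, Meets a b) :
    T.card ≤ 4 * M := by
  have h := Finset.card_le_card_of_injOn (s := T) (t :=
    (({a.1.1} ×ˢ Finset.univ) ∪ ({a.1.2} ×ˢ Finset.univ)) ∪
      ((Finset.univ ×ˢ {a.1.1}) ∪ (Finset.univ ×ˢ {a.1.2}))) (fun b => b.1)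
    (fun b hb => by
      have := hT b hb
      simp only [Finset.coe_union, Set.mem_union, Finset.mem_coe, Finset.mem_product,
        Finset.mem_singleton, Finset.mem_univ, and_true, true_and]
      unfold Meets at this
      tauto) Subtype.val_injective.injOn
  refine h.trans ((Finset.card_union_le _ _).trans ((add_le_add (Finset.card_union_le _ _)
    (Finset.card_union_le _ _)).trans ?_))
  simp only [Finset.card_product, Finset.card_singleton, Finset.card_univ, Fintype.card_fin]
  omega

/-- The real-valued indicator of a Boolean. -/
def boolInd (b : Bool) : ℝ := if b then 1 else 0

theorem boolInd_nonneg (b : Bool) : 0 ≤ boolInd b := by cases b <;> simp [boolInd]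

variable {M : ℕ} {f : U → U → Bool} {p : ℝ}

theorem piExp_pairArray_le (h0 : ∀ u, 0 ≤ σ u) (h1 : ∑ u, σ u = 1)
    (hf : ∀ u, ∑ v, σ v * boolInd (f u v) ≤ p) (b : Pairs M) :
    piExp σ (fun x => boolInd (pairArray f x b)) ≤ p := by
  rw [piExp_update h1 b.1.2, ← piExp_const (ι := Fin M) h1 p]
  refine piExp_mono h0 fun x => ?_
  simp only [pairArray, Function.update_self, Function.update_of_ne b.2.ne]
  exact hf _

/-- Two distinct ordered pairs share at most one index, so `a` has an index outside `b`. Resampling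
it leaves the indicator of `b` fixed and gains a factor `p`. -/
theorem piExp_pairArray_mul_le (h0 : ∀ u, 0 ≤ σ u) (h1 : ∑ u, σ u = 1)
    (hf : ∀ u, ∑ v, σ v * boolInd (f u v) ≤ p) (hf' : ∀ v, ∑ u, σ u * boolInd (f u v) ≤ p)
    (hp : 0 ≤ p) {a b : Pairs M} (hab : a ≠ b) :
    piExp σ (fun x => boolInd (pairArray f x a) * boolInd (pairArray f x b)) ≤ p * p := by
  suffices h : piExp σ (fun x => boolInd (pairArray f x a) * boolInd (pairArray f x b))
      ≤ piExp σ (fun x => p * boolInd (pairArray f x b)) by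
    rw [piExp_const_mul] at h
    exact h.trans (mul_le_mul_of_nonneg_left (piExp_pairArray_le h0 h1 hf b) hp)
  have hb : ∀ t : Fin M, t ≠ b.1.1 → t ≠ b.1.2 → ∀ (x : Fin M → U) (v : U),
      pairArray f (Function.update x t v) b = pairArray f x b := by
    intro t h2 h3 x v
    simp only [pairArray, Function.update_of_ne h2.symm, Function.update_of_ne h3.symm]
  by_cases hi : a.1.1 ≠ b.1.1 ∧ a.1.1 ≠ b.1.2
  · rw [piExp_update h1 a.1.1]
    refine piExp_mono h0 fun x => ?_
    simp only [hb a.1.1 hi.1 hi.2, ← mul_assoc]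
    rw [← Finset.sum_mul]
    refine mul_le_mul_of_nonneg_right ?_ (boolInd_nonneg _)
    simp only [pairArray, Function.update_self, Function.update_of_ne a.2.ne']
    exact hf' _
  · have hj : a.1.2 ≠ b.1.1 ∧ a.1.2 ≠ b.1.2 := by
      have ha := a.2
      have hb := b.2
      have hne : ¬ (a.1.1 = b.1.1 ∧ a.1.2 = b.1.2) := fun h =>
        hab (Subtype.ext (Prod.ext h.1 h.2))
      simp only [Fin.ext_iff, Fin.lt_def, ne_eq] at *
      omega
    rw [piExp_update h1 a.1.2]
    refine piExp_mono h0 fun x => ?_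
    simp only [hb a.1.2 hj.1 hj.2, ← mul_assoc]
    rw [← Finset.sum_mul]
    refine mul_le_mul_of_nonneg_right ?_ (boolInd_nonneg _)
    simp only [pairArray, Function.update_self, Function.update_of_ne a.2.ne]
    exact hf _

/-- Replacing one indicator by an independent Bernoulli variable. -/
theorem abs_piExp_replace_le (h0 : ∀ u, 0 ≤ σ u) (h1 : ∑ u, σ u = 1)
    (hf : ∀ u, ∑ v, σ v * boolInd (f u v) ≤ p) (hf' : ∀ v, ∑ u, σ u * boolInd (f u v) ≤ p)
    {q ε : ℝ} (hq0 : 0 ≤ q) (hqp : q ≤ p)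
    (hε : |∑ u, σ u * ∑ v, σ v * boolInd (f u v) - q| ≤ ε)
    (g : (Pairs M → Bool) → ℝ) (hg : ∀ z, |g z| ≤ 1) (a : Pairs M) :
    |piExp σ (fun x => g (pairArray f x)) - piExp σ (fun x =>
      ∑ b, bern q b * g (Function.update (pairArray f x) a b))| ≤ 2 * ε + 32 * M * p ^ 2 := by
  classical
  have hp : 0 ≤ p := hq0.trans hqp
  -- `D` is the effect on `g` of switching entry `a`; the replacement error is the mean of `(Z_a -
  -- q) D(Z)`, where `Z` is the array.
  set D : (Pairs M → Bool) → ℝ := fun z =>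
    g (Function.update z a true) - g (Function.update z a false) with hD
  have hD2 : ∀ z, |D z| ≤ 2 := fun z => 
    (abs_sub _ _).trans
      (by linarith [hg (Function.update z a true), hg (Function.update z a false)])
  -- `Y` blanks every entry sharing an index with `a`, including `a` itself. It does not depend on
  -- the two segments behind `a`, so the mean with `D(Y)` factors into the bias of `Z_a` times a
  -- quantity at most `2`.
  set Y : (Fin M → U) → Pairs M → Bool := fun x b =>
    if Meets a b then false else pairArray f x b with hY
  set N : Finset (Pairs M) := Finset.univ.filter fun b => Meets a b ∧ b ≠ a with hN
  have hdiff : ∀ x, g (pairArray f x)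
      - ∑ b, bern q b * g (Function.update (pairArray f x) a b)
      = (boolInd (pairArray f x a) - q) * D (pairArray f x) := by
    intro x
    rw [Fintype.sum_bool]
    simp only [bern, hD]
    rcases hx : pairArray f x a with _ | _
    · have : Function.update (pairArray f x) a false = pairArray f x := by
        rw [← hx, Function.update_eq_self]
      simp only [this, boolInd]
      simp
      ring
    · have : Function.update (pairArray f x) a true = pairArray f x := by
        rw [← hx, Function.update_eq_self]
      simp only [this, boolInd]
      simp
      ring
  have hmain : |piExp σ (fun x => (boolInd (pairArray f x a) - q) * D (Y x))| ≤ 2 * ε := by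
    have hYi : ∀ (x : Fin M → U) (u v : U),
        Y (Function.update (Function.update x a.1.2 v) a.1.1 u) = Y x := by
      intro x u v
      funext b
      simp only [hY]
      by_cases hb : Meets a b
      · simp [hb]
      · rw [if_neg hb, if_neg hb]
        simp only [Meets, not_or] at hb
        simp only [pairArray]
        rw [Function.update_of_ne hb.1, Function.update_of_ne hb.2.1,
          Function.update_of_ne hb.2.2.1, Function.update_of_ne hb.2.2.2]
    have hZ : ∀ (x : Fin M → U) (u v : U),
        pairArray f (Function.update (Function.update x a.1.2 v) a.1.1 u) a = f u v := by
      intro x u v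
      simp only [pairArray]
      rw [Function.update_self, Function.update_of_ne a.2.ne', Function.update_self]
    have hin : ∑ v, σ v * ∑ u, σ u * (boolInd (f u v) - q)
        = ∑ u, σ u * ∑ v, σ v * boolInd (f u v) - q := by
      simp only [mul_sub, Finset.sum_sub_distrib, ← Finset.sum_mul, h1, one_mul, Finset.mul_sum]
      rw [Finset.sum_comm]
      congr 1
      exact Finset.sum_congr rfl fun u _ => Finset.sum_congr rfl fun v _ => by ring
    rw [piExp_update h1 a.1.1, piExp_update h1 a.1.2]
    simp only [hYi, hZ, ← mul_assoc]
    simp only [mul_assoc]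
    simp only [← mul_assoc, ← Finset.sum_mul]
    have : ∀ x : Fin M → U, (∑ v, σ v * ∑ u, σ u * (boolInd (f u v) - q)) * D (Y x)
        = (∑ u, σ u * ∑ v, σ v * boolInd (f u v) - q) * D (Y x) := fun x => by rw [hin]
    simp only [this]
    rw [piExp_const_mul, abs_mul, mul_comm (2 : ℝ)]
    refine mul_le_mul hε ?_ (abs_nonneg _) ((abs_nonneg _).trans hε)
    refine (abs_piExp_le h0 _).trans ?_
    rw [← piExp_const (ι := Fin M) h1 2]
    exact piExp_mono h0 fun x => hD2 _
  -- `D(Z)` and `D(Y)` differ only if some other entry sharing an index with `a` is occupied. Then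
  -- they differ by at most `4`, and `|Z_a - q| ≤ Z_a + q`.
  have hrest : ∀ x, |(boolInd (pairArray f x a) - q) * (D (pairArray f x) - D (Y x))|
      ≤ ∑ b ∈ N, 4 * (boolInd (pairArray f x a) * boolInd (pairArray f x b)
        + q * boolInd (pairArray f x b)) := by
    intro x
    have hterm : ∀ b ∈ N, 0 ≤ 4 * (boolInd (pairArray f x a) * boolInd (pairArray f x b)
        + q * boolInd (pairArray f x b)) := fun b _ =>
      mul_nonneg (by norm_num) (add_nonneg (mul_nonneg (boolInd_nonneg _) (boolInd_nonneg _))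
        (mul_nonneg hq0 (boolInd_nonneg _)))
    by_cases hx : ∃ b ∈ N, pairArray f x b = true
    · obtain ⟨b, hbN, hb⟩ := hx
      refine le_trans ?_ (Finset.single_le_sum hterm hbN)
      rw [hb, abs_mul]
      simp only [boolInd, if_true, mul_one]
      have h3 : |(if pairArray f x a = true then (1 : ℝ) else 0) - q|
          ≤ (if pairArray f x a = true then (1 : ℝ) else 0) + q := by
        refine (abs_sub _ _).trans ?_
        rw [abs_of_nonneg hq0, abs_of_nonneg (by split_ifs <;> norm_num)]
      have h4 : |D (pairArray f x) - D (Y x)| ≤ 4 :=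
        (abs_sub _ _).trans (by linarith [hD2 (pairArray f x), hD2 (Y x)])
      rw [mul_comm (4 : ℝ)]
      exact mul_le_mul h3 h4 (abs_nonneg _) ((abs_nonneg _).trans h3)
    · have hDeq : D (pairArray f x) = D (Y x) := by
        have : ∀ c, Function.update (pairArray f x) a c = Function.update (Y x) a c := by
          intro c
          funext b
          by_cases hba : b = a
          · subst hba; simp
          · rw [Function.update_of_ne hba, Function.update_of_ne hba]
            simp only [hY]
            by_cases hm : Meets a b
            · rw [if_pos hm]
              by_contra hc
              exact hx ⟨b, Finset.mem_filter.2 ⟨Finset.mem_univ _, hm, hba⟩, by simpa using hc⟩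
            · rw [if_neg hm]
        simp only [hD, this]
      rw [hDeq, sub_self, mul_zero, abs_zero]
      exact Finset.sum_nonneg hterm
  have hrest2 : |piExp σ (fun x => (boolInd (pairArray f x a) - q) *
      (D (pairArray f x) - D (Y x)))| ≤ 32 * M * p ^ 2 := by
    refine (abs_piExp_le h0 _).trans ((piExp_mono h0 hrest).trans ?_)
    rw [piExp_sum]
    -- Each neighbour contributes at most `4 (p² + p²)`; with at most `4M` neighbours this gives the
    -- constant `32`.
    have h5 : ∀ b ∈ N, piExp σ (fun x => 4 * (boolInd (pairArray f x a) * boolInd (pairArray f x b)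
        + q * boolInd (pairArray f x b))) ≤ 8 * p ^ 2 := by
      intro b hb
      rw [piExp_const_mul, piExp_add, piExp_const_mul]
      have h6 := piExp_pairArray_mul_le h0 h1 hf hf' hp (Finset.mem_filter.1 hb).2.2.symm
      have h7 := piExp_pairArray_le h0 h1 hf b
      have h8 := mul_le_mul hqp h7
        (by
          rw [← piExp_const (ι := Fin M) h1 0]
          exact piExp_mono h0 fun x => boolInd_nonneg _) hp
      nlinarith
    refine (Finset.sum_le_sum h5).trans ?_
    rw [Finset.sum_const, nsmul_eq_mul]
    have h9 : (N.card : ℝ) ≤ 4 * M := by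
      exact_mod_cast card_meets_le a N fun b hb => (Finset.mem_filter.1 hb).2.1
    nlinarith [sq_nonneg p]
  rw [← piExp_sub]
  simp only [hdiff]
  have hsplit : ∀ x, (boolInd (pairArray f x a) - q) * D (pairArray f x)
      = (boolInd (pairArray f x a) - q) * D (Y x)
        + (boolInd (pairArray f x a) - q) * (D (pairArray f x) - D (Y x)) := fun x => by ring
  simp only [hsplit]
  rw [piExp_add]
  exact (abs_add_le _ _).trans (add_le_add hmain hrest2)

/-- The array of indicators is close in total variation to independent Bernoulli variables. -/
theorem abs_piExp_sub_bern_le (h0 : ∀ u, 0 ≤ σ u) (h1 : ∑ u, σ u = 1)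
    (hf : ∀ u, ∑ v, σ v * boolInd (f u v) ≤ p) (hf' : ∀ v, ∑ u, σ u * boolInd (f u v) ≤ p)
    {q ε : ℝ} (hq0 : 0 ≤ q) (hq1 : q ≤ 1) (hqp : q ≤ p)
    (hε : |∑ u, σ u * ∑ v, σ v * boolInd (f u v) - q| ≤ ε)
    (g : (Pairs M → Bool) → ℝ) (hg : ∀ z, |g z| ≤ 1) :
    |piExp σ (fun x => g (pairArray f x)) - piExp (bern q) g|
      ≤ M ^ 2 * (2 * ε + 32 * M * p ^ 2) := by
  classical
  have hε0 : 0 ≤ ε := (abs_nonneg _).trans hε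
  -- Induction on a set of entries that determines `g`: averaging over entry `a` removes it from
  -- this set and leaves the Bernoulli expectation unchanged. Once the set is empty, `g` is
  -- constant.
  have key : ∀ (J : Finset (Pairs M)) (g : (Pairs M → Bool) → ℝ), (∀ z, |g z| ≤ 1) →
      (∀ z z', (∀ a ∈ J, z a = z' a) → g z = g z') →
      |piExp σ (fun x => g (pairArray f x)) - piExp (bern q) g|
        ≤ J.card * (2 * ε + 32 * M * p ^ 2) := by
    intro J
    induction J using Finset.induction_on with
    | empty =>
      intro g _ hJ
      have hc : g = fun _ => g fun _ => false := funext fun z => hJ _ _ (by simp)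
      rw [hc, piExp_const h1, piExp_const (sum_bern q)]
      simp
    | insert a J ha ih =>
      intro g hg hJ
      have h2 := abs_piExp_replace_le h0 h1 hf hf' hq0 hqp hε g hg a
      have h3 := ih (fun z => ∑ b, bern q b * g (Function.update z a b)) ?_ ?_
      · rw [← piExp_update (sum_bern q) a g] at h3
        have h4 := (abs_sub_le _ _ _).trans (add_le_add h2 h3)
        refine h4.trans (le_of_eq ?_)
        rw [Finset.card_insert_of_notMem ha]
        push_cast
        ring
      · intro z
        refine (Finset.abs_sum_le_sum_abs _ _).trans ?_
        rw [← sum_bern q]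
        refine Finset.sum_le_sum fun b _ => ?_
        rw [abs_mul, abs_of_nonneg (bern_nonneg hq0 hq1 b)]
        exact mul_le_of_le_one_right (bern_nonneg hq0 hq1 b) (hg _)
      · intro z z' hz
        refine Finset.sum_congr rfl fun b _ => ?_
        congr 1
        refine hJ _ _ fun c hc => ?_
        by_cases hca : c = a
        · subst hca; simp
        · rw [Function.update_of_ne hca, Function.update_of_ne hca]
          exact hz c (Finset.mem_of_mem_insert_of_ne hc hca)
  refine (key Finset.univ g hg fun z z' h => by rw [funext fun a => h a (Finset.mem_univ a)]).trans ?_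
  refine mul_le_mul_of_nonneg_right ?_ (by positivity)
  have h2 : Fintype.card (Pairs M) ≤ M ^ 2 := by
    refine (Fintype.card_subtype_le _).trans ?_
    rw [Fintype.card_prod, Fintype.card_fin, sq]
  rw [Finset.card_univ]
  exact_mod_cast h2

end Dissociated

/-! ### Couplings from total variation bounds -/

/-- Two laws whose images on a finite set are close in total variation can be coupled so that the
images agree with high probability. -/
theorem exists_isCoupling_le {X Y F : Type*} [MeasurableSpace X] [MeasurableSpace Y] [Fintype F]
    [DecidableEq F] (μ : Measure X) (ν : Measure Y) [IsProbabilityMeasure μ]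
    [IsProbabilityMeasure ν] (φ : X → F) (ψ : Y → F) (hφ : ∀ z, MeasurableSet {x | φ x = z})
    (hψ : ∀ z, MeasurableSet {y | ψ y = z}) {δ : ℝ}
    (h : ∀ S : Finset F, ∑ z ∈ S, (ν.real {y | ψ y = z} - μ.real {x | φ x = z}) ≤ δ) :
    ∃ Q : Measure (X × Y), IsCoupling Q μ ν ∧ 1 - δ ≤ Q.real {w | φ w.1 = ψ w.2} := by
  set a : F → ℝ := fun z => μ.real {x | φ x = z} with ha
  set b : F → ℝ := fun z => ν.real {y | ψ y = z} with hb
  set m : F → ℝ := fun z => min (a z) (b z) with hm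
  have ha0 : ∀ z, 0 ≤ a z := fun z => measureReal_nonneg
  have hb0 : ∀ z, 0 ≤ b z := fun z => measureReal_nonneg
  have hm0 : ∀ z, 0 ≤ m z := fun z => le_min (ha0 z) (hb0 z)
  have hma : ∀ z, m z ≤ a z := fun z => min_le_left _ _
  have hmb : ∀ z, m z ≤ b z := fun z => min_le_right _ _
  have ha1 : ∑ z, a z = 1 := by
    have := measureReal_eq_sum_fiber μ φ hφ Set.univ
    simpa using this.symm
  have hb1 : ∑ z, b z = 1 := by
    have := measureReal_eq_sum_fiber ν ψ hψ Set.univ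
    simpa using this.symm
  set D : ℝ := 1 - ∑ z, m z with hD
  have hDa : ∑ z, (a z - m z) = D := by rw [Finset.sum_sub_distrib, ha1]
  have hDb : ∑ z, (b z - m z) = D := by rw [Finset.sum_sub_distrib, hb1]
  have hD0 : 0 ≤ D := hDa ▸ Finset.sum_nonneg fun z _ => sub_nonneg.2 (hma z)
  -- The maximal coupling on `F`: common mass on the diagonal, excesses coupled independently. If `D
  -- = 0` the excesses vanish, and the convention for division by zero gives the right value.
  set K : F → F → ℝ := fun z z' =>
    (if z = z' then m z else 0) + (a z - m z) * (b z' - m z') / D with hK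
  have hK0 : ∀ z z', 0 ≤ K z z' := fun z z' => add_nonneg
    (by split_ifs; exacts [hm0 z, le_rfl])
    (div_nonneg (mul_nonneg (sub_nonneg.2 (hma z)) (sub_nonneg.2 (hmb z'))) hD0)
  have hzero : ∀ c : F → ℝ, (∀ z, 0 ≤ c z) → ∑ z, c z = D → ∀ z, c z * D / D = c z := by
    intro c hc hcD z
    by_cases hD' : D = 0
    · rw [hD'] at hcD
      rw [(Finset.sum_eq_zero_iff_of_nonneg fun z _ => hc z).1 hcD z (Finset.mem_univ z)]
      simp
    · rw [mul_div_assoc, div_self hD', mul_one]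
  have hKa : ∀ z, ∑ z', K z z' = a z := by
    intro z
    simp only [hK, Finset.sum_add_distrib, Finset.sum_ite_eq, Finset.mem_univ, if_true]
    rw [← Finset.sum_div, ← Finset.mul_sum, hDb,
      hzero (fun z => a z - m z) (fun z => sub_nonneg.2 (hma z)) hDa z]
    ring
  have hKb : ∀ z', ∑ z, K z z' = b z' := by
    intro z'
    simp only [hK, Finset.sum_add_distrib, Finset.sum_ite_eq', Finset.mem_univ, if_true]
    rw [← Finset.sum_div, ← Finset.sum_mul, hDa, mul_comm,
      hzero (fun z => b z - m z) (fun z => sub_nonneg.2 (hmb z)) hDb z']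
    ring
  have hKle_a : ∀ z z', K z z' ≤ a z := fun z z' =>
    hKa z ▸ Finset.single_le_sum (fun z' _ => hK0 z z') (Finset.mem_univ z')
  have hKle_b : ∀ z z', K z z' ≤ b z' := fun z z' =>
    hKb z' ▸ Finset.single_le_sum (f := fun z => K z z') (fun z _ => hK0 z z') (Finset.mem_univ z)
  have hμz : ∀ z, μ {x | φ x = z} = ENNReal.ofReal (a z) := fun z => by
    rw [ha, ofReal_measureReal]
  have hνz : ∀ z, ν {y | ψ y = z} = ENNReal.ofReal (b z) := fun z => by
    rw [hb, ofReal_measureReal]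
  -- Conditioning on a null fibre does not give a probability measure, but such a fibre carries no
  -- `K`-mass.
  have hcond_a : ∀ z z', ENNReal.ofReal (K z z') * μ[Set.univ | {x | φ x = z}]
      = ENNReal.ofReal (K z z') := by
    intro z z'
    by_cases hz : a z = 0
    · rw [le_antisymm (hz ▸ hKle_a z z') (hK0 z z')]; simp
    · have : IsProbabilityMeasure μ[|{x | φ x = z}] := cond_isProbabilityMeasure (by
        rw [hμz]; exact (ENNReal.ofReal_pos.2 ((ha0 z).lt_of_ne' hz)).ne')
      rw [measure_univ, mul_one]
  have hcond_b : ∀ z z', ENNReal.ofReal (K z z') * ν[Set.univ | {y | ψ y = z'}]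
      = ENNReal.ofReal (K z z') := by
    intro z z'
    by_cases hz : b z' = 0
    · rw [le_antisymm (hz ▸ hKle_b z z') (hK0 z z')]; simp
    · have : IsProbabilityMeasure ν[|{y | ψ y = z'}] := cond_isProbabilityMeasure (by
        rw [hνz]; exact (ENNReal.ofReal_pos.2 ((hb0 z').lt_of_ne' hz)).ne')
      rw [measure_univ, mul_one]
  let _ : MeasurableSpace F := ⊤
  have : DiscreteMeasurableSpace F := ⟨fun _ => trivial⟩
  have hφm : Measurable φ := measurable_to_countable' hφ
  have hψm : Measurable ψ := measurable_to_countable' hψ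
  -- Given the pair of values, the two points are drawn independently from the conditional laws,
  -- which restores the marginals `μ` and `ν`.
  set Q : Measure (X × Y) := ∑ z, ∑ z', ENNReal.ofReal (K z z') •
    (μ[|{x | φ x = z}]).prod (ν[|{y | ψ y = z'}]) with hQ
  have hQapp : ∀ E, Q E = ∑ z, ∑ z', ENNReal.ofReal (K z z') *
      ((μ[|{x | φ x = z}]).prod (ν[|{y | ψ y = z'}])) E := by
    intro E
    simp only [hQ, Measure.coe_finsetSum, Finset.sum_apply, Measure.smul_apply, smul_eq_mul]
  have hfst : Q.map Prod.fst = μ := by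
    ext E hE
    rw [Measure.map_apply measurable_fst hE, ← Set.prod_univ, hQapp]
    have h1 := congrArg (fun m => m E) (sum_meas_smul_cond_fiber hφm μ)
    simp only [Measure.coe_finsetSum, Finset.sum_apply, Measure.smul_apply, smul_eq_mul] at h1
    refine Eq.trans (Finset.sum_congr rfl fun z _ => ?_) h1
    simp only [Measure.prod_prod]
    calc _ = ∑ z', ENNReal.ofReal (K z z') * μ[E | {x | φ x = z}] :=
          Finset.sum_congr rfl fun z' _ => by
            rw [mul_comm (μ[E | {x | φ x = z}]), ← mul_assoc, hcond_b]
      _ = ENNReal.ofReal (a z) * μ[E | {x | φ x = z}] := by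
          rw [← Finset.sum_mul, ← ENNReal.ofReal_sum_of_nonneg fun z' _ => hK0 z z', hKa]
      _ = _ := by rw [← hμz]; rfl
  have hsnd : Q.map Prod.snd = ν := by
    ext E hE
    rw [Measure.map_apply measurable_snd hE, ← Set.univ_prod, hQapp, Finset.sum_comm]
    have h1 := congrArg (fun m => m E) (sum_meas_smul_cond_fiber hψm ν)
    simp only [Measure.coe_finsetSum, Finset.sum_apply, Measure.smul_apply, smul_eq_mul] at h1
    refine Eq.trans (Finset.sum_congr rfl fun z' _ => ?_) h1
    simp only [Measure.prod_prod]
    calc _ = ∑ z, ENNReal.ofReal (K z z') * ν[E | {y | ψ y = z'}] :=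
          Finset.sum_congr rfl fun z _ => by rw [← mul_assoc, hcond_a]
      _ = ENNReal.ofReal (b z') * ν[E | {y | ψ y = z'}] := by
          rw [← Finset.sum_mul, ← ENNReal.ofReal_sum_of_nonneg fun z _ => hK0 z z', hKb]
      _ = _ := by rw [← hνz]; rfl
  have hQprob : IsProbabilityMeasure Q := by
    constructor
    have : Q Set.univ = Q.map Prod.fst Set.univ := by
      rw [Measure.map_apply measurable_fst MeasurableSet.univ, Set.preimage_univ]
    rw [this, hfst, measure_univ]
  refine ⟨Q, ⟨hfst, hsnd⟩, ?_⟩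
  have hdiag : ∀ z, ENNReal.ofReal (m z) ≤ ENNReal.ofReal (K z z) *
      ((μ[|{x | φ x = z}]).prod (ν[|{y | ψ y = z}])) {w | φ w.1 = ψ w.2} := by
    intro z
    by_cases hz : m z = 0
    · rw [hz]; simp
    · have hmz : 0 < m z := (hm0 z).lt_of_ne' hz
      have hp : 1 ≤ ((μ[|{x | φ x = z}]).prod (ν[|{y | ψ y = z}])) {w | φ w.1 = ψ w.2} := by
        have hsub : ({x | φ x = z} ×ˢ {y | ψ y = z} : Set (X × Y)) ⊆ {w | φ w.1 = ψ w.2} :=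
          fun w hw => Eq.trans hw.1 (Eq.symm hw.2)
        refine le_trans (le_of_eq ?_) (measure_mono hsub)
        rw [Measure.prod_prod, cond_apply_self, cond_apply_self, one_mul]
        · rw [hνz]; exact (ENNReal.ofReal_pos.2 (hmz.trans_le (hmb z))).ne'
        · exact measure_ne_top _ _
        · rw [hμz]; exact (ENNReal.ofReal_pos.2 (hmz.trans_le (hma z))).ne'
        · exact measure_ne_top _ _
      calc ENNReal.ofReal (m z) ≤ ENNReal.ofReal (K z z) * 1 := by
            rw [mul_one]
            refine ENNReal.ofReal_le_ofReal ?_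
            simp only [hK, if_true]
            exact le_add_of_nonneg_right (div_nonneg (mul_nonneg (sub_nonneg.2 (hma z))
              (sub_nonneg.2 (hmb z))) hD0)
        _ ≤ _ := by gcongr
  have hlow : ENNReal.ofReal (∑ z, m z) ≤ Q {w | φ w.1 = ψ w.2} := by
    rw [ENNReal.ofReal_sum_of_nonneg fun z _ => hm0 z, hQapp]
    refine Finset.sum_le_sum fun z _ => (hdiag z).trans ?_
    exact Finset.single_le_sum (f := fun z' => ENNReal.ofReal (K z z') *
      ((μ[|{x | φ x = z}]).prod (ν[|{y | ψ y = z'}])) {w | φ w.1 = ψ w.2})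
      (fun _ _ => zero_le) (Finset.mem_univ z)
  have hlow' : ∑ z, m z ≤ Q.real {w | φ w.1 = ψ w.2} :=
    (ENNReal.ofReal_le_iff_le_toReal (measure_ne_top _ _)).1 hlow
  refine le_trans ?_ hlow'
  -- On the set where `b` exceeds `a` the one-sided hypothesis bounds the whole uncoupled mass `D`.
  have h2 := h (Finset.univ.filter fun z => a z < b z)
  have h3 : ∑ z, (b z - m z) = ∑ z ∈ Finset.univ.filter (fun z => a z < b z), (b z - a z) := by
    rw [Finset.sum_filter]
    refine Finset.sum_congr rfl fun z _ => ?_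
    split_ifs with hz
    · simp only [hm, min_eq_left hz.le]
    · simp only [hm, min_eq_right (not_lt.1 hz), sub_self]
  rw [← h3, hDb] at h2
  linarith

/-! ### The Poisson process in the squares -/

theorem measurableSet_square (c : ℝ) (i j : ℕ) : MeasurableSet (square c i j) := by
  have : square c i j = Set.Ico (((j : ℝ) - 1) * c) (j * c) ×ˢ
      Set.Ico (((i : ℝ) - 1) * c) (i * c) := by
    ext p
    simp only [square, Set.mem_ofPred_eq, Set.mem_prod, Set.mem_Ico, and_assoc]
  rw [this]
  exact measurableSet_Ico.prod measurableSet_Ico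

/-- As `i + 1 ≤ j`, the square lies below the diagonal. Only its bottom edge can leave the octant,
on the axis when `i = 0`; hence the open interval in the lower bound. -/
theorem volume_square {c : ℝ} (hc : 0 < c) {i j : ℕ} (hij : i < j) :
    (volume.restrict octant) (square c (i + 1) (j + 1)) = ENNReal.ofReal (c ^ 2) := by
  rw [Measure.restrict_apply (measurableSet_square c _ _)]
  have hi : (0 : ℝ) ≤ i := Nat.cast_nonneg i
  have hj : (i : ℝ) + 1 ≤ j := by exact_mod_cast hij
  have hicj : ((i : ℝ) + 1) * c ≤ j * c := mul_le_mul_of_nonneg_right hj hc.le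
  have hic : 0 ≤ (i : ℝ) * c := mul_nonneg hi hc.le
  have hv : ∀ I : Set ℝ, volume I = ENNReal.ofReal c →
      volume (Set.Ico ((j : ℝ) * c) ((j + 1) * c) ×ˢ I) = ENNReal.ofReal (c ^ 2) := by
    intro I hI
    rw [Measure.volume_eq_prod, Measure.prod_prod, hI, Real.volume_Ico,
      ← ENNReal.ofReal_mul (by nlinarith)]
    congr 1
    ring
  refine le_antisymm ?_ ?_
  · rw [← hv (Set.Ico ((i : ℝ) * c) ((i + 1) * c)) (by rw [Real.volume_Ico]; congr 1; ring)]
    refine measure_mono ?_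
    rintro p ⟨⟨h1, h2, h3, h4⟩, _⟩
    push_cast at h1 h2 h3 h4
    rw [add_sub_cancel_right] at h1 h3
    exact ⟨⟨h1, h2⟩, ⟨h3, h4⟩⟩
  · rw [← hv (Set.Ioo ((i : ℝ) * c) ((i + 1) * c)) (by rw [Real.volume_Ioo]; congr 1; ring)]
    refine measure_mono ?_
    rintro p ⟨⟨h1, h2⟩, ⟨h3, h4⟩⟩
    refine ⟨⟨?_, ?_, ?_, ?_⟩, ⟨?_, ?_, ?_⟩⟩
    · push_cast; rwa [add_sub_cancel_right]
    · push_cast; exact h2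
    · push_cast; rw [add_sub_cancel_right]; exact h3.le
    · push_cast; exact h4
    · linarith
    · linarith
    · linarith

open Classical in
/-- The array of indicators that the points of the process meet the squares. -/
def squareArray (M : ℕ) (c : ℝ) (p : Set (ℝ × ℝ)) : Pairs M → Bool :=
  fun a => decide (p ∩ square c (a.1.1 + 1) (a.1.2 + 1)).Nonempty

section Poisson

variable {Ω : Type*} [MeasurableSpace Ω] {P : Measure Ω}
  {Pi : Ω → Set (ℝ × ℝ)}

theorem squareArray_eq_iff (M : ℕ) (c : ℝ) (p : Set (ℝ × ℝ)) (z : Pairs M → Bool) :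
    squareArray M c p = z ↔ ∀ a, (p ∩ square c (a.1.1 + 1) (a.1.2 + 1)).encard
      ∈ (if z a then {0}ᶜ else {0} : Set ℕ∞) := by
  rw [funext_iff]
  refine forall_congr' fun a => ?_
  rw [squareArray]
  cases z a
  · simp [Set.not_nonempty_iff_eq_empty]
  · simp [Set.nonempty_iff_ne_empty]

theorem squares_disjoint {c : ℝ} (hc : 0 < c) {i j i' j' : ℕ} (h : (i, j) ≠ (i', j')) :
    Disjoint (square c (i + 1) (j + 1)) (square c (i' + 1) (j' + 1)) := by
  rw [Set.disjoint_left]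
  rintro p ⟨h1, h2, h3, h4⟩ ⟨h5, h6, h7, h8⟩
  push_cast at h1 h2 h3 h4 h5 h6 h7 h8
  rw [add_sub_cancel_right] at h1 h3 h5 h7
  have key : ∀ k l : ℕ, (k : ℝ) * c < (l + 1) * c → k ≤ l := by
    intro k l hkl
    have := lt_of_mul_lt_mul_right hkl hc.le
    exact Nat.lt_succ_iff.1 (by exact_mod_cast this)
  refine h (Prod.ext ?_ ?_)
  · exact le_antisymm (key _ _ (h3.trans_lt h8)) (key _ _ (h7.trans_lt h4))
  · exact le_antisymm (key _ _ (h1.trans_lt h6)) (key _ _ (h5.trans_lt h2))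

theorem measurableSet_squareArray (hPi : IsPoissonProcess Pi (volume.restrict octant) P) (M : ℕ)
    (c : ℝ) (z : Pairs M → Bool) : MeasurableSet {ω | squareArray M c (Pi ω) = z} := by
  simp only [squareArray_eq_iff]
  rw [Set.ofPred_forall]
  refine MeasurableSet.iInter fun a => hPi.measurable_count _ (measurableSet_square c _ _) ?_
  split_ifs
  · exact (measurableSet_singleton _).compl
  · exact measurableSet_singleton _

/-- Counts in disjoint squares are independent, and each is zero with probability `exp(-c²)`. -/
theorem real_squareArray [IsProbabilityMeasure P]
    (hPi : IsPoissonProcess Pi (volume.restrict octant) P) (M : ℕ)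
    {c : ℝ} (hc : 0 < c) (z : Pairs M → Bool) :
    P.real {ω | squareArray M c (Pi ω) = z} = ∏ a, bern (1 - Real.exp (-c ^ 2)) (z a) := by
  set B : Pairs M → Set (ℝ × ℝ) := fun a => square c (a.1.1 + 1) (a.1.2 + 1) with hB
  set e := Fintype.equivFin (Pairs M)
  have hind : iIndepFun (fun a ω => (Pi ω ∩ B a).encard) P := by
    have h := hPi.indep_count (Fintype.card (Pairs M)) (fun k => B (e.symm k))
      (fun k => measurableSet_square c _ _) (fun k l hkl => squares_disjoint hc (by
        intro h
        refine hkl (e.symm.injective (Subtype.ext (Prod.ext (Fin.ext ?_) (Fin.ext ?_))))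
        · exact (Prod.ext_iff.1 h).1
        · exact (Prod.ext_iff.1 h).2))
    have h2 := h.precomp e.injective
    simpa using h2
  have hmeas : ∀ b : Bool, MeasurableSet (if b then {0}ᶜ else {0} : Set ℕ∞) := by
    intro b
    split_ifs
    · exact (measurableSet_singleton _).compl
    · exact measurableSet_singleton _
  have hm := hind.measure_inter_preimage_eq_mul Finset.univ
    (sets := fun a => (if z a then {0}ᶜ else {0} : Set ℕ∞)) (fun a _ => hmeas (z a))
  have hset : {ω | squareArray M c (Pi ω) = z} = ⋂ a ∈ (Finset.univ : Finset (Pairs M)),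
      (fun ω => (Pi ω ∩ B a).encard) ⁻¹' (if z a then {0}ᶜ else {0} : Set ℕ∞) := by
    ext ω
    simp only [Set.mem_ofPred_eq, squareArray_eq_iff, Set.mem_iInter, Finset.mem_univ,
      forall_true_left, Set.mem_preimage]
    exact Iff.rfl
  rw [measureReal_def, hset, hm, ENNReal.toReal_prod]
  refine Finset.prod_congr rfl fun a _ => ?_
  have hcount : Measurable fun ω => (Pi ω ∩ B a).encard :=
    hPi.measurable_count _ (measurableSet_square c _ _)
  have hvol : (volume.restrict octant) (B a) = ENNReal.ofReal (c ^ 2) := volume_square hc a.2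
  have h0 : P.real ((fun ω => (Pi ω ∩ B a).encard) ⁻¹' {0}) = Real.exp (-c ^ 2) := by
    have h1 := hPi.map_count (B a) (measurableSet_square c _ _)
      (by rw [hvol]; exact ENNReal.ofReal_ne_top)
    rw [measureReal_def, ← Measure.map_apply hcount (measurableSet_singleton _), h1,
      Measure.map_apply Measurable.of_discrete (measurableSet_singleton _)]
    have h2 : (Nat.cast : ℕ → ℕ∞) ⁻¹' {0} = {0} := by
      ext n; simp
    rw [h2, ← measureReal_def, poissonMeasure_real_singleton, hvol]
    have h3 : ((ENNReal.ofReal (c ^ 2)).toNNReal : ℝ) = c ^ 2 :=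
      ENNReal.toReal_ofReal (sq_nonneg c)
    simp [h3]
  cases z a
  · simpa [bern, measureReal_def] using h0
  · have h3 := probReal_compl_eq_one_sub (μ := P) (hcount (measurableSet_singleton (0 : ℕ∞)))
    rw [h0] at h3
    simpa [bern, measureReal_def] using h3

end Poisson

/-! ### The coupling for a single graph -/

theorem measurableSet_comp_fiber {Ω U W : Type*} [MeasurableSpace Ω] [Finite U] (X : Ω → U)
    (hX : ∀ u, MeasurableSet {ω | X ω = u}) (π : U → W) (z : W) :
    MeasurableSet {ω | π (X ω) = z} := by
  have : {ω | π (X ω) = z} = ⋃ u ∈ {u | π u = z}, {ω | X ω = u} := by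
    ext ω; simp
  rw [this]
  exact MeasurableSet.biUnion (Set.to_countable _) fun u _ => hX u

theorem sum_fiber_comp {Ω U W : Type*} [MeasurableSpace Ω] [Fintype U] [Fintype W]
    (μ : Measure Ω) [IsFiniteMeasure μ] (X : Ω → U) (hX : ∀ u, MeasurableSet {ω | X ω = u})
    (π : U → W) (g : W → ℝ) :
    ∑ z, μ.real {ω | π (X ω) = z} * g z = ∑ u, μ.real {ω | X ω = u} * g (π u) := by
  classical
  have h : ∀ z, μ.real {ω | π (X ω) = z}
      = ∑ u, if π u = z then μ.real {ω | X ω = u} else 0 := by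
    intro z
    rw [measureReal_eq_sum_fiber μ X hX]
    refine Finset.sum_congr rfl fun u _ => ?_
    split_ifs with hu
    · congr 1
      ext ω
      simp only [Set.mem_inter_iff, Set.mem_ofPred_eq, and_iff_right_iff_imp]
      rintro rfl
      exact hu
    · have : {ω | π (X ω) = z} ∩ {ω | X ω = u} = ∅ := by
        ext ω
        simp only [Set.mem_inter_iff, Set.mem_ofPred_eq, Set.mem_empty_iff_false, iff_false,
          not_and]
        rintro h1 rfl
        exact hu h1
      rw [this, measureReal_empty]
  simp only [h, Finset.sum_mul, ite_mul, zero_mul]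
  rw [Finset.sum_comm]
  simp

theorem sum_fiber_boolInd {Ω U : Type*} [MeasurableSpace Ω] [Fintype U]
    (μ : Measure Ω) [IsFiniteMeasure μ] (X : Ω → U) (hX : ∀ u, MeasurableSet {ω | X ω = u})
    (h : U → Bool) :
    ∑ u, μ.real {ω | X ω = u} * boolInd (h u) = μ.real {ω | h (X ω) = true} := by
  rw [← sum_fiber_comp μ X hX h boolInd, Fintype.sum_bool]
  simp [boolInd]

section Segment

variable {V : Type*} [Fintype V] [DecidableEq V]

/-- The possible values of the part of a segment which matters for the hitting indicators. -/
abbrev SegVal (V : Type*) (r : ℕ) : Type _ :=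
  {S : Finset V // S.card ≤ r} × {S : Finset V // S.card ≤ r}

/-- The locally non-erased range and the shortened range of a segment. -/
def segVal (r s : ℕ) (w : ℕ → V) : SegVal V r :=
  (⟨cutRange s (r - s) w, (card_cutRange_le s (r - s) w).trans (Nat.sub_le r s)⟩,
   ⟨pathRange w (Finset.Ico s (r - s - s)), (card_pathRange_le _ _).trans (by
      rw [Nat.card_Ico]; omega)⟩)

/-- The second segment hits the locally non-erased range of the first one. -/
def segHit {r : ℕ} (u v : SegVal V r) : Bool := decide (u.1.1 ∩ v.2.1).Nonempty

theorem squareArray_eq_true (M : ℕ) (c : ℝ) (p : Set (ℝ × ℝ)) (a : Pairs M) :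
    squareArray M c p a = true ↔ (p ∩ square c (a.1.1 + 1) (a.1.2 + 1)).Nonempty := by
  simp only [squareArray, decide_eq_true_eq]

theorem segHit_eq_true {r : ℕ} (u v : SegVal V r) :
    segHit u v = true ↔ (u.1.1 ∩ v.2.1).Nonempty := decide_eq_true_iff

theorem upTo_segVal (r s : ℕ) (u : SegVal V r) : UpTo (r - s) {w : ℕ → V | segVal r s w = u} := by
  have h : {w : ℕ → V | segVal r s w = u} = {w | cutRange s (r - s) w = u.1.1}
      ∩ {w | pathRange w (Finset.Ico s (r - s - s)) = u.2.1} := by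
    ext w
    simp [segVal, Prod.ext_iff, Subtype.ext_iff]
  rw [h]
  refine (upTo_cutRange (Nat.le_succ _) _).inter (upTo_pathRange (fun i hi => ?_) (· = u.2.1))
  have := Finset.mem_Ico.1 hi
  omega

/-- The values of the first `M` segments. -/
def segVals (r s M : ℕ) (w : ℕ → V) : Fin M → SegVal V r :=
  fun i => segVal r s (shiftPath (i * r + s) w)

theorem pathZ_eq_cloudZ {r s M : ℕ} (hr : 2 * s ≤ r) {c : ℝ} {w : ℕ → V} {p : Set (ℝ × ℝ)}
    (h : pairArray segHit (segVals r s M w) = squareArray M c p) {i j : ℕ} (hi : 1 ≤ i)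
    (hij : i < j) (hj : j ≤ M) : pathZ r s w i j = cloudZ c p i j := by
  obtain ⟨i, rfl⟩ := Nat.exists_eq_add_of_le' hi
  obtain ⟨j, rfl⟩ := Nat.exists_eq_add_of_le' (hi.trans hij.le)
  have h1 := Bool.eq_iff_iff.1
    (congrFun h ⟨(⟨i, by omega⟩, ⟨j, by omega⟩), by simpa [Fin.lt_def] using hij⟩)
  rw [pairArray, segHit_eq_true, squareArray_eq_true] at h1
  rw [pathZ_eq r s w i j hr, cloudZ]
  classical exact if_congr h1 rfl rfl

variable [MeasurableSpace V] [MeasurableSingletonClass V]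
  (G : SimpleGraph V) [DecidableRel G.Adj] [Nonempty V] [hG : SymmWalk G]

theorem measurableSet_segVal (r s : ℕ) (u : SegVal V r) :
    MeasurableSet {w : ℕ → V | segVal r s w = u} := (upTo_segVal r s u).measurableSet

theorem measurableSet_segVals (r s M : ℕ) (x : Fin M → SegVal V r) :
    MeasurableSet {w : ℕ → V | segVals r s M w = x} := by
  have : {w : ℕ → V | segVals r s M w = x}
      = ⋂ i : Fin M, shiftPath (i * r + s) ⁻¹' {w | segVal r s w = x i} := by
    ext w
    simp [funext_iff, segVals]
  rw [this]
  exact MeasurableSet.iInter fun i => measurable_shiftPath _ (measurableSet_segVal r s (x i))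

theorem le_walkFrom_segVals {r s : ℕ} {δ : ℝ} (hδ : 0 ≤ δ) (hsr : s ≤ r)
    (hs : ∀ x y, δ * (Fintype.card V : ℝ)⁻¹ ≤ transProb G s x y) (ρ : V) (M : ℕ)
    (x : Fin M → SegVal V r) :
    δ ^ M * ∏ i, (statWalk G).real {w | segVal r s w = x i}
      ≤ (walkFrom G ρ).real {w | segVals r s M w = x} := by
  have h := le_walkFrom_blocks G hδ hs (r := r) (m := r - s) (by omega) (segVal r s) (upTo_segVal r s) ρ
    (fun k => if h : k < M then x ⟨k, h⟩ else segVal r s fun _ => ρ) M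
  rw [Finset.prod_range] at h
  simp only [Fin.is_lt, dif_pos, Fin.eta] at h
  refine h.trans (le_of_eq ?_)
  congr 1
  ext w
  simp only [Set.mem_ofPred_eq, funext_iff, segVals]
  constructor
  · intro h1 i
    have := h1 i i.2
    rwa [dif_pos i.2] at this
  · intro h1 k hk
    rw [dif_pos hk]
    exact h1 ⟨k, hk⟩

/-- The bound holds for every frozen value `u` because `SegVal` caps cardinalities at `r`; the
replacement argument needs this uniformity. -/
theorem sum_segHit_right_le {r s : ℕ} (u : SegVal V r) :
    ∑ v, (statWalk G).real {w | segVal r s w = v} * boolInd (segHit u v)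
      ≤ r ^ 2 * (Fintype.card V : ℝ)⁻¹ := by
  rw [sum_fiber_boolInd (statWalk G) (segVal r s) (measurableSet_segVal r s) (segHit u)]
  have h : {w : ℕ → V | segHit u (segVal r s w) = true}
      = {w | (pathRange w (Finset.Ico s (r - s - s)) ∩ u.1.1).Nonempty} := by
    ext w
    rw [Set.mem_ofPred_eq, segHit_eq_true, Finset.inter_comm]
    rfl
  rw [h]
  refine (statWalk_hit_le G _ _).trans (mul_le_mul_of_nonneg_right ?_ (by positivity))
  rw [Nat.card_Ico, sq]
  have h1 : ((r - s - s - s : ℕ) : ℝ) ≤ r := by exact_mod_cast (by omega : r - s - s - s ≤ r)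
  have h2 : (u.1.1.card : ℝ) ≤ r := by exact_mod_cast u.1.2
  exact mul_le_mul h1 h2 (by positivity) (by positivity)

/-- With the hitting range frozen, the locally non-erased range is enlarged to the full range of its
segment. -/
theorem sum_segHit_left_le {r s : ℕ} (v : SegVal V r) :
    ∑ u, (statWalk G).real {w | segVal r s w = u} * boolInd (segHit u v)
      ≤ r ^ 2 * (Fintype.card V : ℝ)⁻¹ := by
  rw [sum_fiber_boolInd (statWalk G) (segVal r s) (measurableSet_segVal r s) (fun u => segHit u v)]
  have h : {w : ℕ → V | segHit (segVal r s w) v = true}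
      ⊆ {w | (pathRange w (Finset.Ico 0 (r - s)) ∩ v.2.1).Nonempty} := by
    intro w hw
    exact ((segHit_eq_true _ _).1 hw).mono (Finset.inter_subset_inter_right
      (Finset.image_subset_image (locNonErased_subset _ _ _)))
  refine (measureReal_mono h).trans ((statWalk_hit_le G _ _).trans
    (mul_le_mul_of_nonneg_right ?_ (by positivity)))
  rw [Nat.card_Ico, sq]
  have h1 : ((r - s - 0 : ℕ) : ℝ) ≤ r := by exact_mod_cast (by omega : r - s - 0 ≤ r)
  have h2 : (v.2.1.card : ℝ) ≤ r := by exact_mod_cast v.2.2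
  exact mul_le_mul h1 h2 (by positivity) (by positivity)

theorem abs_sum_segHit_sub_le {r s : ℕ} (h : 2 * s ≤ r) :
    |∑ u, (statWalk G).real {w | segVal r s w = u} *
      ∑ v, (statWalk G).real {w | segVal r s w = v} * boolInd (segHit u v) - cutHit G r s|
      ≤ 2 * (s * r) * (Fintype.card V : ℝ)⁻¹ := by
  refine le_trans (le_of_eq ?_) (abs_cutHit_sub_le G h)
  congr 2
  have h1 := sum_fiber_comp (statWalk G) (segVal r s) (measurableSet_segVal r s)
    (fun u : SegVal V r => u.1.1) (fun S =>
      (statWalk G).real {w | (pathRange w (Finset.Ico s (r - s - s)) ∩ S).Nonempty})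
  refine Eq.trans (Finset.sum_congr rfl fun u _ => ?_) h1.symm
  rw [sum_fiber_boolInd (statWalk G) (segVal r s) (measurableSet_segVal r s) (segHit u)]
  congr 2
  ext w
  rw [Set.mem_ofPred_eq, segHit_eq_true, Finset.inter_comm]
  rfl

theorem exp_neg_cutScale_sq {r s : ℕ} (h : cutHit G r s < 1) :
    Real.exp (-cutScale G r s ^ 2) = 1 - cutHit G r s := by
  have h0 : 0 ≤ cutHit G r s := measureReal_nonneg
  have h1 : 0 ≤ -Real.log (1 - cutHit G r s) := by
    have := Real.log_nonpos (by linarith : 0 ≤ 1 - cutHit G r s) (by linarith)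
    linarith
  rw [cutScale, one_sub_cutHit, Real.sq_sqrt h1, neg_neg, Real.exp_log (by linarith)]

theorem exists_isCoupling_walk_poisson {r s : ℕ} {η : ℝ} (hη0 : 0 ≤ η) (hη1 : η ≤ 1)
    (hsr : 2 * s ≤ r)
    (hs : ∀ x y, (1 - η) * (Fintype.card V : ℝ)⁻¹ ≤ transProb G s x y)
    (hcut : cutHit G r s < 1) (hc : 0 < cutScale G r s) (ρ : V)
    {Ω : Type*} [MeasurableSpace Ω] (P : Measure Ω) [IsProbabilityMeasure P]
    (Pi : Ω → Set (ℝ × ℝ)) (hPi : IsPoissonProcess Pi (volume.restrict octant) P) (M : ℕ) :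
    ∃ Q : Measure ((ℕ → V) × Ω), IsCoupling Q (walkFrom G ρ) P ∧
      1 - (M * η + M ^ 2 * (2 * (2 * (s * r) * (Fintype.card V : ℝ)⁻¹)
          + 32 * M * (r ^ 2 * (Fintype.card V : ℝ)⁻¹) ^ 2))
        ≤ Q.real {w | ∀ i j : ℕ, 1 ≤ i → i < j → j ≤ M →
          pathZ r s w.1 i j = cloudZ (cutScale G r s) (Pi w.2) i j} := by
  set c := cutScale G r s with hcdef
  set q := cutHit G r s with hq
  have hexp : 1 - Real.exp (-c ^ 2) = q := by rw [exp_neg_cutScale_sq G hcut]; ring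
  have hq0 : 0 ≤ q := measureReal_nonneg
  set σ : SegVal V r → ℝ := fun u => (statWalk G).real {w | segVal r s w = u} with hσ
  have h0 : ∀ u, 0 ≤ σ u := fun u => measureReal_nonneg
  have h1 : ∑ u, σ u = 1 := by
    have := measureReal_eq_sum_fiber (statWalk G) (segVal r s) (measurableSet_segVal r s) Set.univ
    simpa using this.symm
  set ε := M ^ 2 * (2 * (2 * (s * r) * (Fintype.card V : ℝ)⁻¹)
          + 32 * M * (r ^ 2 * (Fintype.card V : ℝ)⁻¹) ^ 2) with hε
  have hM : 1 - M * η ≤ (1 - η) ^ M := by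
    have := one_add_mul_le_pow (a := -η) (by linarith) M
    simpa [← sub_eq_add_neg] using this
  obtain ⟨Q, hQ, hQle⟩ := exists_isCoupling_le (walkFrom G ρ) P
    (fun w => pairArray segHit (segVals r s M w)) (fun ω => squareArray M c (Pi ω))
    (measurableSet_comp_fiber (segVals r s M) (measurableSet_segVals r s M) (pairArray segHit))
    (measurableSet_squareArray hPi M c) (δ := M * η + ε) (by
      intro S
      set g : (Pairs M → Bool) → ℝ := fun z => if z ∈ S then 1 else 0 with hg
      have hg0 : ∀ z, 0 ≤ g z := fun z => by simp only [hg]; split_ifs <;> norm_num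
      have hg1 : ∀ z, g z ≤ 1 := fun z => by simp only [hg]; split_ifs <;> norm_num
      have hB : ∑ z ∈ S, P.real {ω | squareArray M c (Pi ω) = z} = piExp (bern q) g := by
        simp only [real_squareArray hPi M hc, hexp, piExp, hg, mul_ite, mul_one, mul_zero]
        rw [← Finset.sum_filter]
        simp
      have hA : (1 - η) ^ M * piExp σ (fun x => g (pairArray segHit x))
          ≤ ∑ z ∈ S, (walkFrom G ρ).real {w | pairArray segHit (segVals r s M w) = z} := by
        have h2 := sum_fiber_comp (walkFrom G ρ) (segVals r s M) (measurableSet_segVals r s M)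
          (pairArray segHit) g
        have h3 : ∑ z, (walkFrom G ρ).real {w | pairArray segHit (segVals r s M w) = z} * g z
            = ∑ z ∈ S, (walkFrom G ρ).real {w | pairArray segHit (segVals r s M w) = z} := by
          simp only [hg, mul_ite, mul_one, mul_zero]
          rw [← Finset.sum_filter]
          simp
        rw [← h3, h2, piExp, Finset.mul_sum]
        refine Finset.sum_le_sum fun x _ => ?_
        rw [← mul_assoc]
        exact mul_le_mul_of_nonneg_right
          (le_walkFrom_segVals G (by linarith) (by omega) hs ρ M x) (hg0 _)
      have hAB := abs_piExp_sub_bern_le (M := M) h0 h1 (sum_segHit_right_le G)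
        (sum_segHit_left_le G) hq0 hcut.le (cutHit_le G (by omega)) (abs_sum_segHit_sub_le G hsr)
        g (fun z => by rw [abs_of_nonneg (hg0 z)]; exact hg1 z)
      have hA0 : 0 ≤ piExp σ (fun x : Fin M → _ => g (pairArray segHit x)) := by
        rw [← piExp_const (ι := Fin M) h1 0]
        exact piExp_mono h0 fun x => hg0 _
      have hA1 : piExp σ (fun x : Fin M → _ => g (pairArray segHit x)) ≤ 1 := by
        rw [← piExp_const (ι := Fin M) h1 1]
        exact piExp_mono h0 fun x => hg1 _
      -- The excess is the Bernoulli approximation error plus the loss `1 - (1 - η)^M ≤ Mη` from the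
      -- gaps.
      rw [Finset.sum_sub_distrib, hB]
      have h4 := (abs_le.1 hAB).1
      have h5 := mul_le_mul_of_nonneg_right hM hA0
      have h6 : M * η * piExp σ (fun x : Fin M → _ => g (pairArray segHit x)) ≤ M * η :=
        mul_le_of_le_one_right (by positivity) hA1
      linarith)
  refine ⟨Q, hQ, hQle.trans ?_⟩
  have : IsProbabilityMeasure Q := by
    constructor
    have h2 : Q Set.univ = Q.map Prod.fst Set.univ := by
      rw [Measure.map_apply measurable_fst MeasurableSet.univ, Set.preimage_univ]
    rw [h2, hQ.1, measure_univ]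
  exact measureReal_mono fun w hw i j hi hij hj => pathZ_eq_cloudZ hsr hw hi hij hj

end Segment

/-! ### The scale of the coupling and the limit -/

section Bound

variable {V : Type*} [Fintype V] [DecidableEq V] [MeasurableSpace V] [MeasurableSingletonClass V]
  (G : SimpleGraph V) [DecidableRel G.Adj] [Nonempty V] [hG : SymmWalk G]

/-- From `-ln(1 - q) ≥ q`. It turns a lower bound on the hitting probability into an upper bound on
the number `T / c` of segments. -/
theorem sq_cutScale {r s : ℕ} (h : cutHit G r s < 1) : cutHit G r s ≤ cutScale G r s ^ 2 := by
  have h1 := exp_neg_cutScale_sq G h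
  have h2 := Real.add_one_le_exp (-cutScale G r s ^ 2)
  linarith

/-- The constant in the lower bound for the hitting probability. -/
def hitConst (θ : ℝ) : ℝ := (1 / (8 * (θ + 1)) / 4) ^ 2 / (4 * (θ + 1))

theorem hitConst_pos {θ : ℝ} (hθ : 0 < θ) : 0 < hitConst θ := by
  unfold hitConst; positivity

/-- Here `C = θ + 1`, since `5/4 r² ≤ n` makes the return sum beyond mixing at most `1`. The
condition `16 (θ + 1) s ≤ r` makes the edge term `2sr` at most half of `r²/(4C)`, so avoidance has
probability at least `1/(8C)`. -/
theorem hitConst_mul_le_cutHit {r s : ℕ} {θ : ℝ} (hθ0 : 0 < θ)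
    (hθ : ∀ x, returnSum G (mixTime G) x ≤ θ) (hmix : mixTime G ≠ 0) (hr0 : 0 < r)
    (hrn : 5 / 4 * (r : ℝ) ^ 2 ≤ Fintype.card V) (hs6 : 6 * s ≤ r)
    (hsr : 16 * (θ + 1) * s ≤ r) :
    hitConst θ * (r ^ 2 * (Fintype.card V : ℝ)⁻¹) ≤ cutHit G r s := by
  have hn : (0 : ℝ) < Fintype.card V := by exact_mod_cast Fintype.card_pos
  have hr : (0 : ℝ) < r := by exact_mod_cast hr0
  have hC0 : 0 < θ + 1 := by linarith
  have hC : ∀ x, ∑ i ∈ Finset.range r, ∑ j ∈ Finset.range r, transProb G (i + j) x x ≤ θ + 1 := by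
    intro x
    refine (sum_transProb_le G hmix x).trans (add_le_add (hθ x) ?_)
    rw [← mul_assoc, ← div_eq_mul_inv, div_le_one hn]
    linarith
  refine le_cutHit G hC0 hC hs6 (by positivity) ?_
  have h1 := le_statWalk_avoid G (s := s) hC0 hC
  have h2 : 2 * (s : ℝ) * r ≤ r ^ 2 * (1 / (8 * (θ + 1))) := by
    rw [mul_one_div, le_div_iff₀ (by positivity)]
    nlinarith
  have h3 : (r : ℝ) ^ 2 / (4 * (θ + 1)) = 2 * (r ^ 2 * (1 / (8 * (θ + 1)))) := by
    field_simp
    norm_num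
  have h4 : (r : ℝ) ^ 2 * (1 / (8 * (θ + 1))) ≤ r ^ 2 * (statWalk G).real (avoid s s) := by
    linarith
  exact le_of_mul_le_mul_left h4 (by positivity)

/-- The constant in the error bound of the coupling up to time `T`. -/
def errConst (θ T : ℝ) : ℝ :=
  T / √(hitConst θ) + 32 * (T / √(hitConst θ)) ^ 3 + 4 * (T / √(hitConst θ)) ^ 2

theorem exists_isCoupling_bound {r s : ℕ} {θ T : ℝ} (hθ0 : 0 < θ) (hT : 0 ≤ T)
    (hθ : ∀ x, returnSum G (mixTime G) x ≤ θ) (hmix : mixTime G ≠ 0) (hr0 : 0 < r)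
    (hrn : 5 / 4 * (r : ℝ) ^ 2 ≤ Fintype.card V) (hs6 : 6 * s ≤ r)
    (hsr : 16 * (θ + 1) * s ≤ r)
    (hs : ∀ x y, (1 - (Fintype.card V : ℝ)⁻¹) * (Fintype.card V : ℝ)⁻¹ ≤ transProb G s x y)
    (ρ : V) {Ω : Type*} [MeasurableSpace Ω] (P : Measure Ω) [IsProbabilityMeasure P]
    (Pi : Ω → Set (ℝ × ℝ)) (hPi : IsPoissonProcess Pi (volume.restrict octant) P) :
    ∃ Q : Measure ((ℕ → V) × Ω), IsCoupling Q (walkFrom G ρ) P ∧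
      1 - errConst θ T * (r / √(Fintype.card V : ℝ) + s / r)
        ≤ Q.real {w | ∀ i j : ℕ, 1 ≤ i → i < j → j ≤ ⌊T / cutScale G r s⌋₊ →
          pathZ r s w.1 i j = cloudZ (cutScale G r s) (Pi w.2) i j} := by
  have hn : (0 : ℝ) < Fintype.card V := by exact_mod_cast Fintype.card_pos
  have hn1 : (1 : ℝ) ≤ Fintype.card V := by exact_mod_cast Fintype.card_pos
  have hr : (1 : ℝ) ≤ r := by exact_mod_cast hr0
  set x : ℝ := r / √(Fintype.card V : ℝ) with hx
  have hx0 : 0 < x := div_pos (by linarith) (Real.sqrt_pos.2 hn)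
  have hx2 : x ^ 2 = r ^ 2 * (Fintype.card V : ℝ)⁻¹ := by
    rw [hx, div_pow, Real.sq_sqrt hn.le, div_eq_mul_inv]
  have ha := hitConst_pos hθ0
  have hlow := hitConst_mul_le_cutHit G hθ0 hθ hmix hr0 hrn hs6 hsr
  have hup := cutHit_le G (show s ≤ r by omega)
  rw [← hx2] at hlow hup
  have hx1 : x ^ 2 < 1 := by
    rw [hx2, ← div_eq_mul_inv, div_lt_one hn]
    nlinarith
  have hcut : cutHit G r s < 1 := hup.trans_lt hx1
  have hc2 := hlow.trans (sq_cutScale G hcut)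
  have hc0 : 0 ≤ cutScale G r s := Real.sqrt_nonneg _
  have hcx : √(hitConst θ) * x ≤ cutScale G r s := by
    refine le_of_sq_le_sq ?_ hc0
    rw [mul_pow, Real.sq_sqrt ha.le]
    exact hc2
  have hsx : 0 < √(hitConst θ) * x := mul_pos (Real.sqrt_pos.2 ha) hx0
  have hc : 0 < cutScale G r s := hsx.trans_le hcx
  set M := ⌊T / cutScale G r s⌋₊ with hM
  set B := T / √(hitConst θ) with hB
  have hB0 : 0 ≤ B := div_nonneg hT (Real.sqrt_nonneg _)
  -- The scale `c` is at least `√(hitConst θ) * x`, so `M` is at most `B / x`; every error term is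
  -- then a power of `M * x` times a small factor.
  have hMx : (M : ℝ) * x ≤ B := by
    have h1 : (M : ℝ) ≤ T / (√(hitConst θ) * x) :=
      (Nat.floor_le (div_nonneg hT hc0)).trans (div_le_div_of_nonneg_left hT hsx hcx)
    rw [← div_div, ← hB, le_div_iff₀ hx0] at h1
    exact h1
  obtain ⟨Q, hQ, hQle⟩ := exists_isCoupling_walk_poisson G (inv_nonneg.2 hn.le)
    (inv_le_one_of_one_le₀ hn1) (show 2 * s ≤ r by omega) hs hcut hc ρ P Pi hPi M
  refine ⟨Q, hQ, le_trans ?_ hQle⟩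
  have hMx0 : 0 ≤ (M : ℝ) * x := by positivity
  have hy0 : 0 ≤ (s : ℝ) / r := by positivity
  have h1 : M * (Fintype.card V : ℝ)⁻¹ ≤ B * x := by
    have h2 : (Fintype.card V : ℝ)⁻¹ ≤ x * x := by
      rw [← sq, hx2]
      exact le_mul_of_one_le_left (inv_nonneg.2 hn.le) (by nlinarith)
    calc M * (Fintype.card V : ℝ)⁻¹ ≤ M * (x * x) := mul_le_mul_of_nonneg_left h2 (by positivity)
      _ = M * x * x := by ring
      _ ≤ B * x := mul_le_mul_of_nonneg_right hMx hx0.le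
  have h2 : (M : ℝ) ^ 2 * (2 * (2 * (s * r) * (Fintype.card V : ℝ)⁻¹)) ≤ 4 * B ^ 2 * (s / r) := by
    have h3 : (s : ℝ) * r * (Fintype.card V : ℝ)⁻¹ = s / r * x ^ 2 := by
      rw [hx2]; field_simp
    calc _ = 4 * (M * x) ^ 2 * (s / r) := by rw [mul_assoc 2 (_ * _), h3]; ring
      _ ≤ _ := by gcongr
  have h3 : (M : ℝ) ^ 2 * (32 * M * (r ^ 2 * (Fintype.card V : ℝ)⁻¹) ^ 2) ≤ 32 * B ^ 3 * x := by
    rw [← hx2]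
    calc _ = 32 * (M * x) ^ 3 * x := by ring
      _ ≤ _ := by gcongr
  have h4 : 0 ≤ B ^ 3 * (s / r : ℝ) := by positivity
  have h5 : 0 ≤ B ^ 2 * x := by positivity
  have h6 : 0 ≤ B * (s / r : ℝ) := by positivity
  have h7 : errConst θ T * (x + s / r) = B * x + 32 * B ^ 3 * x + 4 * (B ^ 2 * x)
      + B * (s / r) + 32 * (B ^ 3 * (s / r)) + 4 * B ^ 2 * (s / r) := by
    simp only [errConst, ← hB]
    ring
  rw [h7, mul_add]
  linarith

end Bound

theorem one_le_logSize (V : Type*) [Fintype V] [Nontrivial V] : 1 ≤ logSize V := by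
  have h : (2 : ℝ) ≤ Fintype.card V := by exact_mod_cast Fintype.one_lt_card (α := V)
  rw [logSize, one_le_div (Real.log_pos (by norm_num))]
  exact Real.log_le_log (by norm_num) (by linarith)

/-- By definition `4 ^ logSize` is twice the number of vertices, so `⌊logSize⌋ + 1` mixing times
suffice for a relative error `1/n`. -/
theorem quarter_pow_le_inv_card (V : Type*) [Fintype V] [Nonempty V] :
    (1 / 4 : ℝ) ^ (⌊logSize V⌋₊ + 1) ≤ (Fintype.card V : ℝ)⁻¹ := by
  have hn : (0 : ℝ) < Fintype.card V := by exact_mod_cast Fintype.card_pos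
  rw [one_div, inv_pow]
  refine inv_anti₀ hn ?_
  have h1 : logSize V ≤ (⌊logSize V⌋₊ + 1 : ℕ) := by
    push_cast; exact (Nat.lt_floor_add_one _).le
  rw [logSize, div_le_iff₀ (Real.log_pos (by norm_num)), ← Real.log_pow] at h1
  have h2 := (Real.log_le_log_iff (by positivity) (by positivity)).1 h1
  unfold logSize
  linarith

theorem isCoupling_prod {X Y : Type*} [MeasurableSpace X] [MeasurableSpace Y] (μ : Measure X)
    (ν : Measure Y) [IsProbabilityMeasure μ] [IsProbabilityMeasure ν] :
    IsCoupling (μ.prod ν) μ ν :=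
  ⟨by simp, by simp⟩

theorem IsCoupling.isProbabilityMeasure {X Y : Type*} [MeasurableSpace X] [MeasurableSpace Y]
    {Q : Measure (X × Y)} {μ : Measure X} {ν : Measure Y} [IsProbabilityMeasure μ]
    (h : IsCoupling Q μ ν) : IsProbabilityMeasure Q := by
  constructor
  have h1 : Q Set.univ = Q.map Prod.fst Set.univ := by
    rw [Measure.map_apply measurable_fst MeasurableSet.univ, Set.preimage_univ]
  rw [h1, h.1, measure_univ]

end CutCoupling

end

/-! ### Passage to the limit along the sequence of graphs. -/

theorem mainTheorem5
    {V : ℕ → Type*} [∀ N, Fintype (V N)] [∀ N, DecidableEq (V N)] [∀ N, Nontrivial (V N)]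
    [∀ N, MeasurableSpace (V N)] [∀ N, MeasurableSingletonClass (V N)]
    (G : (N : ℕ) → SimpleGraph (V N)) [∀ N, DecidableRel (G N).Adj]
    (hconn : ∀ N, (G N).Connected)
    (hreg : ∀ N, ∃ d : ℕ, (G N).IsRegularOfDegree d)
    (s' s r : ℕ → ℕ)
    (hmix : (fun _ : ℕ => (1 : ℝ)) =o[atTop]
      fun N => CutCoupling.logSize (V N) ^ 2 * (CutCoupling.mixTime (G N) : ℝ))
    (hmix_s' : (fun N => CutCoupling.logSize (V N) ^ 2 * (CutCoupling.mixTime (G N) : ℝ)) =o[atTop]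
      fun N => CutCoupling.logSize (V N) * (s' N : ℝ))
    (hs'_s : (fun N => CutCoupling.logSize (V N) * (s' N : ℝ)) =o[atTop] fun N => (s N : ℝ))
    (hs_r : (fun N => (s N : ℝ)) =o[atTop] fun N => (r N : ℝ))
    (hr_V : (fun N => (r N : ℝ)) =o[atTop] fun N => √(Fintype.card (V N) : ℝ))
    (htrans : ∃ θ : ℝ, 0 < θ ∧ ∀ N, 1 ≤ N → ∀ x : V N,
      CutCoupling.returnSum (G N) (CutCoupling.mixTime (G N)) x ≤ θ)
    (ρ : (N : ℕ) → V N)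
    {Ω : Type*} [MeasurableSpace Ω] (P : Measure Ω) [IsProbabilityMeasure P]
    (Pi : Ω → Set (ℝ × ℝ))
    (hPi : CutCoupling.IsPoissonProcess Pi (volume.restrict CutCoupling.octant) P)
    (T : ℝ) (hT : 0 ≤ T) :
    ∃ Q : (N : ℕ) → Measure ((ℕ → V N) × Ω),
      (∀ N, CutCoupling.IsCoupling (Q N)
        (CutCoupling.walkLaw (G N) (Measure.dirac (ρ N))) P) ∧
      Tendsto (fun N => (Q N).real {w | ∀ i j : ℕ, 1 ≤ i → i < j →
          j ≤ ⌊T / CutCoupling.cutScale (G N) (r N) (s N)⌋₊ →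
          CutCoupling.pathZ (r N) (s N) w.1 i j =
            CutCoupling.cloudZ (CutCoupling.cutScale (G N) (r N) (s N)) (Pi w.2) i j})
        atTop (𝓝 1) := by

  obtain ⟨θ, hθ0, hθ⟩ := htrans
  have hsymm : ∀ N, CutCoupling.SymmWalk (G N) := fun N =>
    CutCoupling.symmWalk_of_regular (G N) (hconn N) (hreg N)
  have hls := hmix_s'.trans hs'_s
  have h1r := (hmix.trans hls).trans hs_r
  have hx := hr_V.tendsto_div_nhds_zero
  have hy := hs_r.tendsto_div_nhds_zero
  let good (N : ℕ) (Q : Measure ((ℕ → V N) × Ω)) : Prop :=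
    CutCoupling.IsCoupling Q (CutCoupling.walkLaw (G N) (Measure.dirac (ρ N))) P ∧
    1 - CutCoupling.errConst θ T * ((r N : ℝ) / √(Fintype.card (V N) : ℝ) + (s N : ℝ) / r N)
      ≤ Q.real {w | ∀ i j : ℕ, 1 ≤ i → i < j →
        j ≤ ⌊T / CutCoupling.cutScale (G N) (r N) (s N)⌋₊ →
        CutCoupling.pathZ (r N) (s N) w.1 i j =
          CutCoupling.cloudZ (CutCoupling.cutScale (G N) (r N) (s N)) (Pi w.2) i j}
  have hgood : ∀ᶠ N in atTop, ∃ Q, good N Q := by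
    have e1 := hmix.bound (c := 1) one_pos
    have e2 := hls.bound (c := 1 / 2) (by norm_num)
    have e3 := h1r.bound (c := 1) one_pos
    have e4 := hs_r.bound (c := 1 / (16 * (θ + 1))) (by positivity)
    have e5 := hr_V.bound (c := 1 / 2) (by norm_num)
    filter_upwards [e1, e2, e3, e4, e5, eventually_ge_atTop 1] with N h1 h2 h3 h4 h5 hN
    have hsN := hsymm N
    have hn : (0 : ℝ) < Fintype.card (V N) := by exact_mod_cast Fintype.card_pos
    simp only [Real.norm_eq_abs, abs_one, one_mul, Nat.abs_cast] at h1 h2 h3 h4 h5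
    have hmixN : CutCoupling.mixTime (G N) ≠ 0 := by
      intro h0
      rw [h0] at h1
      norm_num at h1
    rw [abs_of_nonneg (by positivity)] at h2
    rw [abs_of_nonneg (Real.sqrt_nonneg _)] at h5
    have hsr : 16 * (θ + 1) * (s N : ℝ) ≤ r N := by
      rw [one_div, inv_mul_eq_div, le_div_iff₀ (by positivity)] at h4
      linarith
    have hs6 : 6 * s N ≤ r N := by
      have : (6 : ℝ) * s N ≤ r N := by nlinarith [Nat.cast_nonneg (α := ℝ) (s N)]
      exact_mod_cast this
    have hrn : 5 / 4 * (r N : ℝ) ^ 2 ≤ Fintype.card (V N) := by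
      have := mul_self_le_mul_self (Nat.cast_nonneg (r N)) h5
      have h6 := Real.mul_self_sqrt hn.le
      nlinarith
    -- With `L = logSize ≥ 1` one has `⌊L⌋ + 1 ≤ 2L²`, and the constant `1/2` in `e2` absorbs the
    -- factor `2`.
    have hgap : (⌊CutCoupling.logSize (V N)⌋₊ + 1) * CutCoupling.mixTime (G N) ≤ s N := by
      have h6 := CutCoupling.one_le_logSize (V N)
      have h7 := Nat.floor_le (zero_le_one.trans h6)
      have h8 : ((⌊CutCoupling.logSize (V N)⌋₊ : ℝ) + 1) ≤ 2 * CutCoupling.logSize (V N) ^ 2 := by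
        nlinarith
      have h9 := mul_le_mul_of_nonneg_right h8
        (Nat.cast_nonneg (α := ℝ) (CutCoupling.mixTime (G N)))
      have : (((⌊CutCoupling.logSize (V N)⌋₊ + 1) * CutCoupling.mixTime (G N) : ℕ) : ℝ) ≤ s N := by
        push_cast
        linarith
      exact_mod_cast this
    refine CutCoupling.exists_isCoupling_bound (G N) hθ0 hT (hθ N hN) hmixN
      (by exact_mod_cast (zero_lt_one.trans_le h3 : (0 : ℝ) < r N)) hrn hs6 hsr
      (fun x y => le_trans ?_ (CutCoupling.le_transProb (G N) hmixN hgap x y)) (ρ N) P Pi hPi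
    exact mul_le_mul_of_nonneg_right
      (sub_le_sub_left (CutCoupling.quarter_pow_le_inv_card (V N)) 1) (inv_nonneg.2 hn.le)
  -- A coupling must be given for every `N`; where the quantitative one is not available, the
  -- product measure serves.
  have hex : ∀ N, ∃ Q : Measure ((ℕ → V N) × Ω),
      CutCoupling.IsCoupling Q (CutCoupling.walkLaw (G N) (Measure.dirac (ρ N))) P ∧
      ((∃ Q, good N Q) → good N Q) := by
    intro N
    by_cases h : ∃ Q, good N Q
    · obtain ⟨Q, hQ⟩ := h
      exact ⟨Q, hQ.1, fun _ => hQ⟩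
    · exact ⟨_, CutCoupling.isCoupling_prod _ _, fun h' => absurd h' h⟩
  choose Q hQ hQb using hex
  refine ⟨Q, hQ, ?_⟩
  have hlim : Tendsto (fun N => 1 - CutCoupling.errConst θ T *
      ((r N : ℝ) / √(Fintype.card (V N) : ℝ) + (s N : ℝ) / r N)) atTop (𝓝 1) := by
    simpa using ((hx.add hy).const_mul (CutCoupling.errConst θ T)).const_sub 1
  refine tendsto_of_tendsto_of_tendsto_of_le_of_le' hlim tendsto_const_nhds ?_ ?_
  · filter_upwards [hgood] with N hN using (hQb N hN).2
  · refine Eventually.of_forall fun N => ?_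
    have := (hQ N).isProbabilityMeasure
    exact measureReal_le_one
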